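/- **Setting.** Let $N\ge 1$ be square-free, $k\ge 4$ an integer, and $\chi$ a Dirichlet character modulo $N$ with $\chi(-1)=(-1)^k$. For $d\mid N$ let $\chi_d$ be the component of $\chi$ modulo $d$, so $\chi=\chi_d\,\chi_{N/d}$. Write elements of $Sp_2(\mathbb Z)$ (the $4\times4$ integral symplectic matrices) in $2\times 2$ blocks $\gamma=\begin{pmatrix}A_\gamma&B_\gamma\\C_\gamma&D_\gamma\end{pmatrix}$; put $\Gamma_\infty=\{\gamma: C_\gamma=0\}$ and $\Gamma_0(N)=\{\gamma: C_\gamma\equiv0\ (N)\}$. Let $\mathfrak h$ be the space of complex symmetric $2\times2$ matrices $\tau$ with positive definite imaginary part. For $\gamma_0\in Sp_2(\mathbb Z)$ such that $\chi_q^2=1$ whenever $q\mid N$ is a prime for which $C_{\gamma_0}$ has rank $1$ modulo $q$, put $$\mathbb E_{\gamma_0}(\tau)=\sum_{\gamma}\overline\chi(\det D_\gamma)\,\det(C_{\gamma_0\gamma}\tau+D_{\gamma_0\gamma})^{-k}\qquad(\tau\in\mathfrak h),$$ where $\gamma$ runs over elements of $\Gamma_0(N)$ such that $\Gamma_\infty\gamma_0\gamma$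 runs once through the $\Gamma_0(N)$-orbit of $\Gamma_\infty\gamma_0$. Let $\mathrm{Eis}^{(2)}_k(N,\chi)$ be the complex span of these functions. For $N_0N_1N_2=N$ let $\mathbb E_{(N_0,N_1,N_2)}=\mathbb E_{\gamma_\rho}$ with $\gamma_\rho=\begin{pmatrix}I&0\\M_\rho&I\end{pmatrix}$, where $M_\rho$ is an integral diagonal matrix with $M_\rho\equiv0\ (N_0)$, $M_\rho\equiv\mathrm{diag}(1,0)\ (N_1)$, $M_\rho\equiv I\ (N_2)$. For a real matrix $g=\begin{pmatrix}A&B\\C&D\end{pmatrix}$ that is a symplectic similitude with positive multiplier, put $(f|g)(\tau)=(\det g)^{k/2}\det(C\tau+D)^{-k}f((A\tau+B)(C\tau+D)^{-1})$. For a prime $q$ and a function $f$ on $\mathfrak h$ with $f|\gamma=\chi(\det D_\gamma)f$ for all $\gamma\in\Gamma_0(N)$, the Hecke operators $T(q)$ (with $\delta=\mathrm{diag}(q,q,1,1)$) and $T_1(q^2)$ (with $\delta=\mathrm{diag}(q,1,q^{-1},1)$) map $f$ to $$q^{k-3}\sum_\gamma\overline\chi(\det D_\gamma)\,f|\delta^{-1}\gamma,$$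 $\gamma$ running over representatives of $(\delta\Gamma_0(N)\delta^{-1}\cap\Gamma_0(N))\backslash\Gamma_0(N)$. For a prime $q\mid N$ with $\chi_q=1$ put $c(q)=\dfrac{q^2}{(q-1)(\chi_{N/q}(q)q^k-1)}$ and $$S_1(q)=c(q)\left[T_1(q^2)-q^{-1}(q+1)T(q)-q^{-1}(q^2-1)\right],$$ $$S_2(q)=c(q)\left[(\chi_{N/q}(q)q^{k-1}+1)T(q)-T_1(q^2)-q(\chi_{N/q}(q)q^{k-2}-1)\right];$$ for a prime $q\mid N$ with $\chi_q\ne1$, $\chi_q^2=1$ put $$S_2(q)=\left(\frac{-1}{q}\right)\frac{q^2}{q-1}\left[T(q)-1\right].$$ Extend multiplicatively: $S_i(n)=\prod_{q\mid n}S_i(q)$ for $n\mid N$ (operators act from the right). **Theorem.** If $N_0N_1N_2=N$, $\chi_{N_1}=1$ and $\chi_{N_2}^2=1$, then $$\mathbb E_{(N_0,N_1,N_2)}=\mathbb E_{(N,1,1)}\,|\,S_1(N_1)S_2(N_2),$$ for every order of the prime factors in the product $S_1(N_1)$ and in the product $S_2(N_2)$. In particular, if $\chi=1$, then the functions $\mathbb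 E_{(N,1,1)}|S_1(N_1)S_2(N_2)$, one for each pair of positive integers $(N_1,N_2)$ with $N_1N_2\mid N$, form a basis of $\mathrm{Eis}^{(2)}_k(N,1)$. -/

import Mathlib

open Matrix

noncomputable section

namespace SiegelEisenstein

/-- The group `Sp₂(ℤ)` of `4 × 4` integral symplectic matrices, in `2 × 2` blocks. -/
abbrev Sp2Z : Type := Matrix.symplecticGroup (Fin 2) ℤ

/-- Real `4 × 4` matrices in `2 × 2` blocks. -/
abbrev Mat4R : Type := Matrix (Fin 2 ⊕ Fin 2) (Fin 2 ⊕ Fin 2) ℝ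

/-- An integral symplectic matrix, viewed as a real matrix. -/
def toReal (γ : Sp2Z) : Mat4R := γ.1.map (Int.cast : ℤ → ℝ)

theorem toReal_one : toReal 1 = 1 := by
  simp [toReal]

theorem toReal_mul (γ γ' : Sp2Z) : toReal (γ * γ') = toReal γ * toReal γ' := by
  simpa [toReal] using Matrix.map_mul (f := Int.castRingHom ℝ) (L := γ.1) (M := γ'.1)

/-- The lower left block `C` of `γ = (A B; C D)`. -/
def blockC (γ : Sp2Z) : Matrix (Fin 2) (Fin 2) ℤ := γ.1.toBlocks₂₁

/-- The lower right block `D` of `γ = (A B; C D)`. -/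
def blockD (γ : Sp2Z) : Matrix (Fin 2) (Fin 2) ℤ := γ.1.toBlocks₂₂

theorem blockC_mul (γ γ' : Sp2Z) :
    blockC (γ * γ') = blockC γ * γ'.1.toBlocks₁₁ + blockD γ * blockC γ' := by
  ext i j
  simp [blockC, blockD, Matrix.mul_apply, toBlocks₂₁, toBlocks₂₂, toBlocks₁₁]

theorem blockC_inv (γ : Sp2Z) : blockC γ⁻¹ = -(blockC γ)ᵀ := by
  have h := SymplecticGroup.coe_inv γ
  rw [← fromBlocks_toBlocks (γ : Matrix (Fin 2 ⊕ Fin 2) (Fin 2 ⊕ Fin 2) ℤ), Matrix.J,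
    fromBlocks_transpose, fromBlocks_neg, fromBlocks_multiply, fromBlocks_multiply] at h
  rw [blockC, h]
  simp [blockC]

/-- `Γ₀(N)`: the elements of `Sp₂(ℤ)` whose lower left block is `≡ 0` modulo `N`. -/
def Gamma0 (N : ℕ) : Subgroup Sp2Z where
  carrier := {γ | ∀ i j, (N : ℤ) ∣ blockC γ i j}
  one_mem' := by
    intro i j
    simp [blockC, toBlocks₂₁]
  mul_mem' := by
    intro a b ha hb i j
    rw [blockC_mul, Matrix.add_apply, Matrix.mul_apply, Matrix.mul_apply]
    exact dvd_add (Finset.dvd_sum fun l _ => Dvd.dvd.mul_right (ha i l) _)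
      (Finset.dvd_sum fun l _ => Dvd.dvd.mul_left (hb l j) _)
  inv_mem' := by
    intro a ha i j
    rw [blockC_inv, Matrix.neg_apply, Matrix.transpose_apply]
    exact (dvd_neg).2 (ha j i)

/-- `Γ_∞`: the elements of `Sp₂(ℤ)` whose lower left block is `0`. -/
def GammaInf : Subgroup Sp2Z where
  carrier := {γ | blockC γ = 0}
  one_mem' := by
    ext i j
    simp [blockC, toBlocks₂₁]
  mul_mem' := by
    intro a b ha hb
    simp only [Set.mem_ofPred_eq] at *
    rw [blockC_mul, ha, hb]
    simp
  inv_mem' := by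
    intro a ha
    simp only [Set.mem_ofPred_eq] at *
    rw [blockC_inv, ha]
    simp

/-- The Siegel upper half-space of degree 2. -/
def UpperHalf : Type :=
  {τ : Matrix (Fin 2) (Fin 2) ℂ // τ.IsSymm ∧ (τ.map Complex.im).PosDef}

/-- `C τ + D` for `g = (A B; C D)`. -/
def denom (g : Mat4R) (τ : UpperHalf) : Matrix (Fin 2) (Fin 2) ℂ :=
  g.toBlocks₂₁.map Complex.ofReal * τ.1 + g.toBlocks₂₂.map Complex.ofReal

/-- `g ∘ τ = (A τ + B) (C τ + D)⁻¹` for `g = (A B; C D)`. -/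
def moebius (g : Mat4R) (τ : UpperHalf) : Matrix (Fin 2) (Fin 2) ℂ :=
  (g.toBlocks₁₁.map Complex.ofReal * τ.1 + g.toBlocks₁₂.map Complex.ofReal) * (denom g τ)⁻¹

open scoped ComplexOrder in
/-- The action of a symplectic similitude with positive multiplier preserves the upper
half-space. -/
theorem moebius_mem (g : Mat4R) (ν : ℝ) (hν : 0 < ν)
    (hg : gᵀ * Matrix.J (Fin 2) ℝ * g = ν • Matrix.J (Fin 2) ℝ) (τ : UpperHalf) :
    (moebius g τ).IsSymm ∧ ((moebius g τ).map Complex.im).PosDef := by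
  obtain ⟨Z, hZs, hZp⟩ := τ
  set c : Matrix (Fin 2) (Fin 2) ℝ → Matrix (Fin 2) (Fin 2) ℂ := fun M => M.map Complex.ofReal
    with hc
  have cmul : ∀ M L, c (M * L) = c M * c L := fun M L =>
    Matrix.map_mul (f := Complex.ofRealHom) (L := M) (M := L)
  have csub : ∀ M L, c (M - L) = c M - c L := fun M L => by
    ext i j
    simp [hc]
  have cT : ∀ M, c Mᵀ = (c M)ᵀ := fun M => rfl
  have cH : ∀ M, (c M)ᴴ = (c M)ᵀ := fun M => by
    ext i j
    simp [hc]
  rw [← fromBlocks_toBlocks g, Matrix.J, fromBlocks_transpose, fromBlocks_multiply,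
    fromBlocks_multiply, fromBlocks_smul, fromBlocks_inj] at hg
  simp only [moebius, denom]
  set A := g.toBlocks₁₁
  set B := g.toBlocks₁₂
  set C := g.toBlocks₂₁
  set D := g.toBlocks₂₂
  obtain ⟨h1, h2, -, h4⟩ := hg
  simp only [Matrix.mul_zero, Matrix.mul_one, Matrix.mul_neg, zero_add, add_zero, smul_zero,
    Matrix.neg_mul, smul_neg] at h1 h2 h4
  have e1 : (c C)ᵀ * c A = (c A)ᵀ * c C := by
    rw [← cT, ← cT, ← cmul, ← cmul]
    congr 1
    exact eq_of_sub_eq_zero (by rw [sub_eq_add_neg]; exact h1)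
  have e4 : (c D)ᵀ * c B = (c B)ᵀ * c D := by
    rw [← cT, ← cT, ← cmul, ← cmul]
    congr 1
    exact eq_of_sub_eq_zero (by rw [sub_eq_add_neg]; exact h4)
  have e2 : (c A)ᵀ * c D - (c C)ᵀ * c B = (ν : ℂ) • 1 := by
    rw [← cT, ← cT, ← cmul, ← cmul, ← csub]
    have : Aᵀ * D - Cᵀ * B = ν • 1 := by
      rw [← neg_inj, ← h2]
      abel
    rw [this]
    ext i j
    by_cases hij : i = j <;> simp [hc, hij]
  have e3 : (c D)ᵀ * c A - (c B)ᵀ * c C = (ν : ℂ) • 1 := by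
    have := congrArg Matrix.transpose e2
    simpa using this
  change ((c A * Z + c B) * (c C * Z + c D)⁻¹).IsSymm ∧
    (((c A * Z + c B) * (c C * Z + c D)⁻¹).map Complex.im).PosDef
  set P := c A * Z + c B with hP
  set Q := c C * Z + c D with hQ
  have hZs' : Zᵀ = Z := hZs
  have hPQ : Pᵀ * Q = Qᵀ * P := by
    rw [hP, hQ]
    simp only [Matrix.transpose_add, Matrix.transpose_mul, hZs', Matrix.add_mul, Matrix.mul_add]
    have t1 : Z * (c A)ᵀ * (c C * Z) = Z * (c C)ᵀ * (c A * Z) := by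
      calc Z * (c A)ᵀ * (c C * Z) = Z * ((c A)ᵀ * c C) * Z := by simp only [Matrix.mul_assoc]
        _ = _ := by rw [← e1]; simp only [Matrix.mul_assoc]
    have t2 : Z * (c A)ᵀ * c D = Z * (c C)ᵀ * c B + (ν : ℂ) • Z := by
      have : (c A)ᵀ * c D = (c C)ᵀ * c B + (ν : ℂ) • 1 := by rw [← e2]; abel
      rw [Matrix.mul_assoc, this]
      simp [Matrix.mul_add, Matrix.mul_assoc]
    have t3 : (c D)ᵀ * (c A * Z) = (c B)ᵀ * (c C * Z) + (ν : ℂ) • Z := by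
      have : (c D)ᵀ * c A = (c B)ᵀ * c C + (ν : ℂ) • 1 := by rw [← e3]; abel
      rw [← Matrix.mul_assoc, this]
      simp [Matrix.add_mul, Matrix.mul_assoc]
    rw [t1, t2, t3, e4]
    abel
  have hH : Qᴴ * P - Pᴴ * Q = (ν : ℂ) • (Z - Zᴴ) := by
    rw [hP, hQ]
    simp only [Matrix.conjTranspose_add, Matrix.conjTranspose_mul, cH, Matrix.add_mul,
      Matrix.mul_add]
    have t1 : Zᴴ * (c A)ᵀ * (c C * Z) = Zᴴ * (c C)ᵀ * (c A * Z) := by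
      calc Zᴴ * (c A)ᵀ * (c C * Z) = Zᴴ * ((c A)ᵀ * c C) * Z := by simp only [Matrix.mul_assoc]
        _ = _ := by rw [← e1]; simp only [Matrix.mul_assoc]
    have t2 : Zᴴ * (c A)ᵀ * c D = Zᴴ * (c C)ᵀ * c B + (ν : ℂ) • Zᴴ := by
      have : (c A)ᵀ * c D = (c C)ᵀ * c B + (ν : ℂ) • 1 := by rw [← e2]; abel
      rw [Matrix.mul_assoc, this]
      simp [Matrix.mul_add, Matrix.mul_assoc]
    have t3 : (c D)ᵀ * (c A * Z) = (c B)ᵀ * (c C * Z) + (ν : ℂ) • Z := by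
      have : (c D)ᵀ * c A = (c B)ᵀ * c C + (ν : ℂ) • 1 := by rw [← e3]; abel
      rw [← Matrix.mul_assoc, this]
      simp [Matrix.add_mul, Matrix.mul_assoc]
    rw [t1, t2, t3, e4, smul_sub]
    abel
  -- the imaginary part, as a complex matrix
  have hYc : ∀ W : Matrix (Fin 2) (Fin 2) ℂ, Wᵀ = W →
      W - Wᴴ = (2 * Complex.I) • c (W.map Complex.im) := by
    intro W hW
    ext i j
    have hji : W j i = W i j := by
      conv_rhs => rw [← hW]
      rfl
    simp only [Matrix.sub_apply, Matrix.conjTranspose_apply, hji, Matrix.smul_apply, hc,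
      Matrix.map_apply, smul_eq_mul]
    apply Complex.ext <;> simp
    ring
  have hYp : (c (Z.map Complex.im)).PosDef := by
    rw [Matrix.posDef_iff_dotProduct_mulVec] at hZp ⊢
    refine ⟨?_, ?_⟩
    · ext i j
      have := congrFun (congrFun hZp.1 i) j
      simp only [hc, Matrix.conjTranspose_apply, Matrix.map_apply, star_trivial] at this ⊢
      simp [this]
    · intro x hx
      have key := hZp.2
      have hre : (star x ⬝ᵥ (c (Z.map Complex.im) *ᵥ x)) =
          (((fun i => (x i).re) ⬝ᵥ ((Z.map Complex.im) *ᵥ (fun i => (x i).re)) +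
            (fun i => (x i).im) ⬝ᵥ ((Z.map Complex.im) *ᵥ (fun i => (x i).im)) : ℝ) : ℂ) := by
        have hs : (Z 1 0).im = (Z 0 1).im := by
          have : Z 1 0 = Z 0 1 := congrFun (congrFun hZs' 0) 1
          rw [this]
        apply Complex.ext <;>
          simp [dotProduct, Matrix.mulVec, Fin.sum_univ_two, hc, hs] <;> ring
      rw [hre]
      have hnn : ∀ y : Fin 2 → ℝ, 0 ≤ y ⬝ᵥ ((Z.map Complex.im) *ᵥ y) := by
        intro y
        by_cases hy : y = 0
        · simp [hy]
        · exact le_of_lt (by simpa using key hy)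
      have hpos : 0 < (fun i => (x i).re) ⬝ᵥ ((Z.map Complex.im) *ᵥ (fun i => (x i).re)) +
            (fun i => (x i).im) ⬝ᵥ ((Z.map Complex.im) *ᵥ (fun i => (x i).im)) := by
        by_cases hr : (fun i => (x i).re) = 0
        · have hi : (fun i => (x i).im) ≠ 0 := by
            intro hi
            apply hx
            funext i
            exact Complex.ext (congrFun hr i) (congrFun hi i)
          exact add_pos_of_nonneg_of_pos (hnn _) (by simpa using key hi)
        · exact add_pos_of_pos_of_nonneg (by simpa using key hr) (hnn _)
      exact_mod_cast hpos
  have hQdet : IsUnit Q := by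
    rw [← Matrix.mulVec_injective_iff_isUnit]
    change Function.Injective (Matrix.mulVecLin Q)
    rw [injective_iff_map_eq_zero (Matrix.mulVecLin Q)]
    intro v hv
    have hv' : Q *ᵥ v = 0 := hv
    by_contra hne
    have h0 : star v ⬝ᵥ ((Qᴴ * P - Pᴴ * Q) *ᵥ v) = 0 := by
      rw [Matrix.sub_mulVec, ← Matrix.mulVec_mulVec, ← Matrix.mulVec_mulVec, hv',
        Matrix.mulVec_zero, sub_zero, Matrix.dotProduct_mulVec, ← Matrix.star_mulVec, hv']
      simp
    rw [hH, hYc Z hZs', Matrix.smul_mulVec, Matrix.smul_mulVec, dotProduct_smul,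
      dotProduct_smul] at h0
    have hp := ((Matrix.posDef_iff_dotProduct_mulVec).1 hYp).2 hne
    have : (ν : ℂ) ≠ 0 := by exact_mod_cast hν.ne'
    rw [smul_eq_mul, smul_eq_mul, mul_eq_zero, mul_eq_zero] at h0
    rcases h0 with h0 | h0 | h0
    · exact this h0
    · simp at h0
    · exact hp.ne' h0
  have hQd : IsUnit Q.det := (Matrix.isUnit_iff_isUnit_det Q).1 hQdet
  have hQQ : Q * Q⁻¹ = 1 := Matrix.mul_nonsing_inv Q hQd
  have hsym : (P * Q⁻¹)ᵀ = P * Q⁻¹ := by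
    have hQT : (Q⁻¹)ᵀ * Qᵀ = 1 := by rw [← Matrix.transpose_mul, hQQ, Matrix.transpose_one]
    calc (P * Q⁻¹)ᵀ = (Q⁻¹)ᵀ * Pᵀ * (Q * Q⁻¹) := by
          rw [hQQ, Matrix.mul_one, Matrix.transpose_mul]
      _ = (Q⁻¹)ᵀ * (Pᵀ * Q) * Q⁻¹ := by simp only [Matrix.mul_assoc]
      _ = (Q⁻¹)ᵀ * Qᵀ * (P * Q⁻¹) := by rw [hPQ]; simp only [Matrix.mul_assoc]
      _ = P * Q⁻¹ := by rw [hQT, Matrix.one_mul]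
  refine ⟨hsym, ?_⟩
  have hQH : (Q⁻¹)ᴴ * Qᴴ = 1 := by
    rw [← Matrix.conjTranspose_mul, hQQ, Matrix.conjTranspose_one]
  have hWim : c ((P * Q⁻¹).map Complex.im) =
      (ν : ℂ) • ((Q⁻¹)ᴴ * c (Z.map Complex.im) * Q⁻¹) := by
    have h2I : (2 * Complex.I) ≠ 0 := by simp
    apply smul_right_injective _ h2I
    simp only
    rw [← hYc _ hsym]
    calc P * Q⁻¹ - (P * Q⁻¹)ᴴ
        = (Q⁻¹)ᴴ * Qᴴ * (P * Q⁻¹) - (Q⁻¹)ᴴ * Pᴴ * (Q * Q⁻¹) := by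
          rw [hQH, hQQ, Matrix.one_mul, Matrix.mul_one, Matrix.conjTranspose_mul]
      _ = (Q⁻¹)ᴴ * (Qᴴ * P - Pᴴ * Q) * Q⁻¹ := by
          simp only [Matrix.mul_sub, Matrix.sub_mul, Matrix.mul_assoc]
      _ = _ := by
          rw [hH, hYc Z hZs']
          simp only [Matrix.mul_smul, Matrix.smul_mul, smul_smul]
          rw [mul_comm]
  have hWp : (c ((P * Q⁻¹).map Complex.im)).PosDef := by
    rw [hWim]
    have hinj : Function.Injective (Q⁻¹).mulVec :=
      Matrix.mulVec_injective_iff_isUnit.2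
        ((Matrix.isUnit_iff_isUnit_det _).2 (Matrix.isUnit_nonsing_inv_det _ hQd))
    exact (hYp.conjTranspose_mul_mul_same hinj).smul (by exact_mod_cast hν)
  rw [Matrix.posDef_iff_dotProduct_mulVec] at hWp ⊢
  refine ⟨?_, ?_⟩
  · ext i j
    have := congrFun (congrFun hsym i) j
    rw [Matrix.transpose_apply] at this
    simp only [Matrix.conjTranspose_apply, Matrix.map_apply, star_trivial]
    rw [this]
  · intro x hx
    have hx' : (fun i => (x i : ℂ)) ≠ 0 := by
      intro h
      apply hx
      funext i
      simpa using congrFun h i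
    have := hWp.2 hx'
    have hcast : star (fun i => (x i : ℂ)) ⬝ᵥ
        (c ((P * Q⁻¹).map Complex.im) *ᵥ fun i => (x i : ℂ)) =
        ((star x ⬝ᵥ ((P * Q⁻¹).map Complex.im *ᵥ x) : ℝ) : ℂ) := by
      simp [dotProduct, Matrix.mulVec, hc]
    rw [hcast] at this
    exact_mod_cast this

open scoped Classical in
/-- `(f | g)(τ) = (det g)^{k/2} det(C τ + D)^{-k} f(g ∘ τ)`. It is only used for
`g` a symplectic similitude with positive multiplier; then `g ∘ τ` lies in the upper half-space
(`moebius_mem` above), so that the value `0` in the other case plays no role. -/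
def slash (k : ℕ) (f : UpperHalf → ℂ) (g : Mat4R) (τ : UpperHalf) : ℂ :=
  ((g.det ^ ((k : ℝ) / 2) : ℝ) : ℂ) * ((denom g τ).det ^ k)⁻¹ *
    (if h : (moebius g τ).IsSymm ∧ ((moebius g τ).map Complex.im).PosDef
      then f ⟨moebius g τ, h⟩ else 0)

/-- For `d ∣ N` with `d` and `N / d` coprime, the character `χ_d` modulo `d` in the decomposition
`χ = χ_d χ_{N/d}`: `χ_d(a) = χ(b)` where `b ≡ a` modulo `d` and `b ≡ 1` modulo `N / d`.
(For other `d`, the value is the trivial character.) -/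
def part {N : ℕ} (χ : DirichletCharacter ℂ N) (d : ℕ) : DirichletCharacter ℂ d :=
  if h : d * (N / d) = N ∧ d.Coprime (N / d) then
    MulChar.ofUnitHom <|
      χ.toUnitHom.comp <|
        (Units.map (ZMod.ringEquivCongr h.1).toRingHom.toMonoidHom).comp <|
          (Units.map (ZMod.chineseRemainder h.2).symm.toRingHom.toMonoidHom).comp <|
            (MulEquiv.prodUnits (M := ZMod d) (N := ZMod (N / d))).symm.toMonoidHom.comp <|
              MonoidHom.inl (ZMod d)ˣ (ZMod (N / d))ˣ
  else 1

/-- `γ₀⁻¹ Γ_∞ γ₀ ∩ Γ₀(N)`, as a subgroup of `Γ₀(N)`: the stabiliser of the coset `Γ_∞ γ₀`. -/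
def cuspStab (N : ℕ) (γ₀ : Sp2Z) : Subgroup (Gamma0 N) :=
  (GammaInf.comap (MulAut.conj γ₀).toMonoidHom).subgroupOf (Gamma0 N)

/-- The Eisenstein series
`E_{γ₀}(τ) = ∑ \bar χ(det D_γ) det(C τ + D)^{-k}`, `γ₀ γ = (* *; C D)`,
where `Γ_∞ γ₀ γ` (`γ ∈ Γ₀(N)`) runs over the `Γ₀(N)`-orbit of `Γ_∞ γ₀`. The orbit is
parametrised by the cosets of `Γ₀(N)` modulo the stabiliser on the left. The summands do not depend
on the representatives `γ` if `χ(-1) = (-1)^k` and `γ₀` is `Admissible` for `χ`. -/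
def eisenstein {N : ℕ} (k : ℕ) (χ : DirichletCharacter ℂ N) (γ₀ : Sp2Z) (τ : UpperHalf) : ℂ :=
  ∑' c : Quotient (QuotientGroup.rightRel (cuspStab N γ₀)),
    (starRingEnd ℂ) (χ (((blockD (c.out : Gamma0 N).1).det : ℤ) : ZMod N)) *
      ((denom (toReal (γ₀ * (c.out : Gamma0 N).1)) τ).det ^ k)⁻¹

/-- The condition under which `E_{γ₀}` is well defined: `χ_q² = 1` for every prime `q ∣ N`
such that the lower left block of `γ₀` has rank `1` modulo `q`. -/
def Admissible {N : ℕ} (χ : DirichletCharacter ℂ N) (γ₀ : Sp2Z) : Prop :=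
  ∀ q : ℕ, q.Prime → q ∣ N →
    ((blockC γ₀).map (Int.cast : ℤ → ZMod q)).rank = 1 → part χ q ^ 2 = 1

/-- The space of Eisenstein series of degree 2, weight `k`, level `N` and character `χ`. -/
def eisSpace {N : ℕ} (k : ℕ) (χ : DirichletCharacter ℂ N) : Submodule ℂ (UpperHalf → ℂ) :=
  Submodule.span ℂ {F | ∃ γ₀ : Sp2Z, Admissible χ γ₀ ∧ F = eisenstein k χ γ₀}

/-- For coprime `a` and `b`: an integer `≡ 0` modulo `a` and `≡ 1` modulo `b`. -/
def zeroOne (a b : ℕ) : ℤ := a * Nat.gcdA a b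

theorem zeroOne_left (a b : ℕ) : zeroOne a b ≡ 0 [ZMOD a] :=
  (Int.modEq_zero_iff_dvd).2 (dvd_mul_right _ _)

theorem zeroOne_right {a b : ℕ} (h : a.Coprime b) : zeroOne a b ≡ 1 [ZMOD b] := by
  have h1 := Nat.gcd_eq_gcd_ab a b
  rw [Nat.Coprime.gcd_eq_one h] at h1
  refine (Int.modEq_iff_dvd).2 ⟨Nat.gcdB a b, ?_⟩
  rw [zeroOne]
  push_cast at h1
  linarith

/-- The diagonal matrix `M_ρ`, `ρ = (N₀, N₁, N₂)`: it is `≡ 0` modulo `N₀`, `≡ diag(1, 0)` modulo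
`N₁` and `≡ I` modulo `N₂` if the `Nᵢ` are pairwise coprime. -/
def cuspM (N₀ N₁ N₂ : ℕ) : Matrix (Fin 2) (Fin 2) ℤ :=
  Matrix.diagonal ![zeroOne N₀ (N₁ * N₂), zeroOne (N₀ * N₁) N₂]

/-- `γ_ρ = (I 0; M_ρ I)`. -/
def cuspRep (N₀ N₁ N₂ : ℕ) : Sp2Z :=
  ⟨Matrix.fromBlocks 1 0 (cuspM N₀ N₁ N₂) 1, by
    rw [SymplecticGroup.mem_iff, Matrix.J, fromBlocks_transpose, fromBlocks_multiply,
      fromBlocks_multiply]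
    simp [cuspM]⟩

/-- `E_ρ = E_{γ_ρ}` for `ρ = (N₀, N₁, N₂)`, `N₀ N₁ N₂ = N`. -/
def eisRho {N : ℕ} (k : ℕ) (χ : DirichletCharacter ℂ N) (N₀ N₁ N₂ : ℕ) : UpperHalf → ℂ :=
  eisenstein k χ (cuspRep N₀ N₁ N₂)

/-- `δ Γ₀(N) δ⁻¹ ∩ Γ₀(N)` for an invertible real matrix `δ`, as a subgroup of `Γ₀(N)`. -/
def heckeStab (N : ℕ) (δ : Mat4R) : Subgroup (Gamma0 N) where
  carrier := {γ | ∃ η : Gamma0 N, toReal γ.1 * δ = δ * toReal η.1}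
  one_mem' := ⟨1, by simp [toReal_one]⟩
  mul_mem' := by
    rintro a b ⟨x, hx⟩ ⟨y, hy⟩
    refine ⟨x * y, ?_⟩
    simp only [Subgroup.coe_mul, toReal_mul]
    rw [Matrix.mul_assoc, hy, ← Matrix.mul_assoc, hx, Matrix.mul_assoc]
  inv_mem' := by
    rintro a ⟨x, hx⟩
    refine ⟨x⁻¹, ?_⟩
    have ha : toReal (a⁻¹ : Gamma0 N).1 * toReal a.1 = 1 := by
      rw [← toReal_mul]
      simp [toReal_one]
    have hx' : toReal x.1 * toReal (x⁻¹ : Gamma0 N).1 = 1 := by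
      rw [← toReal_mul]
      simp [toReal_one]
    calc toReal (a⁻¹ : Gamma0 N).1 * δ
        = toReal (a⁻¹ : Gamma0 N).1 * (δ * (toReal x.1 * toReal (x⁻¹ : Gamma0 N).1)) := by
          rw [hx', Matrix.mul_one]
      _ = toReal (a⁻¹ : Gamma0 N).1 * (toReal a.1 * δ) * toReal (x⁻¹ : Gamma0 N).1 := by
          rw [hx]
          simp only [Matrix.mul_assoc]
      _ = δ * toReal (x⁻¹ : Gamma0 N).1 := by
          rw [← Matrix.mul_assoc (toReal (a⁻¹ : Gamma0 N).1), ha, Matrix.one_mul]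

/-- `p^{k-3} ∑_γ \bar χ(det D_γ) f | δ⁻¹ γ`, where `γ` runs over representatives of
`(δ Γ₀(N) δ⁻¹ ∩ Γ₀(N)) \ Γ₀(N)`. For the `δ` below the sum is finite, and it does not depend
on the representatives if `f | γ = χ(det D_γ) f` for all `γ ∈ Γ₀(N)`. -/
def hecke {N : ℕ} (k : ℕ) (χ : DirichletCharacter ℂ N) (p : ℕ) (δ : Mat4R)
    (f : UpperHalf → ℂ) : UpperHalf → ℂ := fun τ =>
  (p : ℂ) ^ ((k : ℤ) - 3) *
    ∑ᶠ c : Quotient (QuotientGroup.rightRel (heckeStab N δ)),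
      (starRingEnd ℂ) (χ (((blockD (c.out : Gamma0 N).1).det : ℤ) : ZMod N)) *
        slash k f (δ⁻¹ * toReal (c.out : Gamma0 N).1) τ

/-- `f | T(p)`: here `δ = diag(p, p, 1, 1)`. -/
def heckeT {N : ℕ} (k : ℕ) (χ : DirichletCharacter ℂ N) (p : ℕ) :
    (UpperHalf → ℂ) → (UpperHalf → ℂ) :=
  hecke k χ p (Matrix.fromBlocks (Matrix.diagonal ![(p : ℝ), p]) 0 0 1)

/-- `f | T₁(p²)`: here `δ = diag(p, 1, p⁻¹, 1)`. -/
def heckeT1 {N : ℕ} (k : ℕ) (χ : DirichletCharacter ℂ N) (p : ℕ) :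
    (UpperHalf → ℂ) → (UpperHalf → ℂ) :=
  hecke k χ p
    (Matrix.fromBlocks (Matrix.diagonal ![(p : ℝ), 1]) 0 0 (Matrix.diagonal ![(p : ℝ)⁻¹, 1]))

/-- `χ_{N/q}(q)`. -/
def coVal {N : ℕ} (χ : DirichletCharacter ℂ N) (q : ℕ) : ℂ := part χ (N / q) (q : ZMod (N / q))

/-- `c(q) = q² / ((q - 1)(χ_{N/q}(q) q^k - 1))`. -/
def cConst {N : ℕ} (k : ℕ) (χ : DirichletCharacter ℂ N) (q : ℕ) : ℂ :=
  (q : ℂ) ^ 2 / (((q : ℂ) - 1) * (coVal χ q * (q : ℂ) ^ k - 1))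

/-- `f | S₁(q)` for a prime `q ∣ N` with `χ_q = 1`, where
`S₁(q) = c(q) [T₁(q²) - q⁻¹(q+1) T(q) - q⁻¹(q²-1)]`. -/
def S1Prime {N : ℕ} (k : ℕ) (χ : DirichletCharacter ℂ N) (q : ℕ) (f : UpperHalf → ℂ) :
    UpperHalf → ℂ :=
  cConst k χ q • (heckeT1 k χ q f - ((q : ℂ)⁻¹ * ((q : ℂ) + 1)) • heckeT k χ q f
    - ((q : ℂ)⁻¹ * ((q : ℂ) ^ 2 - 1)) • f)

open scoped Classical in
/-- `f | S₂(q)` for a prime `q ∣ N` with `χ_q² = 1`, where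
`S₂(q) = c(q) [(χ_{N/q}(q) q^{k-1} + 1) T(q) - T₁(q²) - q (χ_{N/q}(q) q^{k-2} - 1)]`
if `χ_q = 1`, and `S₂(q) = (-1/q) q² (q-1)⁻¹ [T(q) - 1]` if `χ_q ≠ 1`
(then `q` is odd, and `(-1/q)` is the Legendre symbol). -/
def S2Prime {N : ℕ} (k : ℕ) (χ : DirichletCharacter ℂ N) (q : ℕ) (f : UpperHalf → ℂ) :
    UpperHalf → ℂ :=
  if part χ q = 1 then
    cConst k χ q • ((coVal χ q * (q : ℂ) ^ ((k : ℤ) - 1) + 1) • heckeT k χ q f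
      - heckeT1 k χ q f - ((q : ℂ) * (coVal χ q * (q : ℂ) ^ ((k : ℤ) - 2) - 1)) • f)
  else
    (((jacobiSym (-1) q : ℤ) : ℂ) * (q : ℂ) ^ 2 / ((q : ℂ) - 1)) • (heckeT k χ q f - f)

/-- `f | S(q₁) S(q₂) ⋯ S(q_r)` for a list `[q₁, …, q_r]`; operators act from the right. -/
def applyList (S : ℕ → (UpperHalf → ℂ) → (UpperHalf → ℂ)) (l : List ℕ) (f : UpperHalf → ℂ) :
    UpperHalf → ℂ :=
  l.foldl (fun g q => S q g) f

/-- `f | S₁(n)`, `n ∣ N`: the multiplicative extension, primes in increasing order. -/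
def S1 {N : ℕ} (k : ℕ) (χ : DirichletCharacter ℂ N) (n : ℕ) :
    (UpperHalf → ℂ) → (UpperHalf → ℂ) :=
  applyList (S1Prime k χ) n.primeFactorsList

/-- `f | S₂(n)`, `n ∣ N`: the multiplicative extension, primes in increasing order. -/
def S2 {N : ℕ} (k : ℕ) (χ : DirichletCharacter ℂ N) (n : ℕ) :
    (UpperHalf → ℂ) → (UpperHalf → ℂ) :=
  applyList (S2Prime k χ) n.primeFactorsList

end SiegelEisenstein

end

open Matrix

noncomputable section

/-! ### Plücker vectors of Lagrangian planes -/

namespace SiegelEisenstein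

/-! A coset Γ_∞γ is the Lagrangian plane spanned by the lower rows (C, D) of γ. Up to sign, such a
plane is a primitive integral point p = (a, b, m, n, e) of the quadric mn = ae + b², and det(Cτ + D)
is a linear form `lin τ p` in these five coordinates. Hence every Eisenstein series considered here
is half the sum of Φ(p) · lin(τ, p)^(-k) over the set `V` of these points (`eisenstein_eq_eis`), and
all arithmetic sits in the weight function Φ. For square-free N the orbits of Γ₀(N) on `V` modulo
sign are classified by the rank of C modulo each prime q ∣ N (`HasType.exists_act`). Accordingly Φ
is a product over q ∣ N of local factors that depend only on p modulo q; each has a type 0, 1 or 2,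
the rank of C modulo q (`totalWeight`).

The matrices δ⁻¹ of the Hecke operators at q rescale the coordinates of p by powers of q. Applied to
a series of type 0 at q, the operator changes the factors away from q by a constant at most, and the
sum over cosets becomes a character sum or a count over the field with q elements. Write E_j for the
series with type j at q and X = χ_{N/q}(q) q^k. If χ_q = 1, then E₀ | T(q) = E₀ + (1 - 1/q)(E₁ +
E₂), E₀ | T₁(q²) = (q + 1) E₀ + (q - 1)(X + q)/q² · E₁ + (q² - 1)/q² · E₂. If χ_q is quadratic and
nontrivial, then E₀ | T(q) = E₀ + χ_q(-1)(q - 1)/q² · E₂. The operators S₁(q) and S₂(q) solve these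
equations for E₁ and E₂; the system is regular because |X| = q^k > 1 (`S1Prime_eis`, `S2Prime_eis`).
Starting from type 0 everywhere, each prime is used once, so only the action on E₀ matters and the
order of the primes is irrelevant (`applyList_eis`).

For the basis statement, slashing by γ⁻¹ and letting τ = iy tend to infinity isolates Φ at the plane
of γ (`tendsto_slash_eis`). This value is 0 unless γ has the type of the series. The limit rests on
absolute convergence for k ≥ 4, which follows from a divisor bound on the quadric (`summable_size`).
-/

/-- Plücker coordinates `a = [c₁,c₂]`, `b = [c₁,d₁] = -[c₂,d₂]`, `m = [c₁,d₂]`, `n = [d₁,c₂]`,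
`e = [d₁,d₂]` of the Lagrangian plane spanned by the rows of `(C, D) = (c₁, c₂, d₁, d₂)`. -/
@[ext] structure Plucker (R : Type*) where
  a : R
  b : R
  m : R
  n : R
  e : R

namespace Plucker

variable {R S : Type*}

def map (f : R → S) (p : Plucker R) : Plucker S := ⟨f p.a, f p.b, f p.m, f p.n, f p.e⟩

/-- An integral Plücker vector, viewed as a real one. -/
def toR (p : Plucker ℤ) : Plucker ℝ := p.map (Int.cast : ℤ → ℝ)

instance [Neg R] : Neg (Plucker R) := ⟨fun p => ⟨-p.a, -p.b, -p.m, -p.n, -p.e⟩⟩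

@[simp] theorem neg_a [Neg R] (p : Plucker R) : (-p).a = -p.a := rfl
@[simp] theorem neg_b [Neg R] (p : Plucker R) : (-p).b = -p.b := rfl
@[simp] theorem neg_m [Neg R] (p : Plucker R) : (-p).m = -p.m := rfl
@[simp] theorem neg_n [Neg R] (p : Plucker R) : (-p).n = -p.n := rfl
@[simp] theorem neg_e [Neg R] (p : Plucker R) : (-p).e = -p.e := rfl

@[simp] theorem toR_a (p : Plucker ℤ) : p.toR.a = p.a := rfl
@[simp] theorem toR_b (p : Plucker ℤ) : p.toR.b = p.b := rfl
@[simp] theorem toR_m (p : Plucker ℤ) : p.toR.m = p.m := rfl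
@[simp] theorem toR_n (p : Plucker ℤ) : p.toR.n = p.n := rfl
@[simp] theorem toR_e (p : Plucker ℤ) : p.toR.e = p.e := rfl

protected theorem neg_neg (p : Plucker ℤ) : - -p = p := by ext <;> simp

/-- The alternating matrix with the given Plücker coordinates. -/
def skew [CommRing R] (p : Plucker R) : Matrix (Fin 2 ⊕ Fin 2) (Fin 2 ⊕ Fin 2) R :=
  fromBlocks !![0, p.a; -p.a, 0] !![p.b, p.m; -p.n, -p.b] !![-p.b, p.n; -p.m, p.b]
    !![0, p.e; -p.e, 0]

/-- The Plücker coordinates of an alternating matrix. -/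
def ofMatrix [CommRing R] (P : Matrix (Fin 2 ⊕ Fin 2) (Fin 2 ⊕ Fin 2) R) : Plucker R :=
  ⟨P (.inl 0) (.inl 1), P (.inl 0) (.inr 0), P (.inl 0) (.inr 1), -P (.inl 1) (.inr 0),
    P (.inr 0) (.inr 1)⟩

theorem ofMatrix_skew [CommRing R] (p : Plucker R) : ofMatrix (skew p) = p := by
  ext <;> simp [ofMatrix, skew]

theorem skew_injective [CommRing R] : Function.Injective (skew (R := R)) :=
  Function.LeftInverse.injective ofMatrix_skew

theorem skew_neg [CommRing R] (p : Plucker R) : skew (-p) = -skew p := by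
  ext i j
  rcases i with i | i <;> rcases j with j | j <;> fin_cases i <;> fin_cases j <;> simp [skew]

theorem skew_toR (p : Plucker ℤ) : skew p.toR = (skew p).map (Int.cast : ℤ → ℝ) := by
  ext i j
  rcases i with i | i <;> rcases j with j | j <;> fin_cases i <;> fin_cases j <;> simp [skew]

/-- The quadratic relation between the Plücker coordinates. -/
def Isotropic [CommRing R] (p : Plucker R) : Prop := p.m * p.n = p.a * p.e + p.b ^ 2

def IsPrimitive (p : Plucker ℤ) : Prop :=
  ∀ d : ℤ, d ∣ p.a → d ∣ p.b → d ∣ p.m → d ∣ p.n → d ∣ p.e → IsUnit d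

/-- Every entry of `skew p * J * skew p` is 0 or plus or minus the quadratic form mn - ae - b². The
matrix condition is the one that is visibly preserved by P ↦ γᵀPγ with γ symplectic. -/
theorem isotropic_iff [CommRing R] (p : Plucker R) :
    p.Isotropic ↔ skew p * Matrix.J (Fin 2) R * skew p = 0 := by
  constructor
  · intro h
    unfold Isotropic at h
    ext i j
    rcases i with i | i <;> rcases j with j | j <;> fin_cases i <;> fin_cases j <;>
      simp [skew, Matrix.J, Matrix.mul_apply, Matrix.one_apply] <;>
      first | ring1 | linear_combination h | linear_combination -h
  · intro h
    have := congrFun (congrFun h (.inl 0)) (.inr 0)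
    simp [skew, Matrix.J, Matrix.mul_apply, Matrix.one_apply] at this
    unfold Isotropic
    linear_combination -this

theorem isPrimitive_iff (p : Plucker ℤ) :
    p.IsPrimitive ↔ ∀ d : ℤ, (∀ i j, d ∣ skew p i j) → IsUnit d := by
  constructor
  · intro h d hd
    refine h d ?_ ?_ ?_ ?_ ?_
    · simpa [skew] using hd (.inl 0) (.inl 1)
    · simpa [skew] using hd (.inl 0) (.inr 0)
    · simpa [skew] using hd (.inl 0) (.inr 1)
    · simpa [skew] using hd (.inl 1) (.inr 0)
    · simpa [skew] using hd (.inr 0) (.inr 1)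
  · intro h d h1 h2 h3 h4 h5
    apply h
    intro i j
    rcases i with i | i <;> rcases j with j | j <;> fin_cases i <;> fin_cases j <;>
      simp [skew, h1, h2, h3, h4, h5]

end Plucker

/-! ### The action of the symplectic group -/

open Plucker

/-- The right action of an integral matrix on Plücker vectors. -/
def act (γ : Sp2Z) (p : Plucker ℤ) : Plucker ℤ := ofMatrix (γ.1ᵀ * skew p * γ.1)

/-- `act` keeps five entries of γᵀPγ only. Nothing is lost: the matrices `skew p` are the
alternating P with tr(JP) = 0, and both properties survive the congruence, the second one because
γJγᵀ = J. -/
theorem skew_act (γ : Sp2Z) (p : Plucker ℤ) : skew (act γ p) = γ.1ᵀ * skew p * γ.1 := by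
  set Q := γ.1ᵀ * skew p * γ.1 with hQ
  have hs : (skew p)ᵀ = -skew p := by
    ext i j
    rcases i with i | i <;> rcases j with j | j <;> fin_cases i <;> fin_cases j <;> simp [skew]
  have hT : Qᵀ = -Q := by
    rw [hQ, Matrix.transpose_mul, Matrix.transpose_mul, hs, Matrix.transpose_transpose]
    simp [Matrix.mul_assoc]
  have hij : ∀ i j, Q j i = -Q i j := fun i j => congrFun (congrFun hT i) j
  have htr : (Matrix.J (Fin 2) ℤ * Q).trace = 0 := by
    have h := SymplecticGroup.mem_iff.1 γ.2
    have : (Matrix.J (Fin 2) ℤ * Q).trace = (Matrix.J (Fin 2) ℤ * skew p).trace := by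
      rw [hQ, ← Matrix.mul_assoc, Matrix.trace_mul_comm, ← Matrix.mul_assoc, ← Matrix.mul_assoc, h]
    rw [this]
    simp [Matrix.trace, Matrix.J, skew, Matrix.mul_apply, Matrix.one_apply]
  simp [Matrix.trace, Matrix.J, Matrix.mul_apply, Matrix.one_apply, Fin.sum_univ_two] at htr
  have h1 := hij (.inl 0) (.inr 0)
  have h2 := hij (.inl 1) (.inr 1)
  have h12 : Q (.inl 1) (.inr 1) = -Q (.inl 0) (.inr 0) := by omega
  change skew (ofMatrix Q) = Q
  clear_value Q
  ext i j
  have hd := hij i i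
  have ho := hij i j
  rcases i with i | i <;> rcases j with j | j <;> fin_cases i <;> fin_cases j <;>
      simp [skew, ofMatrix] at hd ho ⊢ <;> omega

theorem act_mul (γ γ' : Sp2Z) (p : Plucker ℤ) : act (γ * γ') p = act γ' (act γ p) := by
  apply skew_injective
  simp only [skew_act, Submonoid.coe_mul, Matrix.transpose_mul, Matrix.mul_assoc]

theorem act_one (p : Plucker ℤ) : act 1 p = p := by
  apply skew_injective
  simp [skew_act]

theorem act_neg (γ : Sp2Z) (p : Plucker ℤ) : act γ (-p) = -act γ p := by
  apply skew_injective
  simp [skew_act, skew_neg]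

theorem act_inv_act (γ : Sp2Z) (p : Plucker ℤ) : act γ⁻¹ (act γ p) = p := by
  rw [← act_mul, mul_inv_cancel, act_one]

theorem act_act_inv (γ : Sp2Z) (p : Plucker ℤ) : act γ (act γ⁻¹ p) = p := by
  rw [← act_mul, inv_mul_cancel, act_one]

/-- The primitive isotropic vectors: up to sign, they are the Lagrangian planes. -/
def V : Set (Plucker ℤ) := {p | p.Isotropic ∧ p.IsPrimitive}

theorem act_mem_V (γ : Sp2Z) {p : Plucker ℤ} (hp : p ∈ V) : act γ p ∈ V := by
  obtain ⟨h1, h2⟩ := hp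
  constructor
  · rw [isotropic_iff] at h1 ⊢
    rw [skew_act]
    have h := SymplecticGroup.mem_iff.1 γ.2
    calc γ.1ᵀ * skew p * γ.1 * Matrix.J (Fin 2) ℤ * (γ.1ᵀ * skew p * γ.1)
        = γ.1ᵀ * (skew p * (γ.1 * Matrix.J (Fin 2) ℤ * γ.1ᵀ) * skew p) * γ.1 := by
          simp only [Matrix.mul_assoc]
      _ = 0 := by rw [h, h1]; simp
  · rw [isPrimitive_iff] at h2 ⊢
    intro d hd
    apply h2
    have hp : skew p = (γ⁻¹).1ᵀ * skew (act γ p) * (γ⁻¹).1 := by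
      rw [← skew_act, act_inv_act]
    intro i j
    rw [hp, Matrix.mul_apply]
    refine Finset.dvd_sum fun l _ => Dvd.dvd.mul_right ?_ _
    rw [Matrix.mul_apply]
    exact Finset.dvd_sum fun l _ => Dvd.dvd.mul_left (hd _ _) _

theorem neg_mem_V {p : Plucker ℤ} (hp : p ∈ V) : -p ∈ V := by
  obtain ⟨h1, h2⟩ := hp
  refine ⟨?_, fun d ha hb hm hn he => ?_⟩
  · unfold Isotropic at *
    simp only [neg_a, neg_b, neg_m, neg_n, neg_e]
    linear_combination h1
  · exact h2 d (by simpa using ha) (by simpa using hb) (by simpa using hm) (by simpa using hn)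
      (by simpa using he)

/-- The action on primitive isotropic vectors, as a permutation. -/
def actV (γ : Sp2Z) : V ≃ V where
  toFun p := ⟨act γ p.1, act_mem_V γ p.2⟩
  invFun p := ⟨act γ⁻¹ p.1, act_mem_V γ⁻¹ p.2⟩
  left_inv p := Subtype.ext (act_inv_act γ p.1)
  right_inv p := Subtype.ext (act_act_inv γ p.1)

/-- The base point: the Plücker vector of `(C, D) = (0, 1)`. -/
def basePt : Plucker ℤ := ⟨0, 0, 0, 0, 1⟩

theorem basePt_mem : basePt ∈ V := by
  refine ⟨by simp [Isotropic, basePt], fun d _ _ _ _ h => isUnit_of_dvd_one h⟩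

/-- The Plücker vector of the two lower rows. -/
def pl (γ : Sp2Z) : Plucker ℤ := act γ basePt

theorem pl_mem (γ : Sp2Z) : pl γ ∈ V := act_mem_V γ basePt_mem

theorem pl_mul (γ γ' : Sp2Z) : pl (γ * γ') = act γ' (pl γ) := act_mul _ _ _

theorem pl_eq (γ : Sp2Z) : pl γ =
    ⟨(blockC γ).det, blockC γ 0 0 * blockD γ 1 0 - blockC γ 1 0 * blockD γ 0 0,
      blockC γ 0 0 * blockD γ 1 1 - blockC γ 1 0 * blockD γ 0 1,
      blockD γ 0 0 * blockC γ 1 1 - blockD γ 1 0 * blockC γ 0 1, (blockD γ).det⟩ := by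
  ext <;> simp [pl, act, ofMatrix, basePt, skew, Matrix.mul_apply, blockC, blockD, toBlocks₂₁,
    toBlocks₂₂, Matrix.det_fin_two] <;> ring

/-- If C = 0, then det D is the only coordinate left, hence a unit by primitivity. Conversely, all
minors formed from a column of C and a column of D vanish while det D = ±1, so C = 0 by Cramer's
rule. -/
theorem mem_GammaInf_iff (γ : Sp2Z) : γ ∈ GammaInf ↔ pl γ = basePt ∨ pl γ = -basePt := by
  constructor
  · intro h
    have h0 : blockC γ = 0 := h
    have hdet : (blockD γ).det = 1 ∨ (blockD γ).det = -1 := by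
      rw [← Int.isUnit_iff]
      have := (pl_mem γ).2
      rw [pl_eq, h0] at this
      refine this _ ?_ ?_ ?_ ?_ ?_ <;> simp
    rw [pl_eq, h0]
    rcases hdet with h | h
    · left; simp [h, basePt]
    · right; ext <;> simp [h, basePt]
  · intro h
    change blockC γ = 0
    rw [pl_eq] at h
    have h1 : (blockC γ 0 0 * blockD γ 1 0 - blockC γ 1 0 * blockD γ 0 0) = 0 ∧
        blockC γ 0 0 * blockD γ 1 1 - blockC γ 1 0 * blockD γ 0 1 = 0 ∧
        blockD γ 0 0 * blockC γ 1 1 - blockD γ 1 0 * blockC γ 0 1 = 0 ∧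
        (blockC γ).det = 0 ∧ ((blockD γ).det = 1 ∨ (blockD γ).det = -1) := by
      rcases h with h | h <;> rw [Plucker.ext_iff] at h <;> simp [basePt] at h <;> tauto
    obtain ⟨hb, hm, hn, ha, he⟩ := h1
    -- The minor [c₂,d₂] is not a coordinate of its own; by the shape of `skew` it equals -b.
    have hsym : blockC γ 0 1 * blockD γ 1 1 - blockC γ 1 1 * blockD γ 0 1 = 0 := by
      have := congrFun (congrFun (skew_act γ basePt) (.inl 1)) (.inr 1)
      have hb' : (act γ basePt).b = 0 := by
        change (pl γ).b = 0
        rw [pl_eq]; exact hb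
      simp only [skew, fromBlocks_apply₁₂, hb'] at this
      simp [Matrix.mul_apply, basePt] at this
      simp only [blockC, blockD, toBlocks₂₁, toBlocks₂₂, Matrix.of_apply]
      linear_combination -this
    rw [Matrix.det_fin_two] at he ha
    have hD : (blockD γ 0 0 * blockD γ 1 1 - blockD γ 0 1 * blockD γ 1 0) ≠ 0 := by
      rcases he with he | he <;> rw [he] <;> norm_num
    ext i j
    fin_cases i <;> fin_cases j <;> apply mul_right_cancel₀ hD <;>
      simp only [Fin.zero_eta, Fin.mk_one, Fin.isValue, Matrix.zero_apply, zero_mul]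
    · linear_combination blockD γ 0 0 * hm - blockD γ 0 1 * hb
    · linear_combination blockD γ 0 0 * hsym + blockD γ 0 1 * hn
    · linear_combination blockD γ 1 0 * hm - blockD γ 1 1 * hb
    · linear_combination blockD γ 1 0 * hsym + blockD γ 1 1 * hn

/-! ### The automorphy factor as a linear form -/

open Plucker

/-- `det(Cτ + D)` as a linear form in the Plücker coordinates of `(C, D)`. -/
def lin (τ : UpperHalf) (p : Plucker ℝ) : ℂ :=
  p.a * (τ.1 0 0 * τ.1 1 1 - τ.1 0 1 ^ 2) + p.m * τ.1 0 0 - 2 * p.b * τ.1 0 1 + p.n * τ.1 1 1 + p.e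

/-- The `4 × 2` matrix with blocks `τ` and `1`. -/
def frame (τ : Matrix (Fin 2) (Fin 2) ℂ) : Matrix (Fin 2 ⊕ Fin 2) (Fin 2) ℂ := fromRows τ 1

/-- The extension of `lin` to real matrices. -/
def linMat (τ : UpperHalf) (P : Mat4R) : ℂ :=
  ((frame τ.1)ᵀ * P.map Complex.ofReal * frame τ.1) 0 1

theorem linMat_skew (τ : UpperHalf) (p : Plucker ℝ) : linMat τ (skew p) = lin τ p := by
  have h : τ.1 1 0 = τ.1 0 1 := congrFun (congrFun τ.2.1 0) 1
  simp [linMat, lin, skew, frame, Matrix.mul_apply, Fin.sum_univ_two, h]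
  ring

theorem lin_neg (τ : UpperHalf) (p : Plucker ℝ) : lin τ (-p) = -lin τ p := by
  simp [lin]
  ring

theorem toR_neg (p : Plucker ℤ) : (-p).toR = -p.toR := by
  ext <;> simp

theorem mul_frame (g : Mat4R) (τ : Matrix (Fin 2) (Fin 2) ℂ) :
    g.map Complex.ofReal * frame τ =
      fromRows (g.toBlocks₁₁.map Complex.ofReal * τ + g.toBlocks₁₂.map Complex.ofReal)
        (g.toBlocks₂₁.map Complex.ofReal * τ + g.toBlocks₂₂.map Complex.ofReal) := by
  have : g.map Complex.ofReal = fromBlocks (g.toBlocks₁₁.map Complex.ofReal)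
      (g.toBlocks₁₂.map Complex.ofReal) (g.toBlocks₂₁.map Complex.ofReal)
      (g.toBlocks₂₂.map Complex.ofReal) := by
    rw [← fromBlocks_map, fromBlocks_toBlocks]
  rw [this, frame, fromBlocks_mul_fromRows]
  simp

/-- The inverse of a singular matrix is 0 by convention, so `moebius g τ` would be 0, whose
imaginary part is not positive definite. -/
theorem isUnit_denom (g : Mat4R) (ν : ℝ) (hν : 0 < ν)
    (hg : gᵀ * Matrix.J (Fin 2) ℝ * g = ν • Matrix.J (Fin 2) ℝ) (τ : UpperHalf) :
    IsUnit (denom g τ).det := by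
  by_contra h
  have h1 := (moebius_mem g ν hν hg τ).2
  rw [moebius, Matrix.nonsing_inv_apply_not_isUnit _ h, Matrix.mul_zero] at h1
  have := h1.det_pos
  simp at this

/-- The point `g ∘ τ` of the upper half-space. -/
def moebiusPt (g : Mat4R) (ν : ℝ) (hν : 0 < ν)
    (hg : gᵀ * Matrix.J (Fin 2) ℝ * g = ν • Matrix.J (Fin 2) ℝ) (τ : UpperHalf) : UpperHalf :=
  ⟨moebius g τ, moebius_mem g ν hν hg τ⟩

/-- With W = Cτ + D one has g · (τ; 1) = (gτ; 1) · W. The 2 × 2 matrix at τ is therefore WᵀXW with X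
alternating, and this is det W times X. -/
theorem mul_linMat (g : Mat4R) (ν : ℝ) (hν : 0 < ν)
    (hg : gᵀ * Matrix.J (Fin 2) ℝ * g = ν • Matrix.J (Fin 2) ℝ) (τ : UpperHalf)
    (p : Plucker ℝ) :
    (denom g τ).det * lin (moebiusPt g ν hν hg τ) p
      = linMat τ (gᵀ * skew p * g) := by
  have hu := isUnit_denom g ν hν hg τ
  have hf : g.map Complex.ofReal * frame τ.1 = frame (moebius g τ) * denom g τ := by
    rw [mul_frame, frame, fromRows_mul, Matrix.one_mul, moebius,
      Matrix.nonsing_inv_mul_cancel_right _ _ hu]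
    rfl
  rw [← linMat_skew, linMat, linMat]
  have hm : (gᵀ * skew p * g).map Complex.ofReal =
      (g.map Complex.ofReal)ᵀ * (skew p).map Complex.ofReal * g.map Complex.ofReal := by
    have := Matrix.map_mul (f := Complex.ofRealHom) (L := gᵀ * skew p) (M := g)
    have h2 := Matrix.map_mul (f := Complex.ofRealHom) (L := gᵀ) (M := skew p)
    exact this.trans (by rw [h2]; rfl)
  set W := denom g τ
  set T := frame (moebius g τ)
  set X := Tᵀ * (skew p).map Complex.ofReal * T with hX
  have h1 : (frame τ.1)ᵀ * (gᵀ * skew p * g).map Complex.ofReal * frame τ.1 = Wᵀ * X * W := by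
    rw [hm]
    calc _ = (g.map Complex.ofReal * frame τ.1)ᵀ * (skew p).map Complex.ofReal *
          (g.map Complex.ofReal * frame τ.1) := by
            rw [Matrix.transpose_mul]
            simp only [Matrix.mul_assoc]
      _ = _ := by
            rw [hf, Matrix.transpose_mul]
            simp only [hX, Matrix.mul_assoc]
  have hs : (skew p)ᵀ = -skew p := by
    ext i j
    rcases i with i | i <;> rcases j with j | j <;> fin_cases i <;> fin_cases j <;> simp [skew]
  have hXT : Xᵀ = -X := by
    have hs' : ((skew p).map Complex.ofReal)ᵀ = -(skew p).map Complex.ofReal := by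
      rw [← Matrix.transpose_map, hs]
      ext i j
      simp
    rw [hX, Matrix.transpose_mul, Matrix.transpose_mul, hs']
    simp [Matrix.mul_assoc]
  have hx : ∀ i j, X j i = -X i j := fun i j => congrFun (congrFun hXT i) j
  have h00 : X 0 0 = 0 := by
    have := hx 0 0
    exact self_eq_neg.1 this
  have h11 : X 1 1 = 0 := self_eq_neg.1 (hx 1 1)
  rw [h1]
  change W.det * X 0 1 = _
  simp [Matrix.mul_apply, Fin.sum_univ_two, h00, h11, hx 0 1, Matrix.det_fin_two]
  ring

/-- The Eisenstein series attached to a weight function on primitive isotropic vectors. -/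
def eis (k : ℕ) (Φ : Plucker ℤ → ℂ) (τ : UpperHalf) : ℂ :=
  2⁻¹ * ∑' p : V, Φ p.1 * (lin τ p.1.toR ^ k)⁻¹

/-- The factor det(Cτ + D)^(-k) of the slash operator is absorbed into the linear forms by
`mul_linMat`. -/
theorem slash_eis (k : ℕ) (Φ : Plucker ℤ → ℂ) (g : Mat4R) (ν : ℝ) (hν : 0 < ν)
    (hg : gᵀ * Matrix.J (Fin 2) ℝ * g = ν • Matrix.J (Fin 2) ℝ) (τ : UpperHalf) :
    slash k (eis k Φ) g τ = ((g.det ^ ((k : ℝ) / 2) : ℝ) : ℂ) *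
      (2⁻¹ * ∑' p : V, Φ p.1 * (linMat τ (gᵀ * skew p.1.toR * g) ^ k)⁻¹) := by
  rw [slash, dif_pos (moebius_mem g ν hν hg τ), mul_assoc]
  change _ * (_ * eis k Φ (moebiusPt g ν hν hg τ)) = _
  rw [eis, mul_left_comm ((denom g τ).det ^ k)⁻¹, ← tsum_mul_left]
  congr 2
  refine tsum_congr fun p => ?_
  rw [← mul_linMat g ν hν hg, mul_pow, mul_inv]
  ring

theorem toReal_similitude (γ : Sp2Z) :
    (toReal γ)ᵀ * Matrix.J (Fin 2) ℝ * toReal γ = (1 : ℝ) • Matrix.J (Fin 2) ℝ := by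
  have h := SymplecticGroup.mem_iff.1 (SymplecticGroup.transpose_mem γ.2)
  rw [Matrix.transpose_transpose] at h
  have h2 := congrArg (fun M => M.map (Int.castRingHom ℝ)) h
  simp only [Matrix.map_mul] at h2
  have hJ : (Matrix.J (Fin 2) ℤ).map (Int.castRingHom ℝ) = Matrix.J (Fin 2) ℝ := by
    ext i j
    rcases i with i | i <;> rcases j with j | j <;> fin_cases i <;> fin_cases j <;>
      simp [Matrix.J]
  rw [hJ] at h2
  rw [one_smul]
  exact h2

theorem skew_act_toR (γ : Sp2Z) (p : Plucker ℤ) :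
    skew (act γ p).toR = (toReal γ)ᵀ * skew p.toR * toReal γ := by
  rw [skew_toR, skew_act, skew_toR, toReal]
  have := Matrix.map_mul (f := Int.castRingHom ℝ) (L := γ.1ᵀ * skew p) (M := γ.1)
  have h2 := Matrix.map_mul (f := Int.castRingHom ℝ) (L := γ.1ᵀ) (M := skew p)
  simp only [Int.coe_castRingHom] at this h2
  rw [this, h2]
  rfl

theorem det_denom_toReal (γ : Sp2Z) (τ : UpperHalf) :
    (denom (toReal γ) τ).det = lin τ (pl γ).toR := by
  rw [← linMat_skew, pl, skew_act_toR, ← mul_linMat _ 1 one_pos (toReal_similitude γ)]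
  simp [lin, basePt]

theorem linMat_toReal_mul (γ : Sp2Z) (g : Mat4R) (p : Plucker ℤ) (τ : UpperHalf) :
    linMat τ ((toReal γ * g)ᵀ * skew p.toR * (toReal γ * g)) =
      linMat τ (gᵀ * skew (act γ p).toR * g) := by
  rw [skew_act_toR, Matrix.transpose_mul]
  simp only [Matrix.mul_assoc]

theorem det_toReal (γ : Sp2Z) : (toReal γ).det = 1 := by
  have h : (γ.1).det = 1 := SymplecticGroup.det_eq_one γ.2
  have := (Int.castRingHom ℝ).map_det γ.1
  rw [h] at this
  rw [toReal]
  simpa using this.symm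

/-- An integral symplectic matrix permutes `V`, so slashing by it only moves the weight function. -/
theorem slash_eis_toReal (k : ℕ) (Φ : Plucker ℤ → ℂ) (γ : Sp2Z) (τ : UpperHalf) :
    slash k (eis k Φ) (toReal γ) τ = eis k (fun p => Φ (act γ⁻¹ p)) τ := by
  rw [slash_eis k Φ _ 1 one_pos (toReal_similitude γ), det_toReal, eis]
  simp only [Real.one_rpow, Complex.ofReal_one, one_mul]
  congr 1
  rw [← (actV γ).tsum_eq (fun p => Φ (act γ⁻¹ p.1) * (lin τ p.1.toR ^ k)⁻¹)]
  refine tsum_congr fun p => ?_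
  simp only [actV, Equiv.coe_fn_mk, act_inv_act]
  rw [← linMat_skew, skew_act_toR]

/-! ### Absolute convergence through a divisor bound -/

theorem succ_pow_three_le_two_pow (j : ℕ) : (j + 1) ^ 3 ≤ 8 * 2 ^ j := by
  rcases lt_or_ge j 3 with h | h
  · interval_cases j <;> norm_num
  · induction j, h using Nat.le_induction with
    | base => norm_num
    | succ j hj ih =>
      rw [pow_succ 2 j]
      have : (j + 1 + 1) ^ 3 ≤ 2 * (j + 1) ^ 3 := by
        obtain ⟨i, rfl⟩ := Nat.exists_eq_add_of_le hj
        ring_nf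
        nlinarith [sq_nonneg i, Nat.zero_le (i ^ 3)]
      omega

/-- A prime p ≥ 8 satisfies (v + 1)³ ≤ 8^v ≤ p^v. Each of 2, 3, 5, 7 costs an extra factor 8, and 8⁴
= 4096. A bound of order n^(1/3) for the number of divisors is enough for the convergence below. -/
theorem card_divisors_pow_three_le (n : ℕ) (hn : n ≠ 0) : n.divisors.card ^ 3 ≤ 4096 * n := by
  classical
  have hloc : ∀ p ∈ n.primeFactors, (n.factorization p + 1) ^ 3 ≤
      (if p < 8 then 8 else 1) * p ^ n.factorization p := by
    intro p hp
    have hp' := Nat.prime_of_mem_primeFactors hp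
    split_ifs with h8
    · exact (succ_pow_three_le_two_pow _).trans
        (Nat.mul_le_mul_left _ (Nat.pow_le_pow_left hp'.two_le _))
    · rw [one_mul]
      calc (n.factorization p + 1) ^ 3 ≤ (2 ^ n.factorization p) ^ 3 :=
            Nat.pow_le_pow_left Nat.lt_two_pow_self 3
        _ = 8 ^ n.factorization p := by rw [← pow_mul, mul_comm, pow_mul]; norm_num
        _ ≤ _ := Nat.pow_le_pow_left (by omega) _
  have hsmall : ∏ p ∈ n.primeFactors, (if p < 8 then 8 else 1) ≤ 4096 := by
    rw [Finset.prod_ite, Finset.prod_const_one, mul_one, Finset.prod_const]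
    have hc : (n.primeFactors.filter (· < 8)).card ≤ ({2, 3, 5, 7} : Finset ℕ).card := by
      apply Finset.card_le_card
      intro p hp
      rw [Finset.mem_filter] at hp
      have hp' := Nat.prime_of_mem_primeFactors hp.1
      have := hp.2
      interval_cases p <;> simp_all (config := { decide := true })
    calc 8 ^ _ ≤ 8 ^ 4 := Nat.pow_le_pow_right (by norm_num) (by simpa using hc)
      _ = 4096 := by norm_num
  rw [Nat.card_divisors hn, ← Finset.prod_pow]
  calc _ ≤ ∏ p ∈ n.primeFactors, ((if p < 8 then 8 else 1) * p ^ n.factorization p) :=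
        Finset.prod_le_prod' hloc
    _ = (∏ p ∈ n.primeFactors, (if p < 8 then 8 else 1)) * n := by
        rw [Finset.prod_mul_distrib]
        congr 1
        exact Nat.prod_factorization_pow_eq_self hn
    _ ≤ _ := Nat.mul_le_mul_right _ hsmall

/-- The divisors of an integer, of both signs. -/
def intDivisors (T : ℤ) : Finset ℤ :=
  T.natAbs.divisors.image (fun d : ℕ => (d : ℤ)) ∪ T.natAbs.divisors.image (fun d : ℕ => -(d : ℤ))

theorem mem_intDivisors {T d : ℤ} (hT : T ≠ 0) (hd : d ∣ T) : d ∈ intDivisors T := by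
  have h : d.natAbs ∈ T.natAbs.divisors := by
    rw [Nat.mem_divisors]
    exact ⟨Int.natAbs_dvd_natAbs.2 hd, by simpa using hT⟩
  rw [intDivisors, Finset.mem_union, Finset.mem_image, Finset.mem_image]
  rcases Int.natAbs_eq d with h' | h'
  · left; exact ⟨_, h, h'.symm⟩
  · right; exact ⟨_, h, h'.symm⟩

/-- Allowing both signs doubles the count, and 2³ · 4096 = 32768. -/
theorem card_intDivisors_le (T : ℤ) : ((intDivisors T).card : ℝ) ^ 3 ≤ 32768 * |(T : ℝ)| := by
  rcases eq_or_ne T 0 with rfl | hT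
  · simp [intDivisors]
  have h1 : (intDivisors T).card ≤ 2 * T.natAbs.divisors.card := by
    refine (Finset.card_union_le _ _).trans ?_
    have := Finset.card_image_le (s := T.natAbs.divisors) (f := fun d : ℕ => (d : ℤ))
    have := Finset.card_image_le (s := T.natAbs.divisors) (f := fun d : ℕ => -(d : ℤ))
    omega
  have h2 := card_divisors_pow_three_le T.natAbs (by simpa using hT)
  have h3 : (intDivisors T).card ^ 3 ≤ 32768 * T.natAbs :=
    calc (intDivisors T).card ^ 3 ≤ (2 * T.natAbs.divisors.card) ^ 3 := Nat.pow_le_pow_left h1 3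
      _ = 8 * T.natAbs.divisors.card ^ 3 := by ring
      _ ≤ _ := by omega
  have : ((T.natAbs : ℕ) : ℝ) = |(T : ℝ)| := by simp
  rw [← this]
  exact_mod_cast h3

/-- The maximum of `1` and the absolute values of the components. -/
def maxAbs (y : ℤ × ℤ × ℤ) : ℝ := max 1 (max |(y.1 : ℝ)| (max |(y.2.1 : ℝ)| |(y.2.2 : ℝ)|))

theorem one_le_maxAbs (y : ℤ × ℤ × ℤ) : 1 ≤ maxAbs y := le_max_left _ _
theorem fst_le_maxAbs (y : ℤ × ℤ × ℤ) : |(y.1 : ℝ)| ≤ maxAbs y := by simp [maxAbs]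
theorem snd_le_maxAbs (y : ℤ × ℤ × ℤ) : |(y.2.1 : ℝ)| ≤ maxAbs y := by simp [maxAbs]
theorem trd_le_maxAbs (y : ℤ × ℤ × ℤ) : |(y.2.2 : ℝ)| ≤ maxAbs y := by simp [maxAbs]

theorem summable_max_one_abs_rpow :
    Summable fun x : ℤ => (max 1 |(x : ℝ)|) ^ (-(10 / 9) : ℝ) := by
  have h : Summable fun x : ℤ => |(x : ℝ)| ^ (-(10 / 9) : ℝ) :=
    Real.summable_abs_int_rpow (by norm_num)
  refine (h.add (summable_of_ne_finset_zero (s := {0})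
    (f := fun x : ℤ => if x = 0 then (1 : ℝ) else 0) (by simp +contextual))).of_nonneg_of_le
    (fun x => by positivity) fun x => ?_
  rcases eq_or_ne x 0 with rfl | hx
  · simp
  · have : (1 : ℝ) ≤ |(x : ℝ)| := by exact_mod_cast Int.one_le_abs hx
    simp [max_eq_right this, hx]

/-- Since -10/3 = 3 · (-10/9) and `maxAbs` dominates each component, a product of three convergent
series in one variable is a majorant. -/
theorem summable_maxAbs_rpow :
    Summable fun y : ℤ × ℤ × ℤ => maxAbs y ^ (-(10 / 3) : ℝ) := by
  set u : ℤ → ℝ := fun x => (max 1 |(x : ℝ)|) ^ (-(10 / 9) : ℝ)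
  have hu : Summable u := summable_max_one_abs_rpow
  have hu0 : 0 ≤ u := fun x => by positivity
  have h2 := hu.mul_of_nonneg hu hu0 hu0
  have h3 := hu.mul_of_nonneg h2 hu0 (fun y => mul_nonneg (hu0 _) (hu0 _))
  refine h3.of_nonneg_of_le (fun y => ?_) fun y => ?_
  · have := one_le_maxAbs y; positivity
  have h0 : 0 < maxAbs y := lt_of_lt_of_le one_pos (one_le_maxAbs y)
  have key : ∀ x : ℤ, |(x : ℝ)| ≤ maxAbs y → maxAbs y ^ (-(10 / 9) : ℝ) ≤ u x := fun x hx =>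
    Real.rpow_le_rpow_of_nonpos (by positivity) (max_le (one_le_maxAbs y) hx) (by norm_num)
  have e : maxAbs y ^ (-(10 / 3) : ℝ) = maxAbs y ^ (-(10 / 9) : ℝ) *
      (maxAbs y ^ (-(10 / 9) : ℝ) * maxAbs y ^ (-(10 / 9) : ℝ)) := by
    rw [← Real.rpow_add h0, ← Real.rpow_add h0]; norm_num
  rw [e]
  have p0 : 0 ≤ maxAbs y ^ (-(10 / 9) : ℝ) := by positivity
  exact mul_le_mul (key _ (fst_le_maxAbs y)) (mul_le_mul (key _ (snd_le_maxAbs y))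
    (key _ (trd_le_maxAbs y)) p0 (hu0 _)) (mul_nonneg p0 p0) (hu0 _)

/-- The maximum of the absolute values of the coordinates. -/
def size (p : Plucker ℤ) : ℝ :=
  max |(p.a : ℝ)| (max |(p.b : ℝ)| (max |(p.m : ℝ)| (max |(p.n : ℝ)| |(p.e : ℝ)|)))

theorem one_le_size {p : Plucker ℤ} (hp : p ∈ V) : 1 ≤ size p := by
  by_contra h
  simp only [size, not_le, max_lt_iff] at h
  have z : ∀ x : ℤ, |(x : ℝ)| < 1 → x = 0 := fun x hx => by
    have : |x| < 1 := by exact_mod_cast hx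
    exact Int.abs_lt_one_iff.1 this
  obtain ⟨ha, hb, hm, hn, he⟩ := h
  have := hp.2 0 (by rw [z _ ha]) (by rw [z _ hb]) (by rw [z _ hm]) (by rw [z _ hn])
    (by rw [z _ he])
  simp at this

/-- A point of `A` is determined by three coordinates `f p` and a divisor `g p` of `T (f p)`. As T
is quadratically bounded, there are O(M^(2/3)) divisors over a triple of size M, and M^(-4) ·
M^(2/3) = M^(-10/3) is summable over ℤ³. -/
theorem summable_size_of_fiber (A : Set (Plucker ℤ)) (hA : A ⊆ V) (f : Plucker ℤ → ℤ × ℤ × ℤ)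
    (g : Plucker ℤ → ℤ) (T : ℤ × ℤ × ℤ → ℤ) (hT : ∀ y, |(T y : ℝ)| ≤ 2 * maxAbs y ^ 2)
    (hg : ∀ p ∈ A, T (f p) ≠ 0 ∧ g p ∣ T (f p))
    (hinj : ∀ p ∈ A, ∀ p' ∈ A, f p = f p' → g p = g p' → p = p')
    (hf : ∀ p ∈ A, |((f p).1 : ℝ)| ≤ size p ∧ |((f p).2.1 : ℝ)| ≤ size p ∧
      |((f p).2.2 : ℝ)| ≤ size p) :
    Summable (A.indicator fun p => (size p ^ 4)⁻¹) := by
  classical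
  rw [← summable_subtype_iff_indicator]
  set w : ℤ × ℤ × ℤ → ℝ := fun y => (maxAbs y ^ 4)⁻¹ with hw
  have hm0 : ∀ y, 0 < maxAbs y := fun y => lt_of_lt_of_le one_pos (one_le_maxAbs y)
  have hw0 : ∀ y, 0 ≤ w y := fun y => by have := hm0 y; positivity
  set F : (ℤ × ℤ × ℤ) × ℤ → ℝ := fun z => if z.2 ∈ intDivisors (T z.1) then w z.1 else 0
  have hF : Summable F := by
    rw [summable_prod_of_nonneg (fun z => by simp only [F]; split_ifs; exacts [hw0 _, le_rfl])]
    have hsum : ∀ y, HasSum (fun x => F (y, x)) ((intDivisors (T y)).card * w y) := by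
      intro y
      have : HasSum (fun x => F (y, x)) (∑ x ∈ intDivisors (T y), F (y, x)) :=
        hasSum_sum_of_ne_finset_zero (fun x hx => by simp [F, hx])
      rwa [Finset.sum_congr rfl (g := fun _ => w y) (fun x hx => by simp [F, hx]),
        Finset.sum_const, nsmul_eq_mul] at this
    refine ⟨fun y => (hsum y).summable, ?_⟩
    simp only [fun y => (hsum y).tsum_eq]
    refine (summable_maxAbs_rpow.mul_left 41).of_nonneg_of_le
      (fun y => mul_nonneg (Nat.cast_nonneg _) (hw0 y)) fun y => ?_
    -- The constant works because 41³ = 68921 exceeds 2 · 32768.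
    have hcard : ((intDivisors (T y)).card : ℝ) ≤ 41 * maxAbs y ^ (2 / 3 : ℝ) := by
      have h1 := (card_intDivisors_le (T y)).trans
        (mul_le_mul_of_nonneg_left (hT y) (by norm_num : (0 : ℝ) ≤ 32768))
      have h2 : (41 * maxAbs y ^ (2 / 3 : ℝ)) ^ 3 = 68921 * maxAbs y ^ 2 := by
        rw [mul_pow, ← Real.rpow_natCast (maxAbs y ^ (2 / 3 : ℝ)), ← Real.rpow_mul (hm0 y).le,
          ← Real.rpow_natCast (maxAbs y) 2]
        norm_num
      refine le_of_pow_le_pow_left₀ three_ne_zero (by have := hm0 y; positivity) ?_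
      rw [h2]
      refine h1.trans ?_
      have : 0 ≤ maxAbs y ^ 2 := by positivity
      linarith
    have e : 41 * maxAbs y ^ (-(10 / 3) : ℝ) = 41 * maxAbs y ^ (2 / 3 : ℝ) * w y := by
      have : w y = maxAbs y ^ (-4 : ℝ) := by
        rw [hw, Real.rpow_neg (hm0 y).le]
        norm_cast
      rw [this, mul_assoc, ← Real.rpow_add (hm0 y)]
      norm_num
    rw [e]
    exact mul_le_mul_of_nonneg_right hcard (hw0 y)
  have hi : Function.Injective (fun p : A => ((f p.1, g p.1) : (ℤ × ℤ × ℤ) × ℤ)) := by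
    intro p p' h
    simp only [Prod.mk.injEq] at h
    exact Subtype.ext (hinj _ p.2 _ p'.2 (by simpa [Prod.ext_iff] using h.1) h.2)
  refine (hF.comp_injective hi).of_nonneg_of_le
    (fun p => by have := one_le_size (hA p.2); simp only [Function.comp]; positivity) fun p => ?_
  have h1 := hg p.1 p.2
  have h2 := hf p.1 p.2
  simp only [Function.comp, F, if_pos (mem_intDivisors h1.1 h1.2)]
  refine inv_anti₀ (by have := hm0 (f p.1); positivity) (pow_le_pow_left₀ (hm0 _).le ?_ 4)
  exact max_le (one_le_size (hA p.2)) (max_le h2.1 (max_le h2.2.1 h2.2.2))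

theorem abs_le_size (p : Plucker ℤ) : |(p.a : ℝ)| ≤ size p ∧ |(p.b : ℝ)| ≤ size p ∧
    |(p.m : ℝ)| ≤ size p ∧ |(p.n : ℝ)| ≤ size p ∧ |(p.e : ℝ)| ≤ size p := by
  simp [size]

/-- Cut up the quadric mn = ae + b². If ae ≠ 0, then a divides mn - b². If a = 0 or e = 0 but b ≠ 0,
then m divides b². If b = 0 and ae = 0, then mn = 0 as well, and only two coordinates remain free.
-/
theorem summable_size : Summable fun p : V => (size p.1 ^ 4)⁻¹ := by
  have zero_le : ∀ p, |((0 : ℤ) : ℝ)| ≤ size p := fun p => by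
    simpa using (abs_nonneg _).trans (abs_le_size p).1
  have one_bound : ∀ y : ℤ × ℤ × ℤ, |(((fun _ => 1 : ℤ × ℤ × ℤ → ℤ) y : ℤ) : ℝ)| ≤
      2 * maxAbs y ^ 2 := fun y => by
    have := one_le_maxAbs y
    simp only [Int.cast_one, abs_one]
    nlinarith
  have sq_bound : ∀ y : ℤ × ℤ × ℤ, |(((fun y => y.1 ^ 2 : ℤ × ℤ × ℤ → ℤ) y : ℤ) : ℝ)| ≤
      2 * maxAbs y ^ 2 := fun y => by
    have := one_le_maxAbs y
    have h1 := pow_le_pow_left₀ (abs_nonneg _) (fst_le_maxAbs y) 2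
    simp only [Int.cast_pow, abs_pow]
    nlinarith
  have s1 := summable_size_of_fiber {p | p ∈ V ∧ p.a * p.e ≠ 0} (fun p hp => hp.1)
    (fun p => (p.b, p.m, p.n)) (fun p => p.a) (fun y => y.2.1 * y.2.2 - y.1 ^ 2)
    (fun y => by
      have h1 := pow_le_pow_left₀ (abs_nonneg _) (fst_le_maxAbs y) 2
      have h2 := mul_le_mul (snd_le_maxAbs y) (trd_le_maxAbs y) (abs_nonneg _)
        (zero_le_one.trans (one_le_maxAbs y))
      push_cast
      refine (abs_sub _ _).trans ?_
      rw [abs_mul, abs_pow]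
      nlinarith)
    (fun p hp => by
      have h : p.m * p.n = p.a * p.e + p.b ^ 2 := hp.1.1
      have e : p.m * p.n - p.b ^ 2 = p.a * p.e := by rw [h]; ring
      simp only [e]
      exact ⟨hp.2, dvd_mul_right _ _⟩)
    (fun p hp p' hp' h ha => by
      simp only [Prod.mk.injEq] at h
      obtain ⟨hb, hm, hn⟩ := h
      have h : p.m * p.n = p.a * p.e + p.b ^ 2 := hp.1.1
      have h' : p'.m * p'.n = p'.a * p'.e + p'.b ^ 2 := hp'.1.1
      rw [← hb, ← hm, ← hn, ← ha, h] at h'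
      refine Plucker.ext ha hb hm hn (mul_left_cancel₀ (left_ne_zero_of_mul hp.2) ?_)
      linarith)
    (fun p hp => by have := abs_le_size p; tauto)
  have s2 := summable_size_of_fiber {p | p ∈ V ∧ p.a = 0 ∧ p.b ≠ 0} (fun p hp => hp.1)
    (fun p => (p.b, p.e, 0)) (fun p => p.m) (fun y => y.1 ^ 2) sq_bound
    (fun p hp => by
      have h : p.m * p.n = p.a * p.e + p.b ^ 2 := hp.1.1
      rw [hp.2.1, zero_mul, zero_add] at h
      exact ⟨pow_ne_zero 2 hp.2.2, ⟨_, h.symm⟩⟩)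
    (fun p hp p' hp' h hm => by
      simp only [Prod.mk.injEq] at h
      obtain ⟨hb, he, -⟩ := h
      have h : p.m * p.n = p.a * p.e + p.b ^ 2 := hp.1.1
      have h' : p'.m * p'.n = p'.a * p'.e + p'.b ^ 2 := hp'.1.1
      rw [hp.2.1, zero_mul, zero_add] at h
      rw [hp'.2.1, zero_mul, zero_add] at h'
      have hm0 : p.m ≠ 0 := fun h0 => hp.2.2 (by simpa [h0] using h.symm)
      refine Plucker.ext (hp.2.1.trans hp'.2.1.symm) hb hm (mul_left_cancel₀ hm0 ?_) he
      rw [h, hb, ← h', hm])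
    (fun p hp => by have := abs_le_size p; have := zero_le p; tauto)
  have s3 := summable_size_of_fiber {p | p ∈ V ∧ p.e = 0 ∧ p.b ≠ 0} (fun p hp => hp.1)
    (fun p => (p.b, p.a, 0)) (fun p => p.m) (fun y => y.1 ^ 2) sq_bound
    (fun p hp => by
      have h : p.m * p.n = p.a * p.e + p.b ^ 2 := hp.1.1
      rw [hp.2.1, mul_zero, zero_add] at h
      exact ⟨pow_ne_zero 2 hp.2.2, ⟨_, h.symm⟩⟩)
    (fun p hp p' hp' h hm => by
      simp only [Prod.mk.injEq] at h
      obtain ⟨hb, he, -⟩ := h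
      have h : p.m * p.n = p.a * p.e + p.b ^ 2 := hp.1.1
      have h' : p'.m * p'.n = p'.a * p'.e + p'.b ^ 2 := hp'.1.1
      rw [hp.2.1, mul_zero, zero_add] at h
      rw [hp'.2.1, mul_zero, zero_add] at h'
      have hm0 : p.m ≠ 0 := fun h0 => hp.2.2 (by simpa [h0] using h.symm)
      refine Plucker.ext he hb hm (mul_left_cancel₀ hm0 ?_) (hp.2.1.trans hp'.2.1.symm)
      rw [h, hb, ← h', hm])
    (fun p hp => by have := abs_le_size p; have := zero_le p; tauto)
  have s4 : ∀ (u v u' v' : Plucker ℤ → ℤ), (∀ p p' : Plucker ℤ, p.b = p'.b → u p = u p' →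
      v p = v p' → u' p = u' p' → v' p = v' p' → p = p') →
      (∀ p, |(u' p : ℝ)| ≤ size p ∧ |(v' p : ℝ)| ≤ size p) →
      Summable ({p | p ∈ V ∧ p.b = 0 ∧ u p = 0 ∧ v p = 0}.indicator fun p => (size p ^ 4)⁻¹) := by
    intro u v u' v' hext hle
    refine summable_size_of_fiber {p | p ∈ V ∧ p.b = 0 ∧ u p = 0 ∧ v p = 0} (fun p hp => hp.1)
      (fun p => (u' p, v' p, 0)) (fun _ => 1) (fun _ => 1) one_bound
      (fun p hp => ⟨one_ne_zero, dvd_rfl⟩) ?_ ?_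
    · intro p hp p' hp' h _
      simp only [Prod.mk.injEq] at h
      exact hext p p' (hp.2.1.trans hp'.2.1.symm) (hp.2.2.1.trans hp'.2.2.1.symm)
        (hp.2.2.2.trans hp'.2.2.2.symm) h.1 h.2.1
    · intro p hp
      exact ⟨(hle p).1, (hle p).2, zero_le p⟩
  have s41 := s4 (fun p => p.a) (fun p => p.m) (fun p => p.n) (fun p => p.e)
    (fun p p' h1 h2 h3 h4 h5 => Plucker.ext h2 h1 h3 h4 h5)
    (fun p => by have := abs_le_size p; tauto)
  have s42 := s4 (fun p => p.a) (fun p => p.n) (fun p => p.m) (fun p => p.e)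
    (fun p p' h1 h2 h3 h4 h5 => Plucker.ext h2 h1 h4 h3 h5)
    (fun p => by have := abs_le_size p; tauto)
  have s43 := s4 (fun p => p.e) (fun p => p.m) (fun p => p.n) (fun p => p.a)
    (fun p p' h1 h2 h3 h4 h5 => Plucker.ext h5 h1 h3 h4 h2)
    (fun p => by have := abs_le_size p; tauto)
  have s44 := s4 (fun p => p.e) (fun p => p.n) (fun p => p.m) (fun p => p.a)
    (fun p p' h1 h2 h3 h4 h5 => Plucker.ext h5 h1 h4 h3 h2)
    (fun p => by have := abs_le_size p; tauto)
  change Summable ((fun p => (size p ^ 4)⁻¹) ∘ ((↑) : V → Plucker ℤ))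
  rw [summable_subtype_iff_indicator]
  have hF : ∀ p, 0 ≤ (size p ^ 4)⁻¹ := fun p => by positivity
  refine ((((((s1.add s2).add s3).add s41).add s42).add s43).add s44).of_nonneg_of_le
    (fun p => Set.indicator_nonneg (fun p _ => hF p) p) fun p => ?_
  have nn : ∀ A : Set (Plucker ℤ), 0 ≤ A.indicator (fun p => (size p ^ 4)⁻¹) p :=
    fun A => Set.indicator_nonneg (fun p _ => hF p) p
  have n1 := nn {p | p ∈ V ∧ p.a * p.e ≠ 0}
  have n2 := nn {p | p ∈ V ∧ p.a = 0 ∧ p.b ≠ 0}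
  have n3 := nn {p | p ∈ V ∧ p.e = 0 ∧ p.b ≠ 0}
  have n4 := nn {p | p ∈ V ∧ p.b = 0 ∧ p.a = 0 ∧ p.m = 0}
  have n5 := nn {p | p ∈ V ∧ p.b = 0 ∧ p.a = 0 ∧ p.n = 0}
  have n6 := nn {p | p ∈ V ∧ p.b = 0 ∧ p.e = 0 ∧ p.m = 0}
  have n7 := nn {p | p ∈ V ∧ p.b = 0 ∧ p.e = 0 ∧ p.n = 0}
  by_cases hp : p ∈ V
  swap
  · rw [Set.indicator_of_notMem hp]
    linarith
  rw [Set.indicator_of_mem hp]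
  have h : p.m * p.n = p.a * p.e + p.b ^ 2 := hp.1
  have cases : (p ∈ {p | p ∈ V ∧ p.a * p.e ≠ 0}) ∨ p ∈ {p | p ∈ V ∧ p.a = 0 ∧ p.b ≠ 0} ∨
      p ∈ {p | p ∈ V ∧ p.e = 0 ∧ p.b ≠ 0} ∨ p ∈ {p | p ∈ V ∧ p.b = 0 ∧ p.a = 0 ∧ p.m = 0} ∨
      p ∈ {p | p ∈ V ∧ p.b = 0 ∧ p.a = 0 ∧ p.n = 0} ∨
      p ∈ {p | p ∈ V ∧ p.b = 0 ∧ p.e = 0 ∧ p.m = 0} ∨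
      p ∈ {p | p ∈ V ∧ p.b = 0 ∧ p.e = 0 ∧ p.n = 0} := by
    by_cases hae : p.a * p.e = 0
    swap
    · left; exact ⟨hp, hae⟩
    by_cases hb : p.b = 0
    · rw [hae, hb] at h
      have hmn : p.m = 0 ∨ p.n = 0 := by simpa using h
      have hae' : p.a = 0 ∨ p.e = 0 := by simpa using hae
      simp only [Set.mem_ofPred_eq]
      tauto
    · have hae' : p.a = 0 ∨ p.e = 0 := by simpa using hae
      simp only [Set.mem_ofPred_eq]
      tauto
  rcases cases with h | h | h | h | h | h | h <;>
  · have := Set.indicator_of_mem h (fun p => (size p ^ 4)⁻¹)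
    linarith

/-! ### Lower bound for the linear form -/

section

open Asymptotics Filter

theorem im_pos (τ : UpperHalf) : 0 < (τ.1 0 0).im ∧
    0 < (τ.1 0 0).im * (τ.1 1 1).im - (τ.1 0 1).im ^ 2 := by
  have hs : τ.1 1 0 = τ.1 0 1 := congrFun (congrFun τ.2.1 0) 1
  refine ⟨?_, ?_⟩
  · have := τ.2.2.diag_pos (i := 0)
    simpa using this
  · have := τ.2.2.det_pos
    rw [Matrix.det_fin_two] at this
    simp only [Matrix.map_apply, hs] at this
    linarith

/-- Modulo the quadratic relation, |lin τ p|² is a positive definite quadratic form in the five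
coordinates, the majorant attached to τ. It is written here as a triangular sum of five squares; the
coefficients involve Im τ₀₀ and det Im τ, which are positive. -/
theorem normSq_lin (τ : UpperHalf) (p : Plucker ℝ) (hp : p.Isotropic) :
    ‖lin τ p‖ ^ 2 =
      (p.e + p.m * (τ.1 0 0).re - 2 * p.b * (τ.1 0 1).re + p.n * (τ.1 1 1).re +
        p.a * ((τ.1 0 0).re * (τ.1 1 1).re - (τ.1 0 1).re ^ 2)) ^ 2 +
      (((τ.1 0 0).im * (τ.1 1 1).im - (τ.1 0 1).im ^ 2) * p.a) ^ 2 +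
      ((τ.1 0 0).im * ((p.m + p.a * (τ.1 1 1).re)
        - 2 * (p.b + p.a * (τ.1 0 1).re) * ((τ.1 0 1).im / (τ.1 0 0).im)
        + (p.n + p.a * (τ.1 0 0).re) * ((τ.1 0 1).im / (τ.1 0 0).im) ^ 2)) ^ 2 +
      2 * ((τ.1 0 0).im * (τ.1 1 1).im - (τ.1 0 1).im ^ 2) *
        ((p.b + p.a * (τ.1 0 1).re) - (p.n + p.a * (τ.1 0 0).re) *
          ((τ.1 0 1).im / (τ.1 0 0).im)) ^ 2 +
      (((τ.1 0 0).im * (τ.1 1 1).im - (τ.1 0 1).im ^ 2) / (τ.1 0 0).im *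
        (p.n + p.a * (τ.1 0 0).re)) ^ 2 := by
  have h0 := (im_pos τ).1.ne'
  rw [← Complex.normSq_eq_norm_sq, Complex.normSq_apply]
  unfold Isotropic at hp
  have hre : (lin τ p).re = (p.e + p.m * (τ.1 0 0).re - 2 * p.b * (τ.1 0 1).re +
      p.n * (τ.1 1 1).re + p.a * ((τ.1 0 0).re * (τ.1 1 1).re - (τ.1 0 1).re ^ 2)) -
      ((τ.1 0 0).im * (τ.1 1 1).im - (τ.1 0 1).im ^ 2) * p.a := by
    simp [lin, pow_two]
    ring
  have him : (lin τ p).im = (p.m + p.a * (τ.1 1 1).re) * (τ.1 0 0).im -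
      2 * (p.b + p.a * (τ.1 0 1).re) * (τ.1 0 1).im +
      (p.n + p.a * (τ.1 0 0).re) * (τ.1 1 1).im := by
    simp [lin, pow_two]
    ring
  rw [hre, him]
  generalize (τ.1 0 0).im = y1 at *
  generalize (τ.1 0 1).im = y2 at *
  generalize (τ.1 1 1).im = y3 at *
  generalize (τ.1 0 0).re = x1 at *
  generalize (τ.1 0 1).re = x2 at *
  generalize (τ.1 1 1).re = x3 at *
  field_simp
  linear_combination (2 * (y1 * y3 - y2 ^ 2) * y1 ^ 2) * hp

theorem le_of_eq_sum_squares {R A B C D F w : ℝ} (hw : 0 ≤ w)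
    (h : R = A ^ 2 + B ^ 2 + C ^ 2 + w * D ^ 2 + F ^ 2) :
    A ^ 2 ≤ R ∧ B ^ 2 ≤ R ∧ C ^ 2 ≤ R ∧ w * D ^ 2 ≤ R ∧ F ^ 2 ≤ R := by
  have := mul_nonneg hw (sq_nonneg D)
  have := sq_nonneg A
  have := sq_nonneg B
  have := sq_nonneg C
  have := sq_nonneg F
  refine ⟨?_, ?_, ?_, ?_, ?_⟩ <;> linarith

theorem isotropic_toR {p : Plucker ℤ} (hp : p.Isotropic) : p.toR.Isotropic := by
  unfold Isotropic at *
  simp only [toR_a, toR_b, toR_m, toR_n, toR_e]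
  exact_mod_cast hp

/-- Because the squares in `normSq_lin` are triangular, the coordinates are bounded one after
another: a, then n, b and m up to shifts by Re τ, and finally e. -/
theorem size_isBigO (τ : UpperHalf) : size =O[𝓟 V] fun p => lin τ p.toR := by
  obtain ⟨hy, hΔ⟩ := im_pos τ
  set y1 := (τ.1 0 0).im with hy1
  set Δ := (τ.1 0 0).im * (τ.1 1 1).im - (τ.1 0 1).im ^ 2 with hΔ'
  set l := (τ.1 0 1).im / (τ.1 0 0).im with hl
  have key : ∀ (f : Plucker ℤ → ℝ), (∀ p ∈ V, f p ^ 2 ≤ ‖lin τ p.toR‖ ^ 2) →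
      f =O[𝓟 V] fun p => lin τ p.toR := by
    intro f hf
    rw [isBigO_principal]
    refine ⟨1, fun p hp => ?_⟩
    rw [one_mul, Real.norm_eq_abs]
    exact abs_le_of_sq_le_sq (hf p hp) (norm_nonneg _)
  have h2Δ : 0 ≤ 2 * Δ := by positivity
  have bound : ∀ p ∈ V, _ := fun p hp =>
    le_of_eq_sum_squares h2Δ (normSq_lin τ p.toR (isotropic_toR (p := p) hp.1))
  simp only [toR_a, toR_b, toR_m, toR_n, toR_e] at bound
  have hE : (fun p : Plucker ℤ => (p.e : ℝ) + p.m * (τ.1 0 0).re - 2 * p.b * (τ.1 0 1).re +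
      p.n * (τ.1 1 1).re + p.a * ((τ.1 0 0).re * (τ.1 1 1).re - (τ.1 0 1).re ^ 2))
      =O[𝓟 V] fun p => lin τ p.toR := by
    exact key _ fun p hp => (bound p hp).1
  have hA : (fun p : Plucker ℤ => (p.a : ℝ)) =O[𝓟 V] fun p => lin τ p.toR := by
    have : (fun p : Plucker ℤ => Δ * (p.a : ℝ)) =O[𝓟 V] fun p => lin τ p.toR := by
      exact key _ fun p hp => (bound p hp).2.1
    exact (isBigO_const_mul_left_iff hΔ.ne').1 this
  have hN' : (fun p : Plucker ℤ => (p.n : ℝ) + p.a * (τ.1 0 0).re)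
      =O[𝓟 V] fun p => lin τ p.toR := by
    have : (fun p : Plucker ℤ => Δ / y1 * ((p.n : ℝ) + p.a * (τ.1 0 0).re))
        =O[𝓟 V] fun p => lin τ p.toR := by
      exact key _ fun p hp => (bound p hp).2.2.2.2
    exact (isBigO_const_mul_left_iff (by positivity)).1 this
  have hB' : (fun p : Plucker ℤ => (p.b : ℝ) + p.a * (τ.1 0 1).re -
      (p.n + p.a * (τ.1 0 0).re) * l) =O[𝓟 V] fun p => lin τ p.toR := by
    have : (fun p : Plucker ℤ => √(2 * Δ) * ((p.b : ℝ) + p.a * (τ.1 0 1).re -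
        (p.n + p.a * (τ.1 0 0).re) * l)) =O[𝓟 V] fun p => lin τ p.toR := by
      refine key _ fun p hp => ?_
      rw [mul_pow, Real.sq_sqrt h2Δ]
      exact (bound p hp).2.2.2.1
    exact (isBigO_const_mul_left_iff (by positivity)).1 this
  have hM' : (fun p : Plucker ℤ => (p.m : ℝ) + p.a * (τ.1 1 1).re
      - 2 * (p.b + p.a * (τ.1 0 1).re) * l + (p.n + p.a * (τ.1 0 0).re) * l ^ 2)
      =O[𝓟 V] fun p => lin τ p.toR := by
    have : (fun p : Plucker ℤ => y1 * ((p.m : ℝ) + p.a * (τ.1 1 1).re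
      - 2 * (p.b + p.a * (τ.1 0 1).re) * l + (p.n + p.a * (τ.1 0 0).re) * l ^ 2))
      =O[𝓟 V] fun p => lin τ p.toR := by
      exact key _ fun p hp => (bound p hp).2.2.1
    exact (isBigO_const_mul_left_iff (by positivity)).1 this
  have hN : (fun p : Plucker ℤ => (p.n : ℝ)) =O[𝓟 V] fun p => lin τ p.toR := by
    refine (hN'.sub (hA.const_mul_left (τ.1 0 0).re)).congr_left fun p => ?_
    ring
  have hB : (fun p : Plucker ℤ => (p.b : ℝ)) =O[𝓟 V] fun p => lin τ p.toR := by
    refine ((hB'.sub (hA.const_mul_left (τ.1 0 1).re)).add (hN'.const_mul_left l)).congr_left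
      fun p => ?_
    ring
  have hM : (fun p : Plucker ℤ => (p.m : ℝ)) =O[𝓟 V] fun p => lin τ p.toR := by
    refine ((((hM'.sub (hA.const_mul_left (τ.1 1 1).re)).add (hB.const_mul_left (2 * l))).add
      (hA.const_mul_left (2 * l * (τ.1 0 1).re))).sub (hN'.const_mul_left (l ^ 2))).congr_left
      fun p => ?_
    ring
  have hE' : (fun p : Plucker ℤ => (p.e : ℝ)) =O[𝓟 V] fun p => lin τ p.toR := by
    refine ((((hE.sub (hM.const_mul_left (τ.1 0 0).re)).add
      (hB.const_mul_left (2 * (τ.1 0 1).re))).sub (hN.const_mul_left (τ.1 1 1).re)).sub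
      (hA.const_mul_left ((τ.1 0 0).re * (τ.1 1 1).re - (τ.1 0 1).re ^ 2))).congr_left
      fun p => ?_
    ring
  refine IsBigO.trans (g := fun p : Plucker ℤ => ‖(p.a : ℝ)‖ + ‖(p.b : ℝ)‖ + ‖(p.m : ℝ)‖ +
    ‖(p.n : ℝ)‖ + ‖(p.e : ℝ)‖) ?_ ((((hA.norm_left.add hB.norm_left).add hM.norm_left).add
    hN.norm_left).add hE'.norm_left)
  refine isBigO_of_le _ fun p => ?_
  rw [Real.norm_of_nonneg ((abs_nonneg _).trans (abs_le_size p).1),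
    Real.norm_of_nonneg (by positivity)]
  simp only [size, Real.norm_eq_abs]
  have := abs_nonneg (p.a : ℝ)
  have := abs_nonneg (p.b : ℝ)
  have := abs_nonneg (p.m : ℝ)
  have := abs_nonneg (p.n : ℝ)
  have := abs_nonneg (p.e : ℝ)
  refine max_le ?_ (max_le ?_ (max_le ?_ (max_le ?_ ?_))) <;> linarith

theorem lin_ne_zero (τ : UpperHalf) {p : Plucker ℤ} (hp : p ∈ V) : lin τ p.toR ≠ 0 := by
  intro h
  obtain ⟨c, hc⟩ := isBigO_principal.1 (size_isBigO τ)
  have h1 := hc p hp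
  rw [h, norm_zero, mul_zero, Real.norm_eq_abs] at h1
  have h2 := one_le_size hp
  have h3 := le_abs_self (size p)
  linarith

theorem summable_lin (τ : UpperHalf) {k : ℕ} (hk : 4 ≤ k) {Φ : Plucker ℤ → ℂ}
    (hΦ : ∀ p, ‖Φ p‖ ≤ 1) : Summable fun p : V => Φ p.1 * (lin τ p.1.toR ^ k)⁻¹ := by
  obtain ⟨c, hc⟩ := isBigO_principal.1 (size_isBigO τ)
  refine Summable.of_norm_bounded (summable_size.mul_left (c ^ k)) fun p => ?_
  have h1 := hc p.1 p.2
  have h2 := one_le_size p.2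
  rw [Real.norm_of_nonneg (by linarith)] at h1
  have hl : 0 < ‖lin τ p.1.toR‖ := norm_pos_iff.2 (lin_ne_zero τ p.2)
  rw [norm_mul, norm_inv, norm_pow]
  refine (mul_le_of_le_one_left (by positivity) (hΦ _)).trans ?_
  rw [← div_eq_mul_inv, le_div_iff₀ (by positivity), inv_mul_le_iff₀ (by positivity), mul_comm,
    ← mul_pow]
  exact (pow_le_pow_right₀ h2 hk).trans (pow_le_pow_left₀ (by positivity) h1 k)

end

/-! ### Reduction modulo `d` and explicit symplectic matrices -/

theorem symplectic_blocks (γ : Sp2Z) :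
    γ.1.toBlocks₁₁ * (γ.1.toBlocks₂₂)ᵀ - γ.1.toBlocks₁₂ * (γ.1.toBlocks₂₁)ᵀ = 1 ∧
    γ.1.toBlocks₁₁ * (γ.1.toBlocks₁₂)ᵀ = γ.1.toBlocks₁₂ * (γ.1.toBlocks₁₁)ᵀ ∧
    (γ.1.toBlocks₁₁)ᵀ * γ.1.toBlocks₂₁ = (γ.1.toBlocks₂₁)ᵀ * γ.1.toBlocks₁₁ ∧
    (γ.1.toBlocks₁₂)ᵀ * γ.1.toBlocks₂₂ = (γ.1.toBlocks₂₂)ᵀ * γ.1.toBlocks₁₂ := by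
  have h := SymplecticGroup.mem_iff.1 γ.2
  have h' := SymplecticGroup.mem_iff.1 (SymplecticGroup.transpose_mem γ.2)
  rw [← fromBlocks_toBlocks γ.1, Matrix.J, fromBlocks_transpose, fromBlocks_multiply,
    fromBlocks_multiply, fromBlocks_inj] at h
  rw [← fromBlocks_toBlocks γ.1, Matrix.J, fromBlocks_transpose, fromBlocks_transpose,
    fromBlocks_multiply, fromBlocks_multiply, fromBlocks_inj] at h'
  simp only [Matrix.transpose_transpose, Matrix.mul_zero, Matrix.mul_one, Matrix.mul_neg, zero_add,
    add_zero, Matrix.neg_mul] at h h'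
  obtain ⟨h1, h2, -, -⟩ := h
  obtain ⟨h3, -, -, h4⟩ := h'
  refine ⟨?_, ?_, ?_, ?_⟩
  · rw [← neg_inj, ← h2]; abel
  · rw [eq_comm, ← sub_eq_zero, ← h1]; abel
  · rw [eq_comm, ← sub_eq_zero, ← h3]; abel
  · rw [eq_comm, ← sub_eq_zero, ← h4]; abel

theorem cast_blockC {d : ℕ} {γ : Sp2Z} (h : ∀ i j, (d : ℤ) ∣ blockC γ i j) (i j : Fin 2) :
    ((γ.1 (.inr i) (.inl j) : ℤ) : ZMod d) = 0 :=
  (ZMod.intCast_zmod_eq_zero_iff_dvd _ d).2 (h i j)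

/-- If p comes from (C′, D′) and γ is upper triangular modulo d, then C′ is replaced by C′A modulo
d, so its determinant is multiplied by det A. By `det_mul_det_cast` this is the inverse of det D. -/
theorem act_a_cast {d : ℕ} {γ : Sp2Z} (h : ∀ i j, (d : ℤ) ∣ blockC γ i j) (p : Plucker ℤ) :
    ((act γ p).a : ZMod d) = p.a * (γ.1.toBlocks₁₁.det : ℤ) := by
  simp [act, ofMatrix, skew, Matrix.mul_apply, Matrix.det_fin_two, toBlocks₁₁, cast_blockC h]
  ring

theorem det_mul_det_cast {d : ℕ} {γ : Sp2Z} (h : ∀ i j, (d : ℤ) ∣ blockC γ i j) :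
    ((γ.1.toBlocks₁₁.det : ℤ) : ZMod d) * ((blockD γ).det : ℤ) = 1 := by
  have h1 := (symplectic_blocks γ).1
  have e : ∀ i j, _ := fun i j =>
    congrArg (Int.cast : ℤ → ZMod d) (congrFun (congrFun h1 i) j)
  have e00 := e 0 0
  have e01 := e 0 1
  have e10 := e 1 0
  have e11 := e 1 1
  simp [Matrix.mul_apply, toBlocks₁₁, toBlocks₁₂, toBlocks₂₁, toBlocks₂₂, cast_blockC h]
    at e00 e01 e10 e11
  simp only [blockD, Matrix.det_fin_two, toBlocks₁₁, toBlocks₂₂, Matrix.of_apply]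
  push_cast
  linear_combination ((γ.1 (.inl 1) (.inl 0) : ZMod d) * γ.1 (.inr 1) (.inr 0) +
    γ.1 (.inl 1) (.inl 1) * γ.1 (.inr 1) (.inr 1)) * e00 + e11 -
    ((γ.1 (.inl 0) (.inl 0) : ZMod d) * γ.1 (.inr 1) (.inr 0) +
    γ.1 (.inl 0) (.inl 1) * γ.1 (.inr 1) (.inr 1)) * e10

/-- `p` vanishes modulo `d` outside the coordinate `e`. -/
def RankZero (d : ℕ) (p : Plucker ℤ) : Prop :=
  (d : ℤ) ∣ p.a ∧ (d : ℤ) ∣ p.b ∧ (d : ℤ) ∣ p.m ∧ (d : ℤ) ∣ p.n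

theorem rankZero_iff {d : ℕ} {p : Plucker ℤ} : RankZero d p ↔
    (p.a : ZMod d) = 0 ∧ (p.b : ZMod d) = 0 ∧ (p.m : ZMod d) = 0 ∧ (p.n : ZMod d) = 0 := by
  simp only [RankZero, ZMod.intCast_zmod_eq_zero_iff_dvd]

theorem act_of_rankZero {d : ℕ} {γ : Sp2Z} (h : ∀ i j, (d : ℤ) ∣ blockC γ i j) {p : Plucker ℤ}
    (hp : RankZero d p) :
    RankZero d (act γ p) ∧ ((act γ p).e : ZMod d) = p.e * ((blockD γ).det : ℤ) := by
  rw [rankZero_iff] at hp ⊢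
  obtain ⟨ha, hb, hm, hn⟩ := hp
  refine ⟨⟨?_, ?_, ?_, ?_⟩, ?_⟩ <;>
  simp [act, ofMatrix, skew, Matrix.mul_apply, Matrix.det_fin_two, blockD, toBlocks₂₂,
    cast_blockC h, ha, hb, hm, hn]
  ring

theorem blockC_inv_dvd {d : ℕ} {γ : Sp2Z} (h : ∀ i j, (d : ℤ) ∣ blockC γ i j) (i j : Fin 2) :
    (d : ℤ) ∣ blockC γ⁻¹ i j := (Gamma0 d).inv_mem (x := γ) h i j

theorem rankZero_act_iff {d : ℕ} {γ : Sp2Z} (h : ∀ i j, (d : ℤ) ∣ blockC γ i j)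
    (p : Plucker ℤ) : RankZero d (act γ p) ↔ RankZero d p := by
  refine ⟨fun hp => ?_, fun hp => (act_of_rankZero h hp).1⟩
  have := (act_of_rankZero (blockC_inv_dvd h) hp).1
  rwa [act_inv_act] at this

theorem dvd_act_a_iff {d : ℕ} {γ : Sp2Z} (h : ∀ i j, (d : ℤ) ∣ blockC γ i j)
    (p : Plucker ℤ) : (d : ℤ) ∣ (act γ p).a ↔ (d : ℤ) ∣ p.a := by
  rw [← ZMod.intCast_zmod_eq_zero_iff_dvd, ← ZMod.intCast_zmod_eq_zero_iff_dvd, act_a_cast h]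
  constructor
  · intro h0
    have := congrArg (· * (((blockD γ).det : ℤ) : ZMod d)) h0
    simpa [mul_assoc, det_mul_det_cast h] using this
  · intro h0
    rw [h0, zero_mul]

/-- The unipotent matrix `(1 S; 0 1)`, `S = (s₁ s₂; s₂ s₃)`. -/
def transl (s₁ s₂ s₃ : ℤ) : Sp2Z :=
  ⟨fromBlocks 1 !![s₁, s₂; s₂, s₃] 0 1, by
    rw [SymplecticGroup.mem_iff, Matrix.J, fromBlocks_transpose, fromBlocks_multiply,
      fromBlocks_multiply, fromBlocks_inj]
    refine ⟨?_, by simp, by simp, by simp⟩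
    ext i j
    fin_cases i <;> fin_cases j <;> simp⟩

theorem act_transl (s₁ s₂ s₃ : ℤ) (p : Plucker ℤ) : act (transl s₁ s₂ s₃) p =
    ⟨p.a, p.b + p.a * s₂, p.m + p.a * s₃, p.n + p.a * s₁,
      p.e + p.m * s₁ - 2 * p.b * s₂ + p.n * s₃ + p.a * (s₁ * s₃ - s₂ ^ 2)⟩ := by
  ext <;> simp [act, ofMatrix, skew, Matrix.mul_apply, transl] <;> ring

/-- The block diagonal matrix with blocks `A` and `D = A⁻ᵀ`. -/
def levi (A D : Matrix (Fin 2) (Fin 2) ℤ) (h : A * Dᵀ = 1) : Sp2Z :=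
  ⟨fromBlocks A 0 0 D, by
    rw [SymplecticGroup.mem_iff, Matrix.J, fromBlocks_transpose, fromBlocks_multiply,
      fromBlocks_multiply, fromBlocks_inj]
    have h' : D * Aᵀ = 1 := by
      rw [← Matrix.transpose_transpose D, ← Matrix.transpose_mul, h, Matrix.transpose_one]
    simp [h, h']⟩

theorem act_levi (A D : Matrix (Fin 2) (Fin 2) ℤ) (h : A * Dᵀ = 1) (p : Plucker ℤ) :
    act (levi A D h) p = ⟨p.a * A.det,
      p.b * (A 0 0 * D 0 0 - A 1 0 * D 1 0) + p.m * (A 0 0 * D 1 0) - p.n * (A 1 0 * D 0 0),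
      p.b * (A 0 0 * D 0 1 - A 1 0 * D 1 1) + p.m * (A 0 0 * D 1 1) - p.n * (A 1 0 * D 0 1),
      -(p.b * (A 0 1 * D 0 0 - A 1 1 * D 1 0) + p.m * (A 0 1 * D 1 0) - p.n * (A 1 1 * D 0 0)),
      p.e * D.det⟩ := by
  ext <;> simp [act, ofMatrix, skew, Matrix.mul_apply, levi, Matrix.det_fin_two] <;> ring

/-- `SL₂` acting on the first pair of symplectic coordinates. -/
def embFst (x y z w : ℤ) (h : x * w - y * z = 1) : Sp2Z :=
  ⟨fromBlocks !![x, 0; 0, 1] !![y, 0; 0, 0] !![z, 0; 0, 0] !![w, 0; 0, 1], by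
    rw [SymplecticGroup.mem_iff, Matrix.J, fromBlocks_transpose, fromBlocks_multiply,
      fromBlocks_multiply, fromBlocks_inj]
    refine ⟨?_, ?_, ?_, ?_⟩ <;> ext i j <;> fin_cases i <;> fin_cases j <;>
      simp [Matrix.vecMul, dotProduct, Fin.sum_univ_two] <;>
      first | ring1 | linear_combination h | linear_combination -h⟩

theorem act_embFst (x y z w : ℤ) (h : x * w - y * z = 1) (p : Plucker ℤ) :
    act (embFst x y z w h) p =
      ⟨x * p.a + z * p.n, p.b, x * p.m + z * p.e, y * p.a + w * p.n, y * p.m + w * p.e⟩ := by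
  ext <;> simp [act, ofMatrix, skew, Matrix.mul_apply, embFst] <;>
    first | ring1 | linear_combination p.b * h

/-- `SL₂` acting on the second pair of symplectic coordinates. -/
def embSnd (x y z w : ℤ) (h : x * w - y * z = 1) : Sp2Z :=
  ⟨fromBlocks !![1, 0; 0, x] !![0, 0; 0, y] !![0, 0; 0, z] !![1, 0; 0, w], by
    rw [SymplecticGroup.mem_iff, Matrix.J, fromBlocks_transpose, fromBlocks_multiply,
      fromBlocks_multiply, fromBlocks_inj]
    refine ⟨?_, ?_, ?_, ?_⟩ <;> ext i j <;> fin_cases i <;> fin_cases j <;>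
      simp [Matrix.vecMul, dotProduct, Fin.sum_univ_two] <;>
      first | ring1 | linear_combination h | linear_combination -h⟩

theorem act_embSnd (x y z w : ℤ) (h : x * w - y * z = 1) (p : Plucker ℤ) :
    act (embSnd x y z w h) p =
      ⟨x * p.a + z * p.m, p.b, y * p.a + w * p.m, x * p.n + z * p.e, y * p.n + w * p.e⟩ := by
  ext <;> simp [act, ofMatrix, skew, Matrix.mul_apply, embSnd] <;> ring

theorem exists_unimodular_kill (a m : ℤ) :
    ∃ x y z w : ℤ, x * w - y * z = 1 ∧ x * a + z * m = 0 := by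
  by_cases hg : Int.gcd a m = 0
  · rw [Int.gcd_eq_zero_iff] at hg
    exact ⟨1, 0, 0, 1, by norm_num, by simp [hg.1, hg.2]⟩
  · obtain ⟨a', ha⟩ := Int.gcd_dvd_left a m
    obtain ⟨m', hm⟩ := Int.gcd_dvd_right a m
    have hb := Int.gcd_eq_gcd_ab a m
    set g : ℤ := (Int.gcd a m : ℤ) with hgdef
    have hg0 : g ≠ 0 := by rw [hgdef]; exact_mod_cast hg
    refine ⟨m', Int.gcdA a m, -a', Int.gcdB a m, ?_, ?_⟩
    · apply mul_left_cancel₀ hg0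
      linear_combination -hb + Int.gcdA a m * (-ha) - Int.gcdB a m * hm
    · rw [ha, hm]
      ring

/-- Up to sign, every primitive isotropic vector comes from a symplectic matrix. -/
theorem exists_pl_eq {p : Plucker ℤ} (hp : p ∈ V) : ∃ γ : Sp2Z, pl γ = p ∨ pl γ = -p := by
  obtain ⟨x, y, z, w, h1, hk1⟩ := exists_unimodular_kill p.a p.m
  set p1 := act (embSnd x y z w h1) p with hp1
  have m1 : p1 ∈ V := act_mem_V _ hp
  have a1 : p1.a = 0 := by rw [hp1, act_embSnd]; exact hk1
  have i1 : p1.m * p1.n = p1.b ^ 2 := by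
    have : p1.m * p1.n = p1.a * p1.e + p1.b ^ 2 := m1.1
    rw [this, a1]; ring
  -- With a = 0 the quadratic relation says that the symmetric matrix (m b; b n) is singular. The
  -- primitive vector (u2, -u4) lies in its kernel and is completed to a unimodular matrix, which
  -- then removes b and n.
  obtain ⟨u1, u2, u3, u4, hu, k1, k2⟩ : ∃ u1 u2 u3 u4 : ℤ, u1 * u4 - u2 * u3 = 1 ∧
      p1.m * u2 - p1.b * u4 = 0 ∧ p1.n * u4 - p1.b * u2 = 0 := by
    by_cases hm : p1.m = 0
    · have hb : p1.b = 0 := by simpa [hm] using i1.symm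
      exact ⟨0, 1, -1, 0, by norm_num, by simp [hm, hb], by simp [hb]⟩
    · obtain ⟨x', y', z', w', h2, hk2⟩ := exists_unimodular_kill p1.m (-p1.b)
      refine ⟨-y', x', -w', z', by linarith, by linarith, ?_⟩
      apply mul_left_cancel₀ hm
      linear_combination z' * i1 - p1.b * hk2
  have hU : !![u1, u2; u3, u4] * (!![u4, -u3; -u2, u1])ᵀ = 1 := by
    ext i j
    fin_cases i <;> fin_cases j <;> simp [Matrix.mul_apply] <;>
      first | ring1 | linear_combination hu
  set p2 := act (levi _ _ hU) p1 with hp2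
  have m2 : p2 ∈ V := act_mem_V _ m1
  have a2 : p2.a = 0 := by rw [hp2, act_levi]; simp [a1]
  have b2 : p2.b = 0 := by
    rw [hp2, act_levi]; simp
    linear_combination -u1 * k1 - u3 * k2
  have n2 : p2.n = 0 := by
    rw [hp2, act_levi]; simp
    linear_combination u2 * k1 + u4 * k2
  -- Only m and e are left, and a unimodular combination removes m; primitivity then makes e a unit.
  obtain ⟨x', y', z', w', h3, hk3⟩ := exists_unimodular_kill p2.m p2.e
  set p3 := act (embFst x' y' z' w' h3) p2 with hp3
  have m3 : p3 ∈ V := act_mem_V _ m2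
  have a3 : p3.a = 0 := by rw [hp3, act_embFst]; simp [a2, n2]
  have b3 : p3.b = 0 := by rw [hp3, act_embFst]; exact b2
  have mm3 : p3.m = 0 := by rw [hp3, act_embFst]; exact hk3
  have n3 : p3.n = 0 := by rw [hp3, act_embFst]; simp [a2, n2]
  have e3 : p3.e = 1 ∨ p3.e = -1 := by
    rw [← Int.isUnit_iff]
    refine m3.2 _ ?_ ?_ ?_ ?_ dvd_rfl <;> simp [a3, b3, mm3, n3]
  have hγ : p3 = act (embSnd x y z w h1 * levi _ _ hU * embFst x' y' z' w' h3) p := by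
    rw [act_mul, act_mul]
  refine ⟨(embSnd x y z w h1 * levi _ _ hU * embFst x' y' z' w' h3)⁻¹, ?_⟩
  rcases e3 with e | e
  · left
    have : basePt = p3 := by ext <;> simp [basePt, a3, b3, mm3, n3, e]
    rw [pl, this, hγ, act_inv_act]
  · right
    have : basePt = -p3 := by ext <;> simp [basePt, a3, b3, mm3, n3, e]
    rw [pl, this, hγ, act_neg, act_inv_act]

/-! ### The orbits of `Gamma0 N` on Lagrangian planes -/

section

open scoped MatrixGroups

theorem natAbs_emod_lt (x y : ℤ) (hx : x ≠ 0) : (y % x).natAbs < x.natAbs := by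
  have h1 := Int.emod_nonneg y hx
  have h2 := Int.emod_lt_abs y hx
  rw [Int.abs_eq_natAbs] at h2
  omega

/-- Smith normal form of an integral `2 × 2` matrix. -/
theorem exists_smith (C : Matrix (Fin 2) (Fin 2) ℤ) :
    ∃ (U W : SL(2, ℤ)) (x z : ℤ), U.1 * C * W.1 = Matrix.diagonal ![x, z] ∧ x ∣ z := by
  classical
  set S : Set (Matrix (Fin 2) (Fin 2) ℤ) := {X | ∃ U W : SL(2, ℤ), X = U.1 * C * W.1} with hS
  have mulR : ∀ X ∈ S, ∀ W : SL(2, ℤ), X * W.1 ∈ S := by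
    rintro X ⟨U, W, rfl⟩ W'
    exact ⟨U, W * W', by simp [Matrix.mul_assoc]⟩
  have mulL : ∀ X ∈ S, ∀ U : SL(2, ℤ), U.1 * X ∈ S := by
    rintro X ⟨U, W, rfl⟩ U'
    exact ⟨U' * U, W, by simp [Matrix.mul_assoc]⟩
  by_cases hC : C = 0
  · exact ⟨1, 1, 0, 0, by ext i j; fin_cases i <;> fin_cases j <;> simp [hC], dvd_rfl⟩
  let J' : SL(2, ℤ) := ⟨!![0, -1; 1, 0], by simp [Matrix.det_fin_two]⟩
  let tr : ℤ → SL(2, ℤ) := fun t => ⟨!![1, t; 0, 1], by simp [Matrix.det_fin_two]⟩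
  let tl : ℤ → SL(2, ℤ) := fun t => ⟨!![1, 0; t, 1], by simp [Matrix.det_fin_two]⟩
  have hC1 : C ∈ S := ⟨1, 1, by simp⟩
  have hne : ∃ g : ℕ, ∃ X ∈ S, X 0 0 ≠ 0 ∧ (X 0 0).natAbs = g := by
    have : ∃ i j, C i j ≠ 0 := by
      by_contra h
      push Not at h
      exact hC (by ext i j; exact h i j)
    obtain ⟨i, j, hij⟩ := this
    fin_cases i <;> fin_cases j
    · exact ⟨_, C, hC1, hij, rfl⟩
    · exact ⟨_, _, mulR _ hC1 J', by simpa [J', Matrix.mul_apply] using hij, rfl⟩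
    · exact ⟨_, _, mulL _ hC1 J', by simpa [J', Matrix.mul_apply] using hij, rfl⟩
    · exact ⟨_, _, mulL _ (mulR _ hC1 J') J', by simpa [J', Matrix.mul_apply] using hij, rfl⟩
  set g := Nat.find hne with hg
  obtain ⟨X, hX, hX0, hXg⟩ := Nat.find_spec hne
  rw [← hg] at hXg
  have hmin : ∀ Y ∈ S, (Y 0 0).natAbs < g → Y 0 0 = 0 := by
    intro Y hY hlt
    by_contra h0
    exact Nat.find_min hne hlt ⟨Y, hY, h0, rfl⟩
  -- A nonzero remainder of the second entry by the corner could be moved into the corner by `J'`,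
  -- against minimality.
  have right : ∀ Y ∈ S, Y 0 0 ≠ 0 → (Y 0 0).natAbs = g → Y 0 0 ∣ Y 0 1 := by
    intro Y hY h0 hg'
    have h1 := hmin _ (mulR _ (mulR _ hY (tr (-(Y 0 1 / Y 0 0)))) J')
    have e : (Y * (tr (-(Y 0 1 / Y 0 0))).1 * J'.1) 0 0 = Y 0 1 % Y 0 0 := by
      simp [J', tr, Matrix.mul_apply, Fin.sum_univ_two, Int.emod_def]
      ring
    rw [e] at h1
    exact Int.dvd_of_emod_eq_zero (h1 (hg' ▸ natAbs_emod_lt _ _ h0))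
  have left : ∀ Y ∈ S, Y 0 0 ≠ 0 → (Y 0 0).natAbs = g → Y 0 0 ∣ Y 1 0 := by
    intro Y hY h0 hg'
    have h1 := hmin _ (mulL _ (mulL _ hY (tl (-(Y 1 0 / Y 0 0)))) J')
    have e : (J'.1 * ((tl (-(Y 1 0 / Y 0 0))).1 * Y)) 0 0 = -(Y 1 0 % Y 0 0) := by
      simp [J', tl, Matrix.mul_apply, Fin.sum_univ_two, Int.emod_def, Matrix.vecMul, dotProduct]
      ring
    rw [e, Int.natAbs_neg, neg_eq_zero] at h1
    exact Int.dvd_of_emod_eq_zero (h1 (hg' ▸ natAbs_emod_lt _ _ h0))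
  obtain ⟨s, hs⟩ := right X hX hX0 hXg
  obtain ⟨t, ht⟩ := left X hX hX0 hXg
  set Z := (tl (-t)).1 * (X * (tr (-s)).1) with hZ
  have hZS : Z ∈ S := mulL _ (mulR _ hX _) _
  have hZd : Z = Matrix.diagonal ![X 0 0, Z 1 1] := by
    ext i j
    fin_cases i <;> fin_cases j <;>
      simp [hZ, tl, tr, Matrix.mul_apply, Fin.sum_univ_two, Matrix.vecMul, dotProduct, hs, ht]
    ring
  -- Adding the second row to the first one keeps the corner and puts `Z 1 1` next to it.
  have hdvd : X 0 0 ∣ Z 1 1 := by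
    have h := right _ (mulL _ hZS (tr 1))
    have e0 : ((tr 1).1 * Z) 0 0 = X 0 0 := by
      rw [hZd]; simp [tr, Matrix.mul_apply, Fin.sum_univ_two]
    have e1 : ((tr 1).1 * Z) 0 1 = Z 1 1 := by
      rw [hZd]; simp [tr, Matrix.mul_apply, Fin.sum_univ_two]
    rw [e0, e1] at h
    exact h hX0 hXg
  obtain ⟨U, W, hUW⟩ := hZS
  exact ⟨U, W, X 0 0, Z 1 1, hUW ▸ hZd, hdvd⟩

theorem dvd_of_squarefree {n : ℕ} (hn : Squarefree n) {x : ℤ}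
    (h : ∀ q : ℕ, q.Prime → q ∣ n → (q : ℤ) ∣ x) : (n : ℤ) ∣ x := by
  rw [Int.natCast_dvd, ← Nat.prod_primeFactors_of_squarefree hn]
  refine Finset.prod_primes_dvd _ (fun q hq => (Nat.prime_of_mem_primeFactors hq).prime)
    fun q hq => ?_
  exact Int.natCast_dvd.1 (h q (Nat.prime_of_mem_primeFactors hq) (Nat.dvd_of_mem_primeFactors hq))

theorem pl_levi (A D : Matrix (Fin 2) (Fin 2) ℤ) (h : A * Dᵀ = 1) (hD : D.det = 1) :
    pl (levi A D h) = basePt := by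
  rw [pl, act_levi, hD]
  simp [basePt]

theorem pl_transl (s₁ s₂ s₃ : ℤ) : pl (transl s₁ s₂ s₃) = basePt := by
  rw [pl, act_transl]
  simp [basePt]

theorem mem_Gamma0_of_blockC_eq_zero {γ : Sp2Z} (N : ℕ) (h : blockC γ = 0) : γ ∈ Gamma0 N := by
  intro i j
  rw [h]; simp

theorem levi_mem (N : ℕ) (A D : Matrix (Fin 2) (Fin 2) ℤ) (h : A * Dᵀ = 1) :
    levi A D h ∈ Gamma0 N :=
  mem_Gamma0_of_blockC_eq_zero N (by simp [levi, blockC])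

theorem blockC_levi_mul_mul_levi (A D A' D' : Matrix (Fin 2) (Fin 2) ℤ) (h : A * Dᵀ = 1)
    (h' : A' * D'ᵀ = 1) (γ : Sp2Z) :
    blockC (levi A D h * γ * levi A' D' h') = D * blockC γ * A' := by
  rw [blockC_mul, blockC, blockD, Submonoid.coe_mul]
  have h1 : (levi A D h).1 = fromBlocks A 0 0 D := rfl
  have h2 : (levi A' D' h').1 = fromBlocks A' 0 0 D' := rfl
  rw [h1, ← fromBlocks_toBlocks γ.1, fromBlocks_multiply, h2, blockC, h2]
  simp [blockC]

theorem blockD_inv (γ : Sp2Z) : blockD γ⁻¹ = (γ.1.toBlocks₁₁)ᵀ := by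
  have h := SymplecticGroup.coe_inv γ
  rw [← fromBlocks_toBlocks (γ : Matrix (Fin 2 ⊕ Fin 2) (Fin 2 ⊕ Fin 2) ℤ), Matrix.J,
    fromBlocks_transpose, fromBlocks_neg, fromBlocks_multiply, fromBlocks_multiply] at h
  rw [blockD, h]
  simp

theorem Gamma0_mono {d N : ℕ} (hd : d ∣ N) {γ : Sp2Z} (h : γ ∈ Gamma0 N) (i j : Fin 2) :
    (d : ℤ) ∣ blockC γ i j := (Int.natCast_dvd_natCast.2 hd).trans (h i j)

theorem rankZero_neg {d : ℕ} {p : Plucker ℤ} : RankZero d (-p) ↔ RankZero d p := by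
  simp [RankZero]

/-- The conditions on `p` modulo the primes that divide `N₀ N₁ N₂` which single out the cusp
`(N₀, N₁, N₂)`. -/
def HasType (N₀ N₁ N₂ : ℕ) (p : Plucker ℤ) : Prop :=
  (∀ q : ℕ, q.Prime → q ∣ N₀ → RankZero q p) ∧
  (∀ q : ℕ, q.Prime → q ∣ N₁ → (q : ℤ) ∣ p.a ∧ ¬ RankZero q p) ∧
  (∀ q : ℕ, q.Prime → q ∣ N₂ → ¬ (q : ℤ) ∣ p.a)

theorem HasType.neg {N₀ N₁ N₂ : ℕ} {p : Plucker ℤ} (h : HasType N₀ N₁ N₂ p) :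
    HasType N₀ N₁ N₂ (-p) := by
  simpa only [HasType, rankZero_neg, neg_a, dvd_neg] using h

theorem HasType.act {N N₀ N₁ N₂ : ℕ} (hN : N₀ * N₁ * N₂ = N) {γ : Sp2Z} (hγ : γ ∈ Gamma0 N)
    {p : Plucker ℤ} (h : HasType N₀ N₁ N₂ p) : HasType N₀ N₁ N₂ (act γ p) := by
  obtain ⟨h0, h1, h2⟩ := h
  have d0 : N₀ ∣ N := ⟨N₁ * N₂, by rw [← hN]; ring⟩
  have d1 : N₁ ∣ N := ⟨N₀ * N₂, by rw [← hN]; ring⟩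
  have d2 : N₂ ∣ N := ⟨N₀ * N₁, by rw [← hN]; ring⟩
  refine ⟨fun q hq hd => ?_, fun q hq hd => ?_, fun q hq hd => ?_⟩
  · rw [rankZero_act_iff (Gamma0_mono (hd.trans d0) hγ)]; exact h0 q hq hd
  · rw [rankZero_act_iff (Gamma0_mono (hd.trans d1) hγ),
      dvd_act_a_iff (Gamma0_mono (hd.trans d1) hγ)]; exact h1 q hq hd
  · rw [dvd_act_a_iff (Gamma0_mono (hd.trans d2) hγ)]; exact h2 q hq hd

theorem exists_mul_congr {n : ℕ} {x : ℤ} (h : ∀ q : ℕ, q.Prime → q ∣ n → ¬ (q : ℤ) ∣ x) (y : ℤ) :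
    ∃ s : ℤ, (n : ℤ) ∣ s * x - y := by
  have hc : IsCoprime x (n : ℤ) := by
    rw [Int.isCoprime_iff_gcd_eq_one]
    by_contra hne
    obtain ⟨q, hq, hd⟩ := Nat.exists_prime_and_dvd hne
    have hd' : (q : ℤ) ∣ (Int.gcd x n : ℤ) := Int.natCast_dvd_natCast.2 hd
    exact h q hq (Int.natCast_dvd_natCast.1 (hd'.trans (Int.gcd_dvd_right _ _)))
      (hd'.trans (Int.gcd_dvd_left _ _))
  obtain ⟨u, v, huv⟩ := hc
  exact ⟨y * u, -v * y, by linear_combination y * huv⟩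

theorem dvd_of_prod_primewise {N N₀ N₁ N₂ : ℕ} (hN : N₀ * N₁ * N₂ = N) (hsq : Squarefree N) {x : ℤ}
    (h0 : ∀ q : ℕ, q.Prime → q ∣ N₀ → (q : ℤ) ∣ x) (h1 : ∀ q : ℕ, q.Prime → q ∣ N₁ → (q : ℤ) ∣ x)
    (h2 : ∀ q : ℕ, q.Prime → q ∣ N₂ → (q : ℤ) ∣ x) : (N : ℤ) ∣ x := by
  refine dvd_of_squarefree hsq fun q hq hd => ?_
  rw [← hN, hq.dvd_mul, hq.dvd_mul] at hd
  rcases hd with (hd | hd) | hd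
  exacts [h0 q hq hd, h1 q hq hd, h2 q hq hd]

theorem cuspM_congr {N N₀ N₁ N₂ : ℕ} (hN : N₀ * N₁ * N₂ = N) (hsq : Squarefree N) :
    ((N₀ : ℤ) ∣ zeroOne N₀ (N₁ * N₂)) ∧ ((N₁ * N₂ : ℕ) : ℤ) ∣ zeroOne N₀ (N₁ * N₂) - 1 ∧
    ((N₀ * N₁ : ℕ) : ℤ) ∣ zeroOne (N₀ * N₁) N₂ ∧ (N₂ : ℤ) ∣ zeroOne (N₀ * N₁) N₂ - 1 := by
  have c1 : N₀.Coprime (N₁ * N₂) := by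
    rw [← hN, mul_assoc] at hsq; exact Nat.coprime_of_squarefree_mul hsq
  have c2 : (N₀ * N₁).Coprime N₂ := by
    rw [← hN] at hsq; exact Nat.coprime_of_squarefree_mul hsq
  exact ⟨Int.modEq_zero_iff_dvd.1 (zeroOne_left _ _), (zeroOne_right c1).symm.dvd,
    Int.modEq_zero_iff_dvd.1 (zeroOne_left _ _), (zeroOne_right c2).symm.dvd⟩

/-- The vectors of a given type form, up to sign, a single orbit of `Γ₀(N)`. -/
theorem HasType.exists_act {N N₀ N₁ N₂ : ℕ} (hN : N₀ * N₁ * N₂ = N) (hsq : Squarefree N)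
    {p : Plucker ℤ} (hp : p ∈ V) (h : HasType N₀ N₁ N₂ p) :
    ∃ γ ∈ Gamma0 N, p = SiegelEisenstein.act γ (pl (cuspRep N₀ N₁ N₂)) ∨
      p = -SiegelEisenstein.act γ (pl (cuspRep N₀ N₁ N₂)) := by
  obtain ⟨γ₁, hγ₁⟩ := exists_pl_eq hp
  -- Levi factors replace C by UCW, so C may be taken diagonal: the left factor does not change the
  -- plane, and the right factor lies in `Gamma0 N`.
  obtain ⟨U, W, x, z, hUW, hxz⟩ := exists_smith (blockC γ₁)
  have hU : (U⁻¹).1ᵀ * U.1ᵀ = 1 := by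
    rw [← Matrix.transpose_mul, ← Matrix.SpecialLinearGroup.coe_mul, mul_inv_cancel]; simp
  have hW : W.1 * ((W⁻¹).1ᵀ)ᵀ = 1 := by
    rw [Matrix.transpose_transpose, ← Matrix.SpecialLinearGroup.coe_mul, mul_inv_cancel]; simp
  set β := levi _ _ hW with hβ
  have hβN : β ∈ Gamma0 N := levi_mem N _ _ hW
  set γ₂ := levi _ _ hU * γ₁ * β with hγ₂
  have hC : blockC γ₂ = Matrix.diagonal ![x, z] := by
    rw [hγ₂, hβ, blockC_levi_mul_mul_levi, hUW]
  have hpl : pl γ₂ = SiegelEisenstein.act β (pl γ₁) := by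
    rw [hγ₂, pl_mul, pl_mul, pl_levi _ _ _ U.2]; rfl
  have htype : HasType N₀ N₁ N₂ (pl γ₂) := by
    rw [hpl]
    refine HasType.act hN hβN ?_
    rcases hγ₁ with h' | h' <;> rw [h']
    exacts [h, h.neg]
  have hV : pl γ₂ ∈ V := pl_mem γ₂
  have hsym := (symplectic_blocks γ₂).2.2.1
  have hplx := pl_eq γ₂
  rw [hC] at hplx
  simp at hplx
  set D := blockD γ₂ with hD
  -- If q does not divide x, the coordinates b = x D₁₀ and m = x D₁₁ force the last row of D to
  -- vanish modulo q. Then q divides e too, against primitivity.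
  have hx0 : ∀ q : ℕ, q.Prime → q ∣ N₀ → (q : ℤ) ∣ x := by
    intro q hq hd
    have hr := htype.1 q hq hd
    by_contra hx
    have hq' : Prime (q : ℤ) := Nat.prime_iff_prime_int.1 hq
    have h10 : (q : ℤ) ∣ D 1 0 := by
      have := hr.2.1; rw [hplx] at this; exact (hq'.dvd_or_dvd this).resolve_left hx
    have h11 : (q : ℤ) ∣ D 1 1 := by
      have := hr.2.2.1; rw [hplx] at this; exact (hq'.dvd_or_dvd this).resolve_left hx
    refine hq'.not_isUnit (hV.2 q hr.1 hr.2.1 hr.2.2.1 hr.2.2.2 ?_)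
    rw [hplx]
    simp only [Matrix.det_fin_two]
    exact dvd_sub (h11.mul_left _) (h10.mul_left _)
  have hx12 : ∀ q : ℕ, q.Prime → q ∣ N₁ * N₂ → ¬ (q : ℤ) ∣ x := by
    intro q hq hd hx
    have ha : (q : ℤ) ∣ (pl γ₂).a := by rw [hplx]; exact hx.mul_right _
    rcases hq.dvd_mul.1 hd with hd | hd
    · refine (htype.2.1 q hq hd).2 ⟨ha, ?_, ?_, ?_⟩ <;> rw [hplx]
      · exact hx.mul_right _
      · exact hx.mul_right _
      · exact (hx.trans hxz).mul_left _
    · exact htype.2.2 q hq hd ha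
  have hz1 : ∀ q : ℕ, q.Prime → q ∣ N₁ → (q : ℤ) ∣ z := by
    intro q hq hd
    have ha := (htype.2.1 q hq hd).1
    rw [hplx] at ha
    exact ((Nat.prime_iff_prime_int.1 hq).dvd_or_dvd ha).resolve_left
      (hx12 q hq (hd.mul_right _))
  have hz2 : ∀ q : ℕ, q.Prime → q ∣ N₂ → ¬ (q : ℤ) ∣ z := by
    intro q hq hd hz
    exact htype.2.2 q hq hd (by rw [hplx]; exact hz.mul_left _)
  set A := γ₂.1.toBlocks₁₁ with hA
  -- The symmetry of AᵀC supplies the off-diagonal congruence for which no parameter is left.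
  have hsym' : x * A 0 1 = z * A 1 0 := by
    have e := congrFun (congrFun hsym 0) 1
    change (Aᵀ * blockC γ₂) 0 1 = ((blockC γ₂)ᵀ * A) 0 1 at e
    rw [hC] at e
    simp [Matrix.mul_apply] at e
    linarith
  -- The lower left block of γ_ρ⁻¹ (1 S; 0 1) γ₂ is C - M_ρ(A + SC), and it has to vanish modulo N.
  -- Modulo N₁N₂ this asks for A₀₀ + s₁x ≡ x, and modulo N₂ also for s₂x ≡ -A₁₀ and A₁₁ + s₃z ≡ z.
  obtain ⟨s₁, hs₁⟩ := exists_mul_congr hx12 (x - A 0 0)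
  obtain ⟨s₂, hs₂⟩ := exists_mul_congr (n := N₂) (x := x)
    (fun q hq hd => hx12 q hq (hd.mul_left _)) (-A 1 0)
  obtain ⟨s₃, hs₃⟩ := exists_mul_congr hz2 (z - A 1 1)
  obtain ⟨m10, m11, m20, m21⟩ := cuspM_congr hN hsq
  set M₁ := zeroOne N₀ (N₁ * N₂)
  set M₂ := zeroOne (N₀ * N₁) N₂
  set γ' := (cuspRep N₀ N₁ N₂)⁻¹ * (transl s₁ s₂ s₃ * γ₂) with hγ'
  have hblock : blockC γ' = !![x - M₁ * (A 0 0 + s₁ * x), -M₁ * (A 0 1 + s₂ * z);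
      -M₂ * (A 1 0 + s₂ * x), z - M₂ * (A 1 1 + s₃ * z)] := by
    have h11 : (transl s₁ s₂ s₃ * γ₂).1.toBlocks₁₁ = A + !![s₁, s₂; s₂, s₃] * blockC γ₂ := by
      rw [Submonoid.coe_mul, ← fromBlocks_toBlocks γ₂.1, transl, fromBlocks_multiply]
      simp [hA, blockC]
    have h21 : blockC (transl s₁ s₂ s₃ * γ₂) = blockC γ₂ := by
      rw [blockC_mul]
      simp [transl, blockC, blockD]
    rw [hγ', blockC_mul, blockC_inv, blockD_inv, h11, h21, hC]
    ext i j
    fin_cases i <;> fin_cases j <;>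
      simp [cuspRep, blockC, cuspM, Matrix.mul_apply, Fin.sum_univ_two, Matrix.vecMul,
        dotProduct, M₁, M₂] <;> ring
  have hmem : γ' ∈ Gamma0 N := by
    have cast_dvd : ∀ {q n : ℕ} {y : ℤ}, q ∣ n → (n : ℤ) ∣ y → (q : ℤ) ∣ y :=
      fun hd h => (Int.natCast_dvd_natCast.2 hd).trans h
    have h00 : ∀ q : ℕ, q ∣ N₁ * N₂ → (q : ℤ) ∣ x - M₁ * (A 0 0 + s₁ * x) := by
      intro q hd
      have := dvd_sub ((cast_dvd hd m11).mul_right (-(A 0 0 + s₁ * x))) (cast_dvd hd hs₁)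
      obtain ⟨w, hw⟩ := this
      exact ⟨w, by linear_combination hw⟩
    intro i j
    rw [hblock]
    fin_cases i <;> fin_cases j <;>
      refine dvd_of_prod_primewise hN hsq (fun q hq hd => ?_) (fun q hq hd => ?_)
        (fun q hq hd => ?_) <;>
      simp only [Fin.zero_eta, Fin.mk_one, Fin.isValue, Matrix.of_apply, Matrix.cons_val',
        Matrix.cons_val_zero, Matrix.cons_val_one, Matrix.cons_val_fin_one]
    · exact dvd_sub (hx0 q hq hd) ((cast_dvd hd m10).mul_right _)
    · exact h00 q (hd.mul_right _)
    · exact h00 q (hd.mul_left _)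
    · exact (dvd_neg.2 (cast_dvd hd m10)).mul_right _
    · refine Dvd.dvd.mul_left (dvd_add ?_ ((hz1 q hq hd).mul_left _)) _
      have : (q : ℤ) ∣ x * A 0 1 := by rw [hsym']; exact (hz1 q hq hd).mul_right _
      exact ((Nat.prime_iff_prime_int.1 hq).dvd_or_dvd this).resolve_left
        (hx12 q hq (hd.mul_right _))
    · refine Dvd.dvd.mul_left ?_ _
      have : (q : ℤ) ∣ x * (A 0 1 + s₂ * z) := by
        have h := (cast_dvd hd hs₂).mul_left z
        obtain ⟨w, hw⟩ := h
        exact ⟨w, by linear_combination hw + hsym'⟩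
      exact ((Nat.prime_iff_prime_int.1 hq).dvd_or_dvd this).resolve_left
        (hx12 q hq (hd.mul_left _))
    · exact (dvd_neg.2 (cast_dvd (hd.mul_right _) m20)).mul_right _
    · exact (dvd_neg.2 (cast_dvd (hd.mul_left _) m20)).mul_right _
    · refine Dvd.dvd.mul_left ?_ _
      have h := cast_dvd hd hs₂
      obtain ⟨w, hw⟩ := h
      exact ⟨w, by linear_combination hw⟩
    · exact dvd_sub ((hx0 q hq hd).trans hxz) ((cast_dvd (hd.mul_right _) m20).mul_right _)
    · exact dvd_sub (hz1 q hq hd) ((cast_dvd (hd.mul_left _) m20).mul_right _)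
    · have := dvd_sub ((cast_dvd hd m21).mul_right (-(A 1 1 + s₃ * z))) (cast_dvd hd hs₃)
      obtain ⟨w, hw⟩ := this
      exact ⟨w, by linear_combination hw⟩
  refine ⟨γ' * β⁻¹, (Gamma0 N).mul_mem hmem ((Gamma0 N).inv_mem hβN), ?_⟩
  have e1 : SiegelEisenstein.act (γ' * β⁻¹) (pl (cuspRep N₀ N₁ N₂)) = pl γ₁ := by
    rw [← pl_mul, hγ', ← mul_assoc, mul_inv_cancel_left, pl_mul, pl_mul, pl_transl]
    change SiegelEisenstein.act β⁻¹ (pl γ₂) = _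
    rw [hpl, act_inv_act]
  rw [e1]
  rcases hγ₁ with h' | h'
  · left; rw [h']
  · right; rw [h', Plucker.neg_neg]

end

/-! ### Local components of the character -/

theorem part_apply {N d : ℕ} (hN : Squarefree N) (hd : d ∣ N) (χ : DirichletCharacter ℂ N)
    {x y : ℤ} (h1 : (d : ℤ) ∣ y - x) (h2 : ((N / d : ℕ) : ℤ) ∣ y - 1) :
    part χ d (x : ZMod d) = χ (y : ZMod N) := by
  have hmul : d * (N / d) = N := Nat.mul_div_cancel' hd
  have hcop : d.Coprime (N / d) := Nat.coprime_of_squarefree_mul (hmul.symm ▸ hN)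
  have e1 : (x : ZMod d) = y := (ZMod.intCast_eq_intCast_iff_dvd_sub _ _ d).2 h1
  have e2 : ((1 : ℤ) : ZMod (N / d)) = y := (ZMod.intCast_eq_intCast_iff_dvd_sub _ _ _).2 h2
  rw [e1]
  by_cases hu : IsUnit (y : ZMod d)
  · obtain ⟨u, hu⟩ := hu
    rw [part, dif_pos ⟨hmul, hcop⟩, ← hu, MulChar.ofUnitHom_coe]
    simp only [MonoidHom.comp_apply]
    rw [MulChar.coe_toUnitHom]
    congr 1
    simp only [Units.coe_map]
    have : ((MulEquiv.prodUnits.symm.toMonoidHom ((MonoidHom.inl (ZMod d)ˣ (ZMod (N / d))ˣ) u) :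
        (ZMod d × ZMod (N / d))ˣ) : ZMod d × ZMod (N / d)) = ((y : ℤ) : ZMod d × ZMod (N / d)) := by
      ext
      · simp [MulEquiv.prodUnits, hu]
      · simp [MulEquiv.prodUnits, ← e2]
    rw [this]
    simp
  · rw [MulChar.map_nonunit _ hu, MulChar.map_nonunit]
    intro hy
    apply hu
    have := hy.map (ZMod.castHom hd (ZMod d))
    simpa using this

theorem part_self {N : ℕ} (hN : Squarefree N) (χ : DirichletCharacter ℂ N) (x : ℤ) :
    part χ N (x : ZMod N) = χ (x : ZMod N) :=
  part_apply hN dvd_rfl χ (by simp) (by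
    rw [Nat.div_self (Nat.pos_of_ne_zero hN.ne_zero)]; simp)

theorem exists_congr_congr_one {a b : ℕ} (h : a.Coprime b) (x : ℤ) :
    ∃ y : ℤ, (a : ℤ) ∣ y - x ∧ (b : ℤ) ∣ y - 1 := by
  obtain ⟨u, v, huv⟩ := Nat.isCoprime_iff_coprime.2 h
  exact ⟨x * (v * b) + u * a, ⟨u * (1 - x), by linear_combination x * huv⟩,
    ⟨(x - 1) * v, by linear_combination huv⟩⟩

theorem coprime_div {N q : ℕ} (hN : Squarefree N) (hq : q ∣ N) : q.Coprime (N / q) :=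
  Nat.coprime_of_squarefree_mul ((Nat.mul_div_cancel' hq).symm ▸ hN)

theorem dvd_div_of_ne {N q r : ℕ} (hq : q.Prime) (hr : r.Prime) (hqN : q ∣ N) (hrN : r ∣ N)
    (h : q ≠ r) : q ∣ N / r := by
  have : q ∣ r * (N / r) := by rwa [Nat.mul_div_cancel' hrN]
  exact (hq.dvd_mul.1 this).resolve_left fun h' => h ((Nat.prime_dvd_prime_iff_eq hq hr).1 h')

/-- Lift x for each q ∣ d to an integer that is ≡ x modulo q and ≡ 1 modulo N/q. The product of
these lifts is a lift that computes χ_d(x), and χ is multiplicative. -/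
theorem part_eq_prod {N d : ℕ} (hN : Squarefree N) (hd : d ∣ N) (χ : DirichletCharacter ℂ N)
    (x : ℤ) : part χ d (x : ZMod d) = ∏ q ∈ d.primeFactors, part χ q (x : ZMod q) := by
  have hd0 : d ≠ 0 := ne_zero_of_dvd_ne_zero hN.ne_zero hd
  have hpr : ∀ q ∈ d.primeFactors, q.Prime ∧ q ∣ d ∧ q ∣ N := fun q hq =>
    ⟨Nat.prime_of_mem_primeFactors hq, Nat.dvd_of_mem_primeFactors hq,
      (Nat.dvd_of_mem_primeFactors hq).trans hd⟩
  have hex : ∀ q : ℕ, ∃ y : ℤ, q ∣ N → (q : ℤ) ∣ y - x ∧ ((N / q : ℕ) : ℤ) ∣ y - 1 := by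
    intro q
    by_cases hq : q ∣ N
    · obtain ⟨y, hy⟩ := exists_congr_congr_one (coprime_div hN hq) x
      exact ⟨y, fun _ => hy⟩
    · exact ⟨0, fun h => absurd h hq⟩
  choose y hy using hex
  have hY : ∀ q : ℕ, q.Prime → q ∣ N → ∀ r ∈ d.primeFactors, q ≠ r → (y r : ZMod q) = 1 := by
    intro q hq hqN r hr hne
    have := (Int.natCast_dvd_natCast.2 (dvd_div_of_ne hq (hpr r hr).1 hqN (hpr r hr).2.2 hne)).trans
      (hy r (hpr r hr).2.2).2
    rw [← ZMod.intCast_eq_intCast_iff_dvd_sub] at this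
    simpa using this.symm
  rw [part_apply hN hd χ (y := ∏ q ∈ d.primeFactors, y q)]
  · rw [Int.cast_prod, map_prod]
    refine Finset.prod_congr rfl fun q hq => ?_
    obtain ⟨-, -, h3⟩ := hpr q hq
    exact (part_apply hN h3 χ (hy q h3).1 (hy q h3).2).symm
  · refine dvd_of_squarefree (hN.squarefree_of_dvd hd) fun q hq hqd => ?_
    have hmem : q ∈ d.primeFactors := Nat.mem_primeFactors.2 ⟨hq, hqd, hd0⟩
    rw [← ZMod.intCast_eq_intCast_iff_dvd_sub, Int.cast_prod, Finset.prod_eq_single q]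
    · exact (ZMod.intCast_eq_intCast_iff_dvd_sub _ _ _).2 (hy q (hqd.trans hd)).1
    · intro r hr hne
      exact hY q hq (hqd.trans hd) r hr hne.symm
    · exact fun h => absurd hmem h
  · refine dvd_of_squarefree (hN.squarefree_of_dvd (Nat.div_dvd_of_dvd hd)) fun q hq hqd => ?_
    rw [← ZMod.intCast_eq_intCast_iff_dvd_sub, Int.cast_prod, Finset.prod_eq_one]
    · simp
    · intro r hr
      refine hY q hq (hqd.trans (Nat.div_dvd_of_dvd hd)) r hr fun h => ?_
      subst h
      exact Nat.not_coprime_of_dvd_of_dvd hq.one_lt (hpr q hr).2.1 hqd (coprime_div hN hd)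

/-- Through this, relations such as χ_d = 1 or χ_d² = 1 pass to the components at the primes
dividing d. -/
theorem exists_part_eq {N d q : ℕ} (hN : Squarefree N) (hd : d ∣ N) (hq : q.Prime) (hqd : q ∣ d)
    (χ : DirichletCharacter ℂ N) (u : (ZMod q)ˣ) :
    ∃ x : (ZMod d)ˣ, part χ d x = part χ q u := by
  have hd0 : d ≠ 0 := ne_zero_of_dvd_ne_zero hN.ne_zero hd
  have : NeZero q := ⟨hq.ne_zero⟩
  obtain ⟨y, hy1, hy2⟩ := exists_congr_congr_one (coprime_div hN (hqd.trans hd))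
    (((u : ZMod q).val : ℕ) : ℤ)
  have e1 : (y : ZMod q) = u := by
    rw [← ZMod.intCast_eq_intCast_iff_dvd_sub] at hy1
    rw [← hy1]
    simp
  have hprod : part χ d (y : ZMod d) = part χ q u := by
    rw [part_eq_prod hN hd χ, Finset.prod_eq_single q, e1]
    · intro r hr hne
      have hr' := Nat.prime_of_mem_primeFactors hr
      have hrd := Nat.dvd_of_mem_primeFactors hr
      have := (Int.natCast_dvd_natCast.2 (dvd_div_of_ne hr' hq (hrd.trans hd) (hqd.trans hd)
        hne)).trans hy2
      rw [← ZMod.intCast_eq_intCast_iff_dvd_sub] at this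
      rw [← this]
      simp
    · exact fun h => absurd (Nat.mem_primeFactors.2 ⟨hq, hqd, hd0⟩) h
  have hunit : IsUnit (y : ZMod d) := by
    by_contra h
    rw [MulChar.map_nonunit _ h] at hprod
    exact (Units.isUnit u |>.map (part χ q)).ne_zero hprod.symm
  exact ⟨hunit.unit, hprod⟩

theorem part_prime_eq_one {N d q : ℕ} (hN : Squarefree N) (hd : d ∣ N) (hq : q.Prime) (hqd : q ∣ d)
    {χ : DirichletCharacter ℂ N} (h : part χ d = 1) : part χ q = 1 := by
  ext u
  obtain ⟨x, hx⟩ := exists_part_eq hN hd hq hqd χ u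
  rw [← hx, h, MulChar.one_apply_coe, MulChar.one_apply_coe]

theorem part_prime_sq_eq_one {N d q : ℕ} (hN : Squarefree N) (hd : d ∣ N) (hq : q.Prime)
    (hqd : q ∣ d) {χ : DirichletCharacter ℂ N} (h : part χ d ^ 2 = 1) : part χ q ^ 2 = 1 := by
  ext u
  obtain ⟨x, hx⟩ := exists_part_eq hN hd hq hqd χ u
  have h2 := congrArg (fun ψ : DirichletCharacter ℂ d => ψ x) h
  simp only [MulChar.pow_apply_coe, MulChar.one_apply_coe] at h2 ⊢
  rw [← hx, h2]

/-! ### Weight functions, and Eisenstein series as sums over `V` -/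

/-- The local factor at `q` of the weight function of an Eisenstein series. The type `t` is the
rank modulo `q` of the lower left block. -/
def weight {N : ℕ} (χ : DirichletCharacter ℂ N) (q : ℕ) (t : Fin 3) (p : Plucker ℤ) : ℂ :=
  open scoped Classical in
  match t with
  | 0 => if RankZero q p then (starRingEnd ℂ) (part χ q (p.e : ZMod q)) else 0
  | 1 => if (q : ℤ) ∣ p.a ∧ ¬ RankZero q p then 1 else 0
  | 2 => part χ q (p.a : ZMod q)

/-- The weight function of the Eisenstein series of type `t`. -/
def totalWeight {N : ℕ} (χ : DirichletCharacter ℂ N) (t : ℕ → Fin 3) (p : Plucker ℤ) : ℂ :=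
  ∏ q ∈ N.primeFactors, weight χ q (t q) p

/-- The characters that may occur for the type `t`. -/
def GoodType {N : ℕ} (χ : DirichletCharacter ℂ N) (t : ℕ → Fin 3) : Prop :=
  ∀ q ∈ N.primeFactors, (t q = 1 → part χ q = 1) ∧ (t q = 2 → part χ q ^ 2 = 1)

theorem norm_weight_le {N : ℕ} (χ : DirichletCharacter ℂ N) (q : ℕ) (t : Fin 3) (p : Plucker ℤ) :
    ‖weight χ q t p‖ ≤ 1 := by
  classical
  fin_cases t <;> simp only [weight]
  · split_ifs
    · rw [RCLike.norm_conj]; exact DirichletCharacter.norm_le_one _ _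
    · simp
  · split_ifs <;> simp
  · exact DirichletCharacter.norm_le_one _ _

theorem norm_totalWeight_le {N : ℕ} (χ : DirichletCharacter ℂ N) (t : ℕ → Fin 3)
    (p : Plucker ℤ) : ‖totalWeight χ t p‖ ≤ 1 := by
  rw [totalWeight, norm_prod]
  exact Finset.prod_le_one (fun _ _ => norm_nonneg _) fun q _ => norm_weight_le χ q (t q) p

theorem conj_eq_of_mul_eq_one {q : ℕ} (ψ : DirichletCharacter ℂ q) {x y : ZMod q}
    (h : x * y = 1) : ψ x = (starRingEnd ℂ) (ψ y) := by
  have h1 : ψ x * ψ y = 1 := by rw [← map_mul, h, map_one]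
  have hy : IsUnit y := IsUnit.of_mul_eq_one x (by rwa [mul_comm])
  obtain ⟨u, rfl⟩ := hy
  rw [← Complex.inv_eq_conj (DirichletCharacter.unit_norm_eq_one ψ u)]
  exact eq_inv_of_mul_eq_one_left h1

/-- In type 0 the coordinate e is multiplied by det D and enters through the conjugate of χ_q; in
type 2 the coordinate a is multiplied by det A ≡ (det D)⁻¹ and enters through χ_q itself. In type 1
the factor is an indicator, which transforms correctly because χ_q = 1. -/
theorem weight_act {N q : ℕ} (χ : DirichletCharacter ℂ N) {t : Fin 3} (ht : t = 1 → part χ q = 1)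
    {γ : Sp2Z} (h : ∀ i j, (q : ℤ) ∣ blockC γ i j) (p : Plucker ℤ) :
    weight χ q t (act γ p) =
      (starRingEnd ℂ) (part χ q ((blockD γ).det : ZMod q)) * weight χ q t p := by
  classical
  have hdet := det_mul_det_cast h
  fin_cases t <;> simp only [weight]
  · rw [rankZero_act_iff h]
    split_ifs with hr
    · rw [(act_of_rankZero h hr).2, map_mul, map_mul, mul_comm]
    · simp
  · have h1 := ht rfl
    simp only [rankZero_act_iff h, dvd_act_a_iff h]
    rw [h1, MulChar.one_apply
      (IsUnit.of_mul_eq_one _ (by rwa [mul_comm] at hdet))]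
    simp
  · rw [act_a_cast h, map_mul, conj_eq_of_mul_eq_one _ hdet, mul_comm]

theorem totalWeight_act {N : ℕ} (hN : Squarefree N) {χ : DirichletCharacter ℂ N} {t : ℕ → Fin 3}
    (ht : GoodType χ t) {γ : Sp2Z} (h : γ ∈ Gamma0 N) (p : Plucker ℤ) :
    totalWeight χ t (act γ p) =
      (starRingEnd ℂ) (χ ((blockD γ).det : ZMod N)) * totalWeight χ t p := by
  rw [← part_self hN, part_eq_prod hN dvd_rfl, map_prod, totalWeight, totalWeight,
    ← Finset.prod_mul_distrib]
  exact Finset.prod_congr rfl fun q hq =>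
    weight_act χ (ht q hq).1 (Gamma0_mono (Nat.dvd_of_mem_primeFactors hq) h) p

theorem weight_neg {N q : ℕ} (χ : DirichletCharacter ℂ N) {t : Fin 3} (ht : t = 1 → part χ q = 1)
    (p : Plucker ℤ) : weight χ q t (-p) = part χ q (-1 : ℤ) * weight χ q t p := by
  classical
  have hm1 : part χ q ((-1 : ℤ) : ZMod q) = (starRingEnd ℂ) (part χ q ((-1 : ℤ) : ZMod q)) :=
    conj_eq_of_mul_eq_one _ (by simp)
  fin_cases t <;> simp only [weight, rankZero_neg, neg_a, neg_e, dvd_neg]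
  · split_ifs with hr
    · rw [hm1, ← map_mul, ← map_mul]; simp
    · simp
  · rw [ht rfl, MulChar.one_apply (by simp)]
    simp
  · rw [← map_mul]; simp

theorem totalWeight_neg {N : ℕ} (hN : Squarefree N) {χ : DirichletCharacter ℂ N} {t : ℕ → Fin 3}
    (ht : GoodType χ t) (p : Plucker ℤ) :
    totalWeight χ t (-p) = χ (-1) * totalWeight χ t p := by
  have : χ (-1) = χ ((-1 : ℤ) : ZMod N) := by simp
  rw [this, ← part_self hN, part_eq_prod hN dvd_rfl, totalWeight, totalWeight,
    ← Finset.prod_mul_distrib]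
  exact Finset.prod_congr rfl fun q hq => weight_neg χ (ht q hq).1 p

theorem ne_neg_of_mem_V {p : Plucker ℤ} (hp : p ∈ V) : p ≠ -p := by
  intro h
  rw [Plucker.ext_iff] at h
  simp only [neg_a, neg_b, neg_m, neg_n, neg_e] at h
  obtain ⟨h1, h2, h3, h4, h5⟩ := h
  have := hp.2 0 (by simp; omega) (by simp; omega) (by simp; omega) (by simp; omega)
    (by simp; omega)
  simp at this

theorem mem_cuspStab {N : ℕ} {γ₀ : Sp2Z} {x : Gamma0 N} :
    x ∈ cuspStab N γ₀ ↔ γ₀ * x.1 * γ₀⁻¹ ∈ GammaInf := by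
  simp [cuspStab, Subgroup.mem_subgroupOf, MulAut.conj_apply]

theorem pl_mul_of_mem_GammaInf {α : Sp2Z} (h : α ∈ GammaInf) (γ : Sp2Z) :
    pl (α * γ) = pl γ ∨ pl (α * γ) = -pl γ := by
  rw [pl_mul]
  rcases (mem_GammaInf_iff α).1 h with h | h <;> rw [h]
  · left; rfl
  · right; rw [act_neg]; rfl

theorem mem_GammaInf_of_pl_eq {γ γ' : Sp2Z} (h : pl γ' = pl γ ∨ pl γ' = -pl γ) :
    γ' * γ⁻¹ ∈ GammaInf := by
  rw [mem_GammaInf_iff, pl_mul]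
  rcases h with h | h <;> rw [h]
  · left; rw [pl, act_inv_act]
  · right; rw [act_neg, pl, act_inv_act]

/-- A coset together with a sign gives the point ± `pl (γ₀ * γ)`, and these points are distinct and
exhaust the support of Φ. The terms at p and -p agree, since Φ and the k-th power of the linear form
both change by (-1)^k; the factor 1/2 in `eis` compensates for this. -/
theorem eisenstein_eq_eis {N k : ℕ} (hk : 4 ≤ k) (χ : DirichletCharacter ℂ N) (γ₀ : Sp2Z)
    (Φ : Plucker ℤ → ℂ) (hΦ : ∀ p, ‖Φ p‖ ≤ 1)
    (h1 : ∀ γ ∈ Gamma0 N, Φ (act γ (pl γ₀)) = (starRingEnd ℂ) (χ ((blockD γ).det : ZMod N)))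
    (h2 : ∀ p, Φ (-p) = (-1) ^ k * Φ p)
    (h3 : ∀ p ∈ V, Φ p ≠ 0 → ∃ γ ∈ Gamma0 N, p = act γ (pl γ₀) ∨ p = -act γ (pl γ₀)) :
    eisenstein k χ γ₀ = eis k Φ := by
  funext τ
  let Q := Quotient (QuotientGroup.rightRel (cuspStab N γ₀))
  let r : Q → Sp2Z := fun c => (c.out : Gamma0 N).1
  let F : Q × Bool → V := fun c => if c.2 then ⟨pl (γ₀ * r c.1), pl_mem _⟩
    else ⟨-pl (γ₀ * r c.1), neg_mem_V (pl_mem _)⟩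
  have hF : ∀ c, (F c).1 = pl (γ₀ * r c.1) ∨ (F c).1 = -pl (γ₀ * r c.1) := by
    rintro ⟨c, s⟩
    cases s <;> simp [F]
  have hcoset : ∀ γ γ' : Gamma0 N, (pl (γ₀ * γ'.1) = pl (γ₀ * γ.1) ∨
      pl (γ₀ * γ'.1) = -pl (γ₀ * γ.1)) → γ' * γ⁻¹ ∈ cuspStab N γ₀ := by
    intro γ γ' h
    rw [mem_cuspStab]
    have := mem_GammaInf_of_pl_eq h
    convert this using 1
    simp [mul_assoc]
  have hinj : Function.Injective F := by
    rintro ⟨c, s⟩ ⟨c', s'⟩ h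
    have hc : c = c' := by
      have e : (F (c, s)).1 = (F (c', s')).1 := by rw [h]
      have : pl (γ₀ * r c') = pl (γ₀ * r c) ∨ pl (γ₀ * r c') = -pl (γ₀ * r c) := by
        rcases hF (c, s) with e1 | e1 <;> rcases hF (c', s') with e2 | e2 <;>
          rw [e1, e2] at e
        · left; exact e.symm
        · right; rw [e, Plucker.neg_neg]
        · right; exact e.symm
        · left
          have := congrArg (fun p => -p) e
          simpa only [Plucker.neg_neg] using this.symm
      rw [← Quotient.out_eq c, ← Quotient.out_eq c']
      exact Quotient.sound (QuotientGroup.rightRel_apply.2 (hcoset _ _ this))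
    subst hc
    congr 1
    by_contra hs
    have e : (F (c, s)).1 = (F (c, s')).1 := by rw [h]
    cases s <;> cases s' <;> simp [F] at e hs
    · exact ne_neg_of_mem_V (pl_mem _) e.symm
    · exact ne_neg_of_mem_V (pl_mem _) e
  have hr : ∀ γ : Gamma0 N, pl (γ₀ * r (Quotient.mk _ γ)) = pl (γ₀ * γ.1) ∨
      pl (γ₀ * r (Quotient.mk _ γ)) = -pl (γ₀ * γ.1) := by
    intro γ
    have h := Quotient.exact
      (Quotient.out_eq (Quotient.mk (QuotientGroup.rightRel (cuspStab N γ₀)) γ))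
    have h' := QuotientGroup.rightRel_apply.1
      ((QuotientGroup.rightRel (cuspStab N γ₀)).symm h)
    rw [mem_cuspStab] at h'
    have := pl_mul_of_mem_GammaInf h' (γ₀ * γ.1)
    simpa [mul_assoc, r] using this
  set f : V → ℂ := fun p => Φ p.1 * (lin τ p.1.toR ^ k)⁻¹ with hf
  have hsum : Summable f := summable_lin τ hk hΦ
  have hsupp : Function.support f ⊆ Set.range F := by
    intro p hp
    have hΦp : Φ p.1 ≠ 0 := fun h0 => hp (by simp [hf, h0])
    obtain ⟨γ, hγ, hpγ⟩ := h3 p.1 p.2 hΦp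
    rw [← pl_mul] at hpγ
    have hpr : p.1 = pl (γ₀ * r (Quotient.mk _ ⟨γ, hγ⟩)) ∨
        p.1 = -pl (γ₀ * r (Quotient.mk _ ⟨γ, hγ⟩)) := by
      rcases hr ⟨γ, hγ⟩ with e | e <;> rw [e]
      · exact hpγ
      · rw [Plucker.neg_neg]; exact hpγ.symm
    rcases hpr with e | e
    · exact ⟨(Quotient.mk _ ⟨γ, hγ⟩, true), Subtype.ext (by simp [F, e])⟩
    · exact ⟨(Quotient.mk _ ⟨γ, hγ⟩, false), Subtype.ext (by simp [F, e])⟩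
  have hval : ∀ c : Q, f (F (c, true)) = f (F (c, false)) ∧ f (F (c, true)) =
      (starRingEnd ℂ) (χ ((blockD (r c)).det : ZMod N)) *
        ((denom (toReal (γ₀ * r c)) τ).det ^ k)⁻¹ := by
    intro c
    have e : f (F (c, true)) = Φ (pl (γ₀ * r c)) * (lin τ (pl (γ₀ * r c)).toR ^ k)⁻¹ := by
      simp [f, F]
    refine ⟨?_, ?_⟩
    · rw [e]
      simp only [f, F, Bool.false_eq_true, if_false]
      rw [h2, toR_neg, lin_neg, neg_pow (lin τ _), mul_inv]
      have : ((-1 : ℂ) ^ k) * ((-1) ^ k)⁻¹ = 1 := mul_inv_cancel₀ (by simp)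
      linear_combination (-Φ (pl (γ₀ * r c)) * (lin τ (pl (γ₀ * r c)).toR ^ k)⁻¹) * this
    · rw [e, det_denom_toReal, pl_mul, h1 _ (c.out : Gamma0 N).2]
  rw [eis]
  change _ = 2⁻¹ * ∑' p, f p
  have hs' : Summable fun c => f (F c) := hsum.comp_injective hinj
  rw [← hinj.tsum_eq hsupp, hs'.tsum_prod, ← tsum_mul_left]
  refine tsum_congr fun c => ?_
  rw [tsum_fintype, Fintype.sum_bool]
  rw [← (hval c).1, (hval c).2]
  ring

/-- The type function of the cusp `(N₀, N₁, N₂)`. -/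
def cuspType (N₀ N₁ : ℕ) (q : ℕ) : Fin 3 := if q ∣ N₀ then 0 else if q ∣ N₁ then 1 else 2

theorem pl_cuspRep (N₀ N₁ N₂ : ℕ) : pl (cuspRep N₀ N₁ N₂) =
    ⟨zeroOne N₀ (N₁ * N₂) * zeroOne (N₀ * N₁) N₂, 0, zeroOne N₀ (N₁ * N₂),
      zeroOne (N₀ * N₁) N₂, 1⟩ := by
  rw [pl_eq]
  have hC : blockC (cuspRep N₀ N₁ N₂) = cuspM N₀ N₁ N₂ := by simp [blockC, cuspRep]
  have hD : blockD (cuspRep N₀ N₁ N₂) = 1 := by simp [blockD, cuspRep]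
  rw [hC, hD, cuspM]
  simp

theorem not_dvd_of_squarefree_mul {a b q : ℕ} (hq : q.Prime) (h : Squarefree (a * b)) (hb : q ∣ b) :
    ¬ q ∣ a := fun ha =>
  Nat.not_coprime_of_dvd_of_dvd hq.one_lt ha hb (Nat.coprime_of_squarefree_mul h)

theorem cuspType_eq {N N₀ N₁ N₂ : ℕ} (hN : N₀ * N₁ * N₂ = N) (hsq : Squarefree N) {q : ℕ}
    (hq : q.Prime) : (q ∣ N₀ → cuspType N₀ N₁ q = 0) ∧ (q ∣ N₁ → cuspType N₀ N₁ q = 1) ∧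
      (q ∣ N₂ → cuspType N₀ N₁ q = 2) := by
  rw [← hN] at hsq
  refine ⟨fun h => by simp [cuspType, h], fun h => ?_, fun h => ?_⟩
  · have := not_dvd_of_squarefree_mul hq (hsq.squarefree_of_dvd (dvd_mul_right _ _)) h
    simp [cuspType, h, this]
  · have h01 := not_dvd_of_squarefree_mul hq hsq h
    have h0 : ¬ q ∣ N₀ := fun h' => h01 (h'.mul_right _)
    have h1 : ¬ q ∣ N₁ := fun h' => h01 (h'.mul_left _)
    simp [cuspType, h0, h1]

theorem weight_ne_zero_iff {N q : ℕ} (hq : q.Prime) (χ : DirichletCharacter ℂ N) {p : Plucker ℤ}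
    (hp : p ∈ V) : (weight χ q 0 p ≠ 0 ↔ RankZero q p) ∧
      (weight χ q 1 p ≠ 0 ↔ (q : ℤ) ∣ p.a ∧ ¬ RankZero q p) ∧
      (weight χ q 2 p ≠ 0 ↔ ¬ (q : ℤ) ∣ p.a) := by
  classical
  have : Fact q.Prime := ⟨hq⟩
  have hunit : ∀ x : ℤ, part χ q (x : ZMod q) ≠ 0 ↔ ¬ (q : ℤ) ∣ x := by
    intro x
    rw [← ZMod.intCast_zmod_eq_zero_iff_dvd]
    constructor
    · intro h h0
      rw [h0, MulChar.map_zero] at h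
      exact h rfl
    · intro h
      exact ((isUnit_iff_ne_zero.2 h).map (part χ q)).ne_zero
  refine ⟨?_, ?_, ?_⟩
  · simp only [weight]
    split_ifs with h
    · refine iff_of_true ?_ h
      rw [Ne, map_eq_zero, ← Ne, hunit]
      intro he
      exact (Nat.prime_iff_prime_int.1 hq).not_isUnit (hp.2 q h.1 h.2.1 h.2.2.1 h.2.2.2 he)
    · simpa using h
  · simp only [weight]
    split_ifs with h <;> simpa using h
  · exact hunit _

/-- Together with `HasType.exists_act`, this makes the support of the weight function on `V` a
single orbit up to sign. -/
theorem totalWeight_ne_zero_iff {N N₀ N₁ N₂ : ℕ} (hN : N₀ * N₁ * N₂ = N) (hsq : Squarefree N)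
    (χ : DirichletCharacter ℂ N) {p : Plucker ℤ} (hp : p ∈ V) :
    totalWeight χ (cuspType N₀ N₁) p ≠ 0 ↔ HasType N₀ N₁ N₂ p := by
  have hN0 := hsq.ne_zero
  have key : totalWeight χ (cuspType N₀ N₁) p ≠ 0 ↔
      ∀ q : ℕ, q.Prime → q ∣ N → weight χ q (cuspType N₀ N₁ q) p ≠ 0 := by
    rw [totalWeight, Finset.prod_ne_zero_iff]
    simp [Nat.mem_primeFactors, hN0]
  rw [key]
  constructor
  · intro h
    refine ⟨fun q hq hd => ?_, fun q hq hd => ?_, fun q hq hd => ?_⟩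
    · have := h q hq (hN ▸ (hd.mul_right _).mul_right _)
      rw [(cuspType_eq hN hsq hq).1 hd] at this
      exact (weight_ne_zero_iff hq χ hp).1.1 this
    · have := h q hq (hN ▸ (hd.mul_left _).mul_right _)
      rw [(cuspType_eq hN hsq hq).2.1 hd] at this
      exact (weight_ne_zero_iff hq χ hp).2.1.1 this
    · have := h q hq (hN ▸ hd.mul_left _)
      rw [(cuspType_eq hN hsq hq).2.2 hd] at this
      exact (weight_ne_zero_iff hq χ hp).2.2.1 this
  · rintro ⟨h0, h1, h2⟩ q hq hd
    rw [← hN, hq.dvd_mul, hq.dvd_mul] at hd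
    rcases hd with (hd | hd) | hd
    · rw [(cuspType_eq hN hsq hq).1 hd]
      exact (weight_ne_zero_iff hq χ hp).1.2 (h0 q hq hd)
    · rw [(cuspType_eq hN hsq hq).2.1 hd]
      exact (weight_ne_zero_iff hq χ hp).2.1.2 (h1 q hq hd)
    · rw [(cuspType_eq hN hsq hq).2.2 hd]
      exact (weight_ne_zero_iff hq χ hp).2.2.2 (h2 q hq hd)

theorem hasType_cuspRep {N N₀ N₁ N₂ : ℕ} (hN : N₀ * N₁ * N₂ = N) (hsq : Squarefree N) :
    HasType N₀ N₁ N₂ (pl (cuspRep N₀ N₁ N₂)) := by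
  obtain ⟨m10, m11, m20, m21⟩ := cuspM_congr hN hsq
  have cast_dvd : ∀ {q n : ℕ} {y : ℤ}, q ∣ n → (n : ℤ) ∣ y → (q : ℤ) ∣ y :=
    fun hd h => (Int.natCast_dvd_natCast.2 hd).trans h
  have not_dvd : ∀ {q n : ℕ} {y : ℤ}, q.Prime → q ∣ n → (n : ℤ) ∣ y - 1 → ¬ (q : ℤ) ∣ y := by
    intro q n y hq hd h hy
    have := dvd_sub hy (cast_dvd hd h)
    rw [sub_sub_cancel] at this
    exact (Nat.prime_iff_prime_int.1 hq).not_isUnit (isUnit_of_dvd_one this)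
  rw [pl_cuspRep]
  refine ⟨fun q hq hd => ?_, fun q hq hd => ?_, fun q hq hd => ?_⟩
  · exact ⟨(cast_dvd hd m10).mul_right _, dvd_zero _, cast_dvd hd m10,
      cast_dvd (hd.mul_right _) m20⟩
  · exact ⟨(cast_dvd (hd.mul_left _) m20).mul_left _,
      fun h => not_dvd hq (hd.mul_right _) m11 h.2.2.1⟩
  · intro h
    rcases (Nat.prime_iff_prime_int.1 hq).dvd_or_dvd h with h | h
    · exact not_dvd hq (hd.mul_left _) m11 h
    · exact not_dvd hq hd m21 h

/-- This fixes the normalisation: on a single orbit up to sign, the transformation laws determine a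
weight function from one value. -/
theorem totalWeight_cuspRep {N N₀ N₁ N₂ : ℕ} (hN : N₀ * N₁ * N₂ = N) (hsq : Squarefree N)
    (χ : DirichletCharacter ℂ N) :
    totalWeight χ (cuspType N₀ N₁) (pl (cuspRep N₀ N₁ N₂)) = 1 := by
  classical
  obtain ⟨m10, m11, m20, m21⟩ := cuspM_congr hN hsq
  obtain ⟨h0, h1, h2⟩ := hasType_cuspRep hN hsq
  refine Finset.prod_eq_one fun q hq => ?_
  have hqp := Nat.prime_of_mem_primeFactors hq
  have hd := Nat.dvd_of_mem_primeFactors hq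
  rw [← hN, hqp.dvd_mul, hqp.dvd_mul] at hd
  rcases hd with (hd | hd) | hd
  · rw [(cuspType_eq hN hsq hqp).1 hd]
    simp only [weight, if_pos (h0 q hqp hd)]
    rw [pl_cuspRep]
    simp
  · rw [(cuspType_eq hN hsq hqp).2.1 hd]
    simp only [weight, if_pos (h1 q hqp hd)]
  · rw [(cuspType_eq hN hsq hqp).2.2 hd]
    simp only [weight]
    rw [pl_cuspRep]
    have e1 := (Int.natCast_dvd_natCast.2 (hd.mul_left N₁)).trans m11
    have e2 := (Int.natCast_dvd_natCast.2 hd).trans m21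
    rw [← ZMod.intCast_eq_intCast_iff_dvd_sub] at e1 e2
    push_cast
    rw [← e1, ← e2]
    simp

theorem goodType_cuspType {N N₀ N₁ N₂ : ℕ} (hN : N₀ * N₁ * N₂ = N) (hsq : Squarefree N)
    {χ : DirichletCharacter ℂ N} (h1 : part χ N₁ = 1) (h2 : part χ N₂ ^ 2 = 1) :
    GoodType χ (cuspType N₀ N₁) := by
  intro q hq
  have hqp := Nat.prime_of_mem_primeFactors hq
  have hd := Nat.dvd_of_mem_primeFactors hq
  have hN1 : N₁ ∣ N := ⟨N₀ * N₂, by rw [← hN]; ring⟩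
  have hN2 : N₂ ∣ N := ⟨N₀ * N₁, by rw [← hN]; ring⟩
  rw [← hN, hqp.dvd_mul, hqp.dvd_mul] at hd
  have ct := cuspType_eq hN hsq hqp
  rcases hd with (hd | hd) | hd
  · rw [ct.1 hd]; simp
  · rw [ct.2.1 hd]
    exact ⟨fun _ => part_prime_eq_one hsq hN1 hqp hd h1, fun h => by simp at h⟩
  · rw [ct.2.2 hd]
    exact ⟨fun h => by simp at h, fun _ => part_prime_sq_eq_one hsq hN2 hqp hd h2⟩

/-- An Eisenstein series at a cusp equivalent to `(N₀, N₁, N₂)` as a sum over primitive isotropic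
vectors. -/
theorem eisenstein_eq_eis_totalWeight {N N₀ N₁ N₂ k : ℕ} (hN : N₀ * N₁ * N₂ = N)
    (hsq : Squarefree N) (hk : 4 ≤ k) {χ : DirichletCharacter ℂ N} (hχ : χ (-1) = (-1) ^ k)
    (ht : GoodType χ (cuspType N₀ N₁)) {γ₀ : Sp2Z}
    (hγ₀ : totalWeight χ (cuspType N₀ N₁) (pl γ₀) = 1) :
    eisenstein k χ γ₀ = eis k (totalWeight χ (cuspType N₀ N₁)) := by
  refine eisenstein_eq_eis hk χ γ₀ _ (norm_totalWeight_le χ _) (fun γ hγ => ?_) (fun p => ?_)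
    fun p hp h0 => ?_
  · rw [totalWeight_act hsq ht hγ, hγ₀, mul_one]
  · rw [totalWeight_neg hsq ht, hχ]
  · obtain ⟨γ, hγ, h⟩ := ((totalWeight_ne_zero_iff hN hsq χ hp).1 h0).exists_act hN hsq hp
    obtain ⟨γ', hγ', h'⟩ := ((totalWeight_ne_zero_iff hN hsq χ (pl_mem γ₀)).1
      (by rw [hγ₀]; exact one_ne_zero)).exists_act hN hsq (pl_mem γ₀)
    refine ⟨γ'⁻¹ * γ, (Gamma0 N).mul_mem ((Gamma0 N).inv_mem hγ') hγ, ?_⟩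
    rw [act_mul]
    rcases h' with h' | h' <;> rw [h'] <;> simp only [act_neg, act_inv_act, Plucker.neg_neg]
    · exact h
    · exact h.symm

theorem eisRho_eq_eis {N N₀ N₁ N₂ k : ℕ} (hN : N₀ * N₁ * N₂ = N) (hsq : Squarefree N)
    (hk : 4 ≤ k) {χ : DirichletCharacter ℂ N} (hχ : χ (-1) = (-1) ^ k) (h1 : part χ N₁ = 1)
    (h2 : part χ N₂ ^ 2 = 1) :
    eisRho k χ N₀ N₁ N₂ = eis k (totalWeight χ (cuspType N₀ N₁)) :=
  eisenstein_eq_eis_totalWeight hN hsq hk hχ (goodType_cuspType hN hsq h1 h2)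
    (totalWeight_cuspRep hN hsq χ)

/-! ### Hecke operators on sums over `V` -/

theorem det_blockD_mul_cast {N : ℕ} {γ γ' : Sp2Z} (h : γ ∈ Gamma0 N) :
    ((blockD (γ * γ')).det : ZMod N) = (blockD γ).det * (blockD γ').det := by
  have hc := cast_blockC (γ := γ) (d := N) h
  simp only [blockD, Matrix.det_fin_two, toBlocks₂₂, Matrix.of_apply, Submonoid.coe_mul,
    Matrix.mul_apply, Fintype.sum_sum_type, Fin.sum_univ_two, Int.cast_sub, Int.cast_mul,
    Int.cast_add, hc]
  ring

/-- Weight functions of automorphic forms of level `N` and character `χ`. -/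
def Equivariant {N : ℕ} (χ : DirichletCharacter ℂ N) (Φ : Plucker ℤ → ℂ) : Prop :=
  ∀ γ ∈ Gamma0 N, ∀ p, Φ (act γ p) = (starRingEnd ℂ) (χ ((blockD γ).det : ZMod N)) * Φ p

theorem similitude_mul_toReal {g : Mat4R} {ν : ℝ}
    (hg : gᵀ * Matrix.J (Fin 2) ℝ * g = ν • Matrix.J (Fin 2) ℝ) (γ : Sp2Z) :
    (g * toReal γ)ᵀ * Matrix.J (Fin 2) ℝ * (g * toReal γ) = ν • Matrix.J (Fin 2) ℝ := by
  calc _ = (toReal γ)ᵀ * (gᵀ * Matrix.J (Fin 2) ℝ * g) * toReal γ := by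
        rw [Matrix.transpose_mul]; simp only [Matrix.mul_assoc]
    _ = _ := by
        rw [hg, Matrix.mul_smul, Matrix.smul_mul, toReal_similitude, one_smul]

theorem similitude_toReal_mul {g : Mat4R} {ν : ℝ}
    (hg : gᵀ * Matrix.J (Fin 2) ℝ * g = ν • Matrix.J (Fin 2) ℝ) (γ : Sp2Z) :
    (toReal γ * g)ᵀ * Matrix.J (Fin 2) ℝ * (toReal γ * g) = ν • Matrix.J (Fin 2) ℝ := by
  calc _ = gᵀ * ((toReal γ)ᵀ * Matrix.J (Fin 2) ℝ * toReal γ) * g := by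
        rw [Matrix.transpose_mul]; simp only [Matrix.mul_assoc]
    _ = _ := by rw [toReal_similitude, one_smul, hg]

theorem slash_eis_toReal_mul {N k : ℕ} {χ : DirichletCharacter ℂ N} {Φ : Plucker ℤ → ℂ}
    (hΦ : Equivariant χ Φ) {g : Mat4R} {ν : ℝ} (hν : 0 < ν)
    (hg : gᵀ * Matrix.J (Fin 2) ℝ * g = ν • Matrix.J (Fin 2) ℝ) {η : Sp2Z} (hη : η ∈ Gamma0 N)
    (τ : UpperHalf) :
    (starRingEnd ℂ) (χ ((blockD η).det : ZMod N)) * slash k (eis k Φ) (toReal η * g) τ =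
      slash k (eis k Φ) g τ := by
  rw [slash_eis k Φ _ ν hν (similitude_toReal_mul hg η), slash_eis k Φ _ ν hν hg, Matrix.det_mul,
    det_toReal, one_mul, mul_left_comm]
  congr 1
  rw [mul_left_comm]
  congr 1
  rw [← tsum_mul_left,
    ← (actV η).tsum_eq (fun p => Φ p.1 * (linMat τ (gᵀ * skew p.1.toR * g) ^ k)⁻¹)]
  refine tsum_congr fun p => ?_
  simp only [actV, Equiv.coe_fn_mk]
  rw [hΦ η hη, linMat_toReal_mul]
  ring

/-- The representative picked by `Quotient.out` differs from `r i` by an element of the stabiliser,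
so δ⁻¹γ = ηδ⁻¹ `r i` with η in `Gamma0 N`, and γ and η have the same character value. Equivariance
removes η together with its character value, and none remains because det D = 1 for `r i`. -/
theorem hecke_eis_eq_sum {N k q : ℕ} {χ : DirichletCharacter ℂ N} {δ : Mat4R} (hδ : IsUnit δ.det)
    {ν : ℝ} (hν : 0 < ν)
    (hg : (δ⁻¹)ᵀ * Matrix.J (Fin 2) ℝ * δ⁻¹ = ν • Matrix.J (Fin 2) ℝ)
    (hdet : ∀ γ η : Gamma0 N, toReal γ.1 * δ = δ * toReal η.1 →
      (blockD γ.1).det = (blockD η.1).det)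
    {Φ : Plucker ℤ → ℂ} (hΦ : Equivariant χ Φ) {ι : Type} [Fintype ι] (r : ι → Gamma0 N)
    (hinj : ∀ i j, r i * (r j)⁻¹ ∈ heckeStab N δ → i = j)
    (hsurj : ∀ γ, ∃ i, γ * (r i)⁻¹ ∈ heckeStab N δ)
    (hr : ∀ i, (blockD (r i).1).det = 1) (τ : UpperHalf) :
    hecke k χ q δ (eis k Φ) τ = (q : ℂ) ^ ((k : ℤ) - 3) *
      ∑ i, slash k (eis k Φ) (δ⁻¹ * toReal (r i).1) τ := by
  rw [hecke]
  congr 1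
  let Q := Quotient (QuotientGroup.rightRel (heckeStab N δ))
  let e : ι → Q := fun i => Quotient.mk _ (r i)
  have he : Function.Bijective e := by
    constructor
    · intro i j h
      exact (hinj j i (QuotientGroup.rightRel_apply.1 (Quotient.exact h))).symm
    · intro c
      obtain ⟨γ, rfl⟩ := Quotient.exists_rep c
      obtain ⟨i, hi⟩ := hsurj γ
      exact ⟨i, Quotient.sound (QuotientGroup.rightRel_apply.2 hi)⟩
  rw [← finsum_eq_of_bijective e he (f := fun i =>
    slash k (eis k Φ) (δ⁻¹ * toReal (r i).1) τ), finsum_eq_sum_of_fintype]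
  intro i
  have h := Quotient.exact (Quotient.out_eq (e i))
  have h' := QuotientGroup.rightRel_apply.1 ((QuotientGroup.rightRel (heckeStab N δ)).symm h)
  obtain ⟨η, hη⟩ := h'
  set γ : Gamma0 N := (e i).out with hγ
  have e1 : γ = γ * (r i)⁻¹ * r i := by group
  have e2 : δ⁻¹ * toReal γ.1 = toReal η.1 * (δ⁻¹ * toReal (r i).1) := by
    conv_lhs => rw [e1]
    rw [Subgroup.coe_mul, toReal_mul, ← Matrix.mul_assoc, ← Matrix.mul_assoc]
    congr 1
    calc δ⁻¹ * toReal (γ * (r i)⁻¹).1 = δ⁻¹ * (toReal (γ * (r i)⁻¹).1 * δ) * δ⁻¹ := by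
          rw [← Matrix.mul_assoc, Matrix.mul_nonsing_inv_cancel_right _ _ hδ]
      _ = _ := by rw [hη, Matrix.nonsing_inv_mul_cancel_left _ _ hδ]
  have e3 : (((blockD γ.1).det : ℤ) : ZMod N) = ((blockD η.1).det : ℤ) := by
    conv_lhs => rw [e1]
    rw [Subgroup.coe_mul, det_blockD_mul_cast (γ * (r i)⁻¹).2, hr i, Int.cast_one, mul_one,
      hdet _ _ hη]
  rw [e2, e3, slash_eis_toReal_mul hΦ hν (similitude_mul_toReal hg _) η.2]

theorem mul_left_cancel_of_det_ne_zero {Δ X Y : Matrix (Fin 2 ⊕ Fin 2) (Fin 2 ⊕ Fin 2) ℤ}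
    (hΔ : Δ.det ≠ 0) (h : Δ * X = Δ * Y) : X = Y := by
  have := congrArg (fun M => Δ.adjugate * M) h
  simp only [← Matrix.mul_assoc, Matrix.adjugate_mul, Matrix.smul_mul, Matrix.one_mul] at this
  exact smul_right_injective _ hΔ this

theorem mem_symplecticGroup_of_conj {Δ η γ : Matrix (Fin 2 ⊕ Fin 2) (Fin 2 ⊕ Fin 2) ℤ} {c : ℤ}
    (hγ : γ ∈ Matrix.symplecticGroup (Fin 2) ℤ)
    (hΔ : Δ * Matrix.J (Fin 2) ℤ * Δᵀ = c • Matrix.J (Fin 2) ℤ) (hdet : Δ.det ≠ 0)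
    (h : γ * Δ = Δ * η) : η ∈ Matrix.symplecticGroup (Fin 2) ℤ := by
  rw [SymplecticGroup.mem_iff] at hγ ⊢
  have h1 : Δ * (η * Matrix.J (Fin 2) ℤ * ηᵀ * Δᵀ) = Δ * (Matrix.J (Fin 2) ℤ * Δᵀ) := by
    calc _ = (Δ * η) * Matrix.J (Fin 2) ℤ * (Δ * η)ᵀ := by
          rw [Matrix.transpose_mul]; simp only [Matrix.mul_assoc]
      _ = γ * (Δ * Matrix.J (Fin 2) ℤ * Δᵀ) * γᵀ := by
          rw [← h, Matrix.transpose_mul]; simp only [Matrix.mul_assoc]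
      _ = _ := by
          rw [hΔ, Matrix.mul_smul, Matrix.smul_mul, hγ, ← hΔ, Matrix.mul_assoc]
  have h2 := mul_left_cancel_of_det_ne_zero hdet h1
  have h3 := congrArg Matrix.transpose h2
  rw [Matrix.transpose_mul, Matrix.transpose_mul _ Δᵀ, Matrix.transpose_transpose] at h3
  exact Matrix.transpose_injective (mul_left_cancel_of_det_ne_zero hdet h3)

/-- The matrix δ for T₁(q²) is not integral. Conjugation does not see the scalar s, so one can work
with the integral matrix Δ. -/
theorem mem_heckeStab_of_conj {N : ℕ} {δ : Mat4R} {s : ℝ}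
    {Δ η : Matrix (Fin 2 ⊕ Fin 2) (Fin 2 ⊕ Fin 2) ℤ} {c : ℤ}
    (hδ : δ = s • Δ.map (Int.cast : ℤ → ℝ))
    (hΔ : Δ * Matrix.J (Fin 2) ℤ * Δᵀ = c • Matrix.J (Fin 2) ℤ) (hdet : Δ.det ≠ 0)
    {γ : Gamma0 N} (h : γ.1.1 * Δ = Δ * η) (hη : ∀ i j, (N : ℤ) ∣ η (.inr i) (.inl j)) :
    γ ∈ heckeStab N δ := by
  refine ⟨⟨⟨η, mem_symplecticGroup_of_conj γ.1.2 hΔ hdet h⟩, hη⟩, ?_⟩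
  have h' := congrArg (fun M => M.map (Int.castRingHom ℝ)) h
  simp only [Matrix.map_mul] at h'
  rw [hδ, Matrix.mul_smul, Matrix.smul_mul]
  exact congrArg (s • ·) h'

theorem det_blockD_eq_of_conj {N : ℕ} {X Y : Matrix (Fin 2) (Fin 2) ℝ} (hY : Y.det ≠ 0)
    {γ η : Gamma0 N} (h : toReal γ.1 * fromBlocks X 0 0 Y = fromBlocks X 0 0 Y * toReal η.1) :
    (blockD γ.1).det = (blockD η.1).det := by
  have hb : ∀ γ : Sp2Z, (toReal γ).toBlocks₂₂ = (blockD γ).map (Int.cast : ℤ → ℝ) := fun γ => rfl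
  rw [← fromBlocks_toBlocks (toReal γ.1), ← fromBlocks_toBlocks (toReal η.1), fromBlocks_multiply,
    fromBlocks_multiply, fromBlocks_inj] at h
  have h4 := h.2.2.2
  simp only [Matrix.mul_zero, Matrix.zero_mul, zero_add, hb] at h4
  have h5 := congrArg Matrix.det h4
  rw [Matrix.det_mul, Matrix.det_mul, mul_comm Y.det] at h5
  have h6 := mul_right_cancel₀ hY h5
  have e1 := (Int.castRingHom ℝ).map_det (blockD γ.1)
  have e2 := (Int.castRingHom ℝ).map_det (blockD η.1)
  have : ((blockD γ.1).det : ℝ) = (blockD η.1).det := e1.trans (h6.trans e2.symm)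
  exact_mod_cast this

/-- Reindexing along `i`: the terms outside `i '' W` vanish, and extension by zero keeps both sums
over the same type. -/
theorem tsum_transfer {W : Set (Plucker ℤ)} (hW : W ⊆ V) {i : Plucker ℤ → Plucker ℤ}
    (hi : ∀ w ∈ W, i w ∈ V) (hinj : Set.InjOn i W) {f : Plucker ℤ → ℂ}
    (hf : ∀ p ∈ V, f p ≠ 0 → ∃ w ∈ W, i w = p) :
    ∑' p : V, f p.1 = ∑' p : V, W.indicator (fun w => f (i w)) p.1 := by
  have h1 : Function.Injective (fun w : W => (⟨i w.1, hi _ w.2⟩ : V)) := fun w w' h =>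
    Subtype.ext (hinj w.2 w'.2 (congrArg Subtype.val h))
  have h2 : Function.Injective (fun w : W => (⟨w.1, hW w.2⟩ : V)) := fun w w' h =>
    Subtype.ext (by simpa using h)
  rw [← h1.tsum_eq, ← h2.tsum_eq]
  · exact tsum_congr fun w => by simp
  · intro p hp
    by_cases hw : p.1 ∈ W
    · exact ⟨⟨p.1, hw⟩, rfl⟩
    · exact absurd (Set.indicator_of_notMem hw _) hp
  · intro p hp
    obtain ⟨w, hw, h⟩ := hf p.1 p.2 hp
    exact ⟨⟨w, hw⟩, Subtype.ext h⟩

theorem eis_congr {k : ℕ} {Φ Ψ : Plucker ℤ → ℂ} (h : ∀ p ∈ V, Φ p = Ψ p) : eis k Φ = eis k Ψ := by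
  funext τ
  rw [eis, eis]
  congr 1
  exact tsum_congr fun p => by rw [h p.1 p.2]

theorem eis_sum {k : ℕ} (hk : 4 ≤ k) {ι : Type*} (s : Finset ι) (c : ι → ℂ) (Φ : ι → Plucker ℤ → ℂ)
    (hΦ : ∀ i p, ‖Φ i p‖ ≤ 1) (τ : UpperHalf) :
    ∑ i ∈ s, c i * eis k (Φ i) τ = eis k (fun p => ∑ i ∈ s, c i * Φ i p) τ := by
  simp only [eis]
  have : ∀ p : V, (∑ i ∈ s, c i * Φ i p.1) * (lin τ p.1.toR ^ k)⁻¹ =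
      ∑ i ∈ s, c i * (Φ i p.1 * (lin τ p.1.toR ^ k)⁻¹) := fun p => by
    rw [Finset.sum_mul]
    exact Finset.sum_congr rfl fun i _ => by ring
  simp only [this]
  rw [Summable.tsum_finsetSum fun i _ => (summable_lin τ hk (hΦ i)).mul_left _, Finset.mul_sum]
  refine Finset.sum_congr rfl fun i _ => ?_
  rw [tsum_mul_left]
  ring

/-- The index function of a diagonal `4 × 4` matrix. -/
def quad {R : Type*} (x y z w : R) : Fin 2 ⊕ Fin 2 → R := Sum.elim ![x, y] ![z, w]

theorem diagonal_quad {R : Type*} [CommRing R] (x y z w : R) :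
    Matrix.diagonal (quad x y z w) =
      fromBlocks (Matrix.diagonal ![x, y]) 0 0 (Matrix.diagonal ![z, w]) := by
  rw [quad, fromBlocks_diagonal]

theorem diagonal_quad_similitude {R : Type*} [CommRing R] {x y z w ν : R} (h1 : x * z = ν)
    (h2 : y * w = ν) : Matrix.diagonal (quad x y z w) * Matrix.J (Fin 2) R *
      (Matrix.diagonal (quad x y z w)) = ν • Matrix.J (Fin 2) R := by
  ext i j
  rw [Matrix.mul_diagonal, Matrix.diagonal_mul]
  rcases i with i | i <;> rcases j with j | j <;> fin_cases i <;> fin_cases j <;>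
    simp [quad, Matrix.J, ← h1, mul_comm]
  · rw [h1, ← h2]
  · rw [h1, ← h2]

theorem diagonal_quad_mul_skew {R : Type*} [CommRing R] {x y z w ν : R} (h1 : x * z = ν)
    (h2 : y * w = ν) (p : Plucker R) :
    (Matrix.diagonal (quad x y z w))ᵀ * skew p * Matrix.diagonal (quad x y z w) =
      skew ⟨x * y * p.a, ν * p.b, x * w * p.m, y * z * p.n, z * w * p.e⟩ := by
  subst h1
  ext i j
  rw [Matrix.diagonal_transpose, Matrix.mul_diagonal, Matrix.diagonal_mul]
  rcases i with i | i <;> rcases j with j | j <;> fin_cases i <;> fin_cases j <;>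
    simp [quad, skew, ← h2]
  any_goals ring1
  all_goals linear_combination (-p.b) * h2

theorem diagonal_quad_inv {x y z w : ℝ} (hx : x ≠ 0) (hy : y ≠ 0) (hz : z ≠ 0) (hw : w ≠ 0) :
    IsUnit (Matrix.diagonal (quad x y z w)).det ∧
      (Matrix.diagonal (quad x y z w))⁻¹ = Matrix.diagonal (quad x⁻¹ y⁻¹ z⁻¹ w⁻¹) := by
  have h : Matrix.diagonal (quad x y z w) * Matrix.diagonal (quad x⁻¹ y⁻¹ z⁻¹ w⁻¹) = 1 := by
    rw [Matrix.diagonal_mul_diagonal, ← Matrix.diagonal_one]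
    congr 1
    funext i
    rcases i with i | i <;> fin_cases i <;> simp [quad, hx, hy, hz, hw]
  exact ⟨(Matrix.isUnit_iff_isUnit_det _).1 (IsUnit.of_mul_eq_one _ h), Matrix.inv_eq_right_inv h⟩

theorem det_diagonal_quad {R : Type*} [CommRing R] (x y z w : R) :
    (Matrix.diagonal (quad x y z w)).det = x * y * (z * w) := by
  simp [Matrix.det_diagonal, quad]

theorem mem_heckeStab_diagonal {N : ℕ} {x y z w ν : ℤ} {s : ℝ} (h1 : x * z = ν) (h2 : y * w = ν)
    (hν : ν ≠ 0) {γ : Gamma0 N} {η : Matrix (Fin 2 ⊕ Fin 2) (Fin 2 ⊕ Fin 2) ℤ}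
    (h : ∀ i j, γ.1.1 i j * quad x y z w j = quad x y z w i * η i j)
    (hη : ∀ i j, (N : ℤ) ∣ η (.inr i) (.inl j)) :
    γ ∈ heckeStab N (Matrix.diagonal (quad (s * x) (s * y) (s * z) (s * w))) := by
  refine mem_heckeStab_of_conj (s := s) (c := ν) (Δ := Matrix.diagonal (quad x y z w)) (η := η)
    ?_ ?_ ?_ ?_ hη
  · ext i j
    by_cases hij : i = j
    · subst hij
      rcases i with i | i <;> fin_cases i <;> simp [quad]
    · simp [hij]
  · rw [Matrix.diagonal_transpose, diagonal_quad_similitude h1 h2]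
  · rw [det_diagonal_quad]
    have : x * y * (z * w) = ν * ν := by rw [← h1]; linear_combination x * z * h2 - x * z * h1
    rw [this]
    exact mul_ne_zero hν hν
  · ext i j
    rw [Matrix.mul_diagonal, Matrix.diagonal_mul, h]

theorem apply_of_mem_heckeStab_diagonal {N : ℕ} {v : Fin 2 ⊕ Fin 2 → ℝ} {γ : Gamma0 N}
    (h : γ ∈ heckeStab N (Matrix.diagonal v)) (i j : Fin 2 ⊕ Fin 2) :
    ∃ c : ℤ, (γ.1.1 i j : ℝ) * v j = v i * c := by
  obtain ⟨η, hη⟩ := h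
  refine ⟨η.1.1 i j, ?_⟩
  have := congrFun (congrFun hη i) j
  rw [Matrix.mul_diagonal, Matrix.diagonal_mul] at this
  exact this

theorem det_blockD_eq_of_diagonal {N : ℕ} {x y z w : ℝ} (hz : z ≠ 0) (hw : w ≠ 0)
    {γ η : Gamma0 N} (h : toReal γ.1 * Matrix.diagonal (quad x y z w) =
      Matrix.diagonal (quad x y z w) * toReal η.1) : (blockD γ.1).det = (blockD η.1).det := by
  rw [diagonal_quad] at h
  exact det_blockD_eq_of_conj (by simp [Matrix.det_diagonal, hz, hw]) h

theorem linMat_smul (τ : UpperHalf) (c : ℝ) (P : Mat4R) : linMat τ (c • P) = c * linMat τ P := by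
  have : (c • P).map Complex.ofReal = (c : ℂ) • P.map Complex.ofReal := by
    ext i j
    simp
  rw [linMat, linMat, this, Matrix.mul_smul, Matrix.smul_mul]
  rfl

/-- A Hecke matrix g need not preserve integrality or primitivity. On the support of Φ, however,
gᵀpg is s times a primitive vector w with `i w = p`, so by homogeneity of degree -k the sum moves to
`W` with a factor s^(-k). -/
theorem slash_eis_transfer {k : ℕ} {g : Mat4R} {ν : ℝ} (hν : 0 < ν)
    (hg : gᵀ * Matrix.J (Fin 2) ℝ * g = ν • Matrix.J (Fin 2) ℝ) {Φ : Plucker ℤ → ℂ}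
    {W : Set (Plucker ℤ)} (hW : W ⊆ V) {i : Plucker ℤ → Plucker ℤ}
    (hi : ∀ w ∈ W, i w ∈ V) (hinj : Set.InjOn i W)
    (hΦ : ∀ p ∈ V, Φ p ≠ 0 → ∃ w ∈ W, i w = p) {s : ℝ}
    (hs : ∀ w ∈ W, gᵀ * skew (i w).toR * g = s • skew w.toR) (ρ : Sp2Z) (τ : UpperHalf) :
    slash k (eis k Φ) (g * toReal ρ⁻¹) τ = ((g.det ^ ((k : ℝ) / 2) : ℝ) : ℂ) *
      (((s : ℂ) ^ k)⁻¹ * eis k (fun p => W.indicator (fun w => Φ (i w)) (act ρ p)) τ) := by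
  rw [slash_eis k Φ _ ν hν (similitude_mul_toReal hg _), Matrix.det_mul, det_toReal, mul_one, eis,
    tsum_transfer hW hi hinj (f := fun p => Φ p * (linMat τ ((g * toReal ρ⁻¹)ᵀ * skew p.toR *
      (g * toReal ρ⁻¹)) ^ k)⁻¹)]
  · rw [mul_left_comm ((s : ℂ) ^ k)⁻¹, ← tsum_mul_left (a := ((s : ℂ) ^ k)⁻¹),
      ← (actV ρ⁻¹).tsum_eq (fun p => ((s : ℂ) ^ k)⁻¹ *
        (W.indicator (fun w => Φ (i w)) (act ρ p.1) * (lin τ p.1.toR ^ k)⁻¹))]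
    congr 2
    refine tsum_congr fun p => ?_
    simp only [actV, Equiv.coe_fn_mk, act_act_inv]
    by_cases hp : p.1 ∈ W
    · rw [Set.indicator_of_mem hp, Set.indicator_of_mem hp]
      have : (g * toReal ρ⁻¹)ᵀ * skew (i p.1).toR * (g * toReal ρ⁻¹) =
          s • skew (act ρ⁻¹ p.1).toR := by
        rw [skew_act_toR, Matrix.transpose_mul]
        calc _ = (toReal ρ⁻¹)ᵀ * (gᵀ * skew (i p.1).toR * g) * toReal ρ⁻¹ := by
              simp only [Matrix.mul_assoc]
          _ = _ := by rw [hs _ hp, Matrix.mul_smul, Matrix.smul_mul]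
      rw [this, linMat_smul, linMat_skew, mul_pow, mul_inv]
      ring
    · rw [Set.indicator_of_notMem hp, Set.indicator_of_notMem hp]
      simp
  · intro p hp h
    exact hΦ p hp (left_ne_zero_of_mul h)

theorem transl_mem (N : ℕ) (s₁ s₂ s₃ : ℤ) : transl s₁ s₂ s₃ ∈ Gamma0 N :=
  mem_Gamma0_of_blockC_eq_zero N (by simp [transl, blockC])

theorem transl_inv (s₁ s₂ s₃ : ℤ) : (transl s₁ s₂ s₃)⁻¹ = transl (-s₁) (-s₂) (-s₃) := by
  apply inv_eq_of_mul_eq_one_right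
  apply Subtype.ext
  rw [Submonoid.coe_mul, transl, transl, fromBlocks_multiply]
  simp only [Submonoid.coe_one, ← fromBlocks_one]
  congr 1 <;> simp
  ext i j; fin_cases i <;> fin_cases j <;> simp

theorem transl_mul (s₁ s₂ s₃ t₁ t₂ t₃ : ℤ) :
    transl s₁ s₂ s₃ * transl t₁ t₂ t₃ = transl (s₁ + t₁) (s₂ + t₂) (s₃ + t₃) := by
  apply Subtype.ext
  rw [Submonoid.coe_mul, transl, transl, transl, fromBlocks_multiply]
  congr 1 <;> simp [add_comm]

theorem zmod_eq_of_dvd {q : ℕ} [NeZero q] {x y : ZMod q}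
    (h : (q : ℤ) ∣ (x.val : ℤ) - (y.val : ℤ)) : x = y := by
  rw [← ZMod.intCast_eq_intCast_iff_dvd_sub] at h
  simpa using h.symm

/-- The relations between the blocks of an element of `Γ₀(N)`, modulo `N`. -/
theorem cast_symplectic {d : ℕ} {γ : Sp2Z} (h : ∀ i j, (d : ℤ) ∣ blockC γ i j) :
    ∃ A B D : Fin 2 → Fin 2 → ZMod d,
      (∀ i j, (γ.1 (.inl i) (.inl j) : ZMod d) = A i j) ∧
      (∀ i j, (γ.1 (.inl i) (.inr j) : ZMod d) = B i j) ∧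
      (∀ i j, (γ.1 (.inr i) (.inr j) : ZMod d) = D i j) ∧
      A 0 0 * D 0 0 + A 0 1 * D 0 1 = 1 ∧ A 0 0 * D 1 0 + A 0 1 * D 1 1 = 0 ∧
      A 1 0 * D 0 0 + A 1 1 * D 0 1 = 0 ∧ A 1 0 * D 1 0 + A 1 1 * D 1 1 = 1 ∧
      B 0 0 * D 0 1 + B 1 0 * D 1 1 = D 0 0 * B 0 1 + D 1 0 * B 1 1 := by
  refine ⟨fun i j => γ.1 (.inl i) (.inl j), fun i j => γ.1 (.inl i) (.inr j),
    fun i j => γ.1 (.inr i) (.inr j), fun _ _ => rfl, fun _ _ => rfl, fun _ _ => rfl, ?_⟩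
  have hc := cast_blockC h
  obtain ⟨h1, -, -, h4⟩ := symplectic_blocks γ
  have h1' : ∀ i j, _ := fun i j =>
    congrArg (Int.cast : ℤ → ZMod d) (congrFun (congrFun h1 i) j)
  have h4' : ∀ i j, _ := fun i j =>
    congrArg (Int.cast : ℤ → ZMod d) (congrFun (congrFun h4 i) j)
  have a00 := h1' 0 0
  have a01 := h1' 0 1
  have a10 := h1' 1 0
  have a11 := h1' 1 1
  have b01 := h4' 0 1
  simp [Matrix.mul_apply, toBlocks₁₁, toBlocks₁₂, toBlocks₂₁, toBlocks₂₂, hc, Fin.sum_univ_two]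
    at a00 a01 a10 a11 b01
  exact ⟨a00, a01, a10, a11, b01⟩

/-! ### The operator T(q) -/

/-- The matrix `diag(q, q, 1, 1)`. -/
def deltaT (q : ℕ) : Mat4R := Matrix.diagonal (quad (q : ℝ) q 1 1)

theorem deltaT_eq (q : ℕ) : fromBlocks (Matrix.diagonal ![(q : ℝ), q]) 0 0 1 = deltaT q := by
  rw [deltaT, diagonal_quad]
  congr 1
  ext i j; fin_cases i <;> fin_cases j <;> simp

/-- Here δ⁻¹γδ = (A, B/q; qC, D). -/
theorem mem_heckeStab_deltaT_iff {N q : ℕ} (hq : q ≠ 0) {γ : Gamma0 N} :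
    γ ∈ heckeStab N (deltaT q) ↔ ∀ i j, (q : ℤ) ∣ γ.1.1 (.inl i) (.inr j) := by
  constructor
  · intro h i j
    obtain ⟨c, hc⟩ := apply_of_mem_heckeStab_diagonal h (.inl i) (.inr j)
    refine ⟨c, ?_⟩
    have : (γ.1.1 (.inl i) (.inr j) : ℝ) = q * c := by
      fin_cases i <;> fin_cases j <;> simpa [quad] using hc
    exact_mod_cast this
  · intro h
    choose B hB using h
    have := mem_heckeStab_diagonal (s := 1) (x := q) (y := q) (z := 1) (w := 1) (ν := q)
      (γ := γ) (η := fromBlocks γ.1.1.toBlocks₁₁ (Matrix.of B)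
        (Matrix.of fun i j => q * γ.1.1 (.inr i) (.inl j)) γ.1.1.toBlocks₂₂) (by ring) (by ring)
      (by exact_mod_cast hq) ?_ ?_
    · simpa [deltaT] using this
    · intro i j
      rcases i with i | i <;> rcases j with j | j <;> fin_cases i <;> fin_cases j <;>
        simp [quad, toBlocks₁₁, toBlocks₂₂, hB, mul_comm]
    · intro i j
      exact (γ.2 i j).mul_left (q : ℤ)

/-- Representatives for `T(q)`. -/
def repT (N : ℕ) {q : ℕ} (i : ZMod q × ZMod q × ZMod q) : Gamma0 N :=
  ⟨(transl i.1.val i.2.1.val i.2.2.val)⁻¹, (Gamma0 N).inv_mem (transl_mem N _ _ _)⟩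

theorem repT_injective {N q : ℕ} [NeZero q] (i j : ZMod q × ZMod q × ZMod q)
    (h : repT N i * (repT N j)⁻¹ ∈ heckeStab N (deltaT q)) : i = j := by
  have e : (repT N i * (repT N j)⁻¹).1 = transl (-i.1.val + j.1.val) (-i.2.1.val + j.2.1.val)
      (-i.2.2.val + j.2.2.val) := by
    simp [repT, transl_inv, transl_mul]
  have hd := (mem_heckeStab_deltaT_iff (NeZero.ne q)).1 h
  rw [e] at hd
  have h00 := hd 0 0
  have h01 := hd 0 1
  have h11 := hd 1 1
  simp only [transl, fromBlocks_apply₁₂, Matrix.of_apply, Matrix.cons_val', Matrix.cons_val_zero,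
    Matrix.cons_val_one, Matrix.cons_val_fin_one] at h00 h01 h11
  refine Prod.ext ?_ (Prod.ext ?_ ?_) <;> refine (zmod_eq_of_dvd ?_).symm <;>
    rwa [sub_eq_neg_add]

/-- Modulo q the inverse of A is Dᵀ, so S = -DᵀB solves B + AS ≡ 0, and it is symmetric because DᵀB
is. -/
theorem repT_surjective {N q : ℕ} [NeZero q] (hq : q ∣ N) (γ : Gamma0 N) :
    ∃ i : ZMod q × ZMod q × ZMod q, γ * (repT N i)⁻¹ ∈ heckeStab N (deltaT q) := by
  obtain ⟨A, B, D, hA, hB, hD, a00, a01, a10, a11, b01⟩ := cast_symplectic (Gamma0_mono hq γ.2)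
  refine ⟨(-(D 0 0 * B 0 0 + D 1 0 * B 1 0), -(D 0 0 * B 0 1 + D 1 0 * B 1 1),
    -(D 0 1 * B 0 1 + D 1 1 * B 1 1)), (mem_heckeStab_deltaT_iff (NeZero.ne q)).2 fun i j => ?_⟩
  rw [← ZMod.intCast_zmod_eq_zero_iff_dvd, Subgroup.coe_mul, Subgroup.coe_inv, repT, inv_inv,
    Submonoid.coe_mul]
  fin_cases i <;> fin_cases j <;>
    simp [transl, Matrix.mul_apply, hA, hB]
  · linear_combination (-B 0 0) * a00 - B 1 0 * a01 + A 0 1 * b01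
  · linear_combination (-B 0 1) * a00 - B 1 1 * a01
  · linear_combination (-B 0 0) * a10 - B 1 0 * a11 + A 1 1 * b01
  · linear_combination (-B 0 1) * a10 - B 1 1 * a11

/-- The product of the local factors away from `q`. -/
def coWeight {N : ℕ} (χ : DirichletCharacter ℂ N) (t : ℕ → Fin 3) (q : ℕ) (p : Plucker ℤ) : ℂ :=
  ∏ l ∈ N.primeFactors.erase q, weight χ l (t l) p

theorem totalWeight_eq_mul {N q : ℕ} (hq : q ∈ N.primeFactors) (χ : DirichletCharacter ℂ N)
    (t : ℕ → Fin 3) (p : Plucker ℤ) :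
    totalWeight χ t p = weight χ q (t q) p * coWeight χ t q p :=
  (Finset.mul_prod_erase _ _ hq).symm

theorem coWeight_update {N q : ℕ} (χ : DirichletCharacter ℂ N) (t : ℕ → Fin 3) (j : Fin 3)
    (p : Plucker ℤ) : coWeight χ (Function.update t q j) q p = coWeight χ t q p :=
  Finset.prod_congr rfl fun l hl => by rw [Function.update_of_ne (Finset.ne_of_mem_erase hl)]

theorem coWeight_act {N : ℕ} {χ : DirichletCharacter ℂ N} {t : ℕ → Fin 3} (ht : GoodType χ t)
    {q : ℕ} {γ : Sp2Z} (h : γ ∈ Gamma0 N) (hD : (blockD γ).det = 1) (p : Plucker ℤ) :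
    coWeight χ t q (act γ p) = coWeight χ t q p := by
  refine Finset.prod_congr rfl fun l hl => ?_
  have hl' := Finset.mem_of_mem_erase hl
  rw [weight_act χ (ht l hl').1 (Gamma0_mono (Nat.dvd_of_mem_primeFactors hl') h), hD]
  simp

/-- Modulo a prime l ≠ q, a Hecke matrix at q multiplies the coordinates by units. The type is
unchanged, and a constant is all that can come out. -/
theorem weight_scale {N l : ℕ} (χ : DirichletCharacter ℂ N) {t : Fin 3} {p p' : Plucker ℤ}
    {α β μ ν ε : ZMod l} (hα : IsUnit α) (hβ : IsUnit β) (hμ : IsUnit μ) (hν : IsUnit ν)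
    (ha : (p'.a : ZMod l) = α * p.a) (hb : (p'.b : ZMod l) = β * p.b)
    (hm : (p'.m : ZMod l) = μ * p.m) (hn : (p'.n : ZMod l) = ν * p.n)
    (he : (p'.e : ZMod l) = ε * p.e) {c : ℂ}
    (h0 : t = 0 → (starRingEnd ℂ) (part χ l ε) = c) (h1 : t = 1 → c = 1)
    (h2 : t = 2 → part χ l α = c) : weight χ l t p' = c * weight χ l t p := by
  have hr : RankZero l p' ↔ RankZero l p := by
    rw [rankZero_iff, rankZero_iff, ha, hb, hm, hn, hα.mul_right_eq_zero, hβ.mul_right_eq_zero,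
      hμ.mul_right_eq_zero, hν.mul_right_eq_zero]
  have hd : (l : ℤ) ∣ p'.a ↔ (l : ℤ) ∣ p.a := by
    rw [← ZMod.intCast_zmod_eq_zero_iff_dvd, ← ZMod.intCast_zmod_eq_zero_iff_dvd, ha,
      hα.mul_right_eq_zero]
  classical
  fin_cases t <;> simp only [weight]
  · rw [← h0 rfl, hr, he]
    split_ifs
    · rw [map_mul, map_mul]
    · simp
  · simp only [h1 rfl, one_mul, hr, hd]
  · rw [← h2 rfl, ha, map_mul]

theorem coWeight_scale {N q : ℕ} (χ : DirichletCharacter ℂ N) {t : ℕ → Fin 3} {p p' : Plucker ℤ}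
    {c : ℕ → ℂ}
    (h : ∀ l ∈ N.primeFactors.erase q, weight χ l (t l) p' = c l * weight χ l (t l) p) :
    coWeight χ t q p' = (∏ l ∈ N.primeFactors.erase q, c l) * coWeight χ t q p := by
  rw [coWeight, coWeight, ← Finset.prod_mul_distrib]
  exact Finset.prod_congr rfl h

theorem isUnit_cast_of_mem_erase {N q l : ℕ} (hq : q.Prime) (hl : l ∈ N.primeFactors.erase q) :
    IsUnit ((q : ℕ) : ZMod l) :=
  (ZMod.isUnit_iff_coprime _ _).2 ((Nat.coprime_primes hq
    (Nat.prime_of_mem_primeFactors (Finset.mem_of_mem_erase hl))).2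
      (Finset.ne_of_mem_erase hl).symm)

/-- Rescaling by powers of q can spoil primitivity only at q, and there one coordinate prime to q
suffices. -/
theorem isPrimitive_of_dvd {p p' : Plucker ℤ} (hp : p.IsPrimitive) {q : ℕ} (hq : q.Prime)
    (he : ¬ (q : ℤ) ∣ p'.e ∨ ¬ (q : ℤ) ∣ p'.m) (ha : p'.a ∣ q ^ 2 * p.a) (hb : p'.b ∣ q ^ 2 * p.b)
    (hm : p'.m ∣ q ^ 2 * p.m) (hn : p'.n ∣ q ^ 2 * p.n) (he' : p'.e ∣ q ^ 2 * p.e) :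
    p'.IsPrimitive := by
  intro d da db dm dn de
  have hcop : IsCoprime d ((q : ℤ) ^ 2) := by
    refine IsCoprime.pow_right ?_
    rw [isCoprime_comm, Prime.coprime_iff_not_dvd (Nat.prime_iff_prime_int.1 hq)]
    exact fun h => he.elim (fun he => he (h.trans de)) fun hm => hm (h.trans dm)
  exact hp d (hcop.dvd_of_dvd_mul_left (da.trans ha)) (hcop.dvd_of_dvd_mul_left (db.trans hb))
    (hcop.dvd_of_dvd_mul_left (dm.trans hm)) (hcop.dvd_of_dvd_mul_left (dn.trans hn))
    (hcop.dvd_of_dvd_mul_left (de.trans he'))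

theorem not_dvd_e_of_rankZero {p : Plucker ℤ} (hp : p ∈ V) {q : ℕ} (hq : q.Prime)
    (h : RankZero q p) : ¬ (q : ℤ) ∣ p.e := fun he =>
  (Nat.prime_iff_prime_int.1 hq).not_isUnit (hp.2 _ h.1 h.2.1 h.2.2.1 h.2.2.2 he)

/-- The product ae = mn - b² is divisible by q², and e is prime to q by primitivity. -/
theorem sq_dvd_a_of_rankZero {p : Plucker ℤ} (hp : p ∈ V) {q : ℕ} (hq : q.Prime)
    (h : RankZero q p) : (q : ℤ) ^ 2 ∣ p.a := by
  obtain ⟨-, ⟨b, hb⟩, ⟨m, hm⟩, ⟨n, hn⟩⟩ := id h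
  have hcop : IsCoprime ((q : ℤ) ^ 2) p.e := by
    refine IsCoprime.pow_left ?_
    rw [Prime.coprime_iff_not_dvd (Nat.prime_iff_prime_int.1 hq)]
    exact not_dvd_e_of_rankZero hp hq h
  refine hcop.dvd_of_dvd_mul_right ⟨m * n - b ^ 2, ?_⟩
  have := hp.1
  rw [Isotropic, hb, hm, hn] at this
  linear_combination -this

/-- The vectors without the factor `q` in the last coordinate. -/
def setT (q : ℕ) : Set (Plucker ℤ) := {p | p ∈ V ∧ ¬ (q : ℤ) ∣ p.e}

/-- The scaling by `diag(q, q, 1, 1)`. -/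
def scaleT (q : ℕ) (p : Plucker ℤ) : Plucker ℤ := ⟨q ^ 2 * p.a, q * p.b, q * p.m, q * p.n, p.e⟩

theorem scaleT_mem {q : ℕ} (hq : q.Prime) {p : Plucker ℤ} (hp : p ∈ setT q) : scaleT q p ∈ V := by
  obtain ⟨⟨h1, h2⟩, h3⟩ := hp
  refine ⟨?_, isPrimitive_of_dvd h2 hq (.inl h3) dvd_rfl ⟨q, ?_⟩ ⟨q, ?_⟩ ⟨q, ?_⟩ ⟨q ^ 2, ?_⟩⟩
  · have : p.m * p.n = _ := h1
    simp only [Isotropic, scaleT]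
    linear_combination q ^ 2 * this
  all_goals simp only [scaleT]; ring

/-- In rank 0 the coordinates b, m, n are divisible by q and a even by q², so the rescaling can be
undone. -/
theorem exists_scaleT {q : ℕ} (hq : q.Prime) {p : Plucker ℤ} (hp : p ∈ V) (h : RankZero q p) :
    ∃ w ∈ setT q, scaleT q w = p := by
  have he := not_dvd_e_of_rankZero hp hq h
  obtain ⟨a, ha⟩ := sq_dvd_a_of_rankZero hp hq h
  obtain ⟨-, ⟨b, hb⟩, ⟨m, hm⟩, ⟨n, hn⟩⟩ := h
  have hq0 : (q : ℤ) ≠ 0 := by exact_mod_cast hq.ne_zero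
  refine ⟨⟨a, b, m, n, p.e⟩, ⟨⟨?_, ?_⟩, he⟩, ?_⟩
  · have := hp.1
    rw [Isotropic, ha, hb, hm, hn] at this
    apply mul_left_cancel₀ (pow_ne_zero 2 hq0)
    simp only
    linear_combination this
  · intro d da db dm dn de
    exact hp.2 d (ha ▸ da.mul_left _) (hb ▸ db.mul_left _) (hm ▸ dm.mul_left _)
      (hn ▸ dn.mul_left _) de
  · simp only [scaleT]
    rw [← ha, ← hb, ← hm, ← hn]

theorem scaleT_injOn {q : ℕ} (hq : q.Prime) : Set.InjOn (scaleT q) (setT q) := by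
  intro p _ p' _ h
  have hq0 : (q : ℤ) ≠ 0 := by exact_mod_cast hq.ne_zero
  simp only [scaleT, Plucker.mk.injEq] at h
  obtain ⟨h1, h2, h3, h4, h5⟩ := h
  ext
  · exact mul_left_cancel₀ (pow_ne_zero 2 hq0) h1
  · exact mul_left_cancel₀ hq0 h2
  · exact mul_left_cancel₀ hq0 h3
  · exact mul_left_cancel₀ hq0 h4
  · exact h5

theorem weight_zero_scaleT {N q : ℕ} (χ : DirichletCharacter ℂ N) (p : Plucker ℤ) :
    weight χ q 0 (scaleT q p) = (starRingEnd ℂ) (part χ q (p.e : ZMod q)) := by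
  have : RankZero q (scaleT q p) :=
    ⟨⟨q * p.a, by simp only [scaleT]; ring⟩, dvd_mul_right _ _, dvd_mul_right _ _,
      dvd_mul_right _ _⟩
  rw [weight, if_pos this]
  rfl

theorem part_sq_apply {q : ℕ} {ψ : DirichletCharacter ℂ q} (h : ψ ^ 2 = 1) {x : ZMod q}
    (hx : IsUnit x) : ψ (x ^ 2) = 1 := by
  obtain ⟨u, rfl⟩ := hx
  rw [map_pow, ← MulChar.pow_apply_coe, h, MulChar.one_apply_coe]

theorem coWeight_scaleT {N q : ℕ} (hq : q.Prime) {χ : DirichletCharacter ℂ N} {t : ℕ → Fin 3}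
    (ht : GoodType χ t) (p : Plucker ℤ) : coWeight χ t q (scaleT q p) = coWeight χ t q p := by
  rw [coWeight_scale χ (p := p) (c := fun _ => 1)]
  · simp
  · intro l hl
    have hu := isUnit_cast_of_mem_erase hq hl
    have hl' := Finset.mem_of_mem_erase hl
    refine weight_scale χ (α := (q : ZMod l) ^ 2) (β := q) (μ := q) (ν := q) (ε := 1) (hu.pow 2) hu
      hu hu ?_ ?_ ?_ ?_ ?_ (fun _ => by simp) (fun _ => rfl)
      (fun h => part_sq_apply ((ht l hl').2 h) hu)
    all_goals simp [scaleT]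

theorem mul_eis (k : ℕ) (c : ℂ) (Φ : Plucker ℤ → ℂ) (τ : UpperHalf) :
    c * eis k Φ τ = eis k (fun p => c * Φ p) τ := by
  rw [eis, eis, mul_left_comm, ← tsum_mul_left]
  simp only [mul_assoc]

theorem equivariant_totalWeight {N : ℕ} (hN : Squarefree N) {χ : DirichletCharacter ℂ N}
    {t : ℕ → Fin 3} (ht : GoodType χ t) : Equivariant χ (totalWeight χ t) :=
  fun _ h p => totalWeight_act hN ht h p

theorem det_blockD_transl (s₁ s₂ s₃ : ℤ) : (blockD (transl s₁ s₂ s₃)).det = 1 := by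
  simp [blockD, transl]

theorem norm_indicator_le {W : Set (Plucker ℤ)} {Φ : Plucker ℤ → ℂ} (hΦ : ∀ p, ‖Φ p‖ ≤ 1)
    (p : Plucker ℤ) : ‖W.indicator Φ p‖ ≤ 1 := by
  by_cases hp : p ∈ W
  · rw [Set.indicator_of_mem hp]; exact hΦ p
  · rw [Set.indicator_of_notMem hp]; simp

theorem rpow_div_two {q : ℕ} (k : ℕ) :
    (((((q : ℝ)⁻¹) ^ 2 : ℝ) ^ ((k : ℝ) / 2) : ℝ) : ℂ) = ((q : ℂ) ^ k)⁻¹ := by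
  have : ((((q : ℝ)⁻¹) ^ 2 : ℝ) ^ ((k : ℝ) / 2) : ℝ) = ((q : ℝ) ^ k)⁻¹ := by
    rw [← Real.rpow_natCast ((q : ℝ)⁻¹) 2, ← Real.rpow_mul (by positivity)]
    have : ((2 : ℕ) : ℝ) * ((k : ℝ) / 2) = (k : ℕ) := by push_cast; ring
    rw [this, Real.rpow_natCast, inv_pow]
  rw [this]
  push_cast
  rfl

/-- The matrix δ⁻¹ carries the rank 0 vector `scaleT q w` back to w. The factor det(δ⁻¹)^(k/2) =
q^(-k) against the normalisation q^(k-3) leaves q^(-3). The condition q ∤ e that defines `setT` may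
be dropped, since χ_q, even when trivial, vanishes at 0 modulo q. -/
theorem heckeT_eis {N k q : ℕ} [NeZero q] (hN : Squarefree N) (hk : 4 ≤ k) (hq : q.Prime)
    (hqN : q ∣ N) {χ : DirichletCharacter ℂ N} {t : ℕ → Fin 3} (ht : GoodType χ t) (h0 : t q = 0) :
    heckeT k χ q (eis k (totalWeight χ t)) = eis k fun p =>
      ((q : ℂ) ^ 3)⁻¹ * (coWeight χ t q p * ∑ i : ZMod q × ZMod q × ZMod q,
        (starRingEnd ℂ) (part χ q (p.e + p.m * i.1 - 2 * p.b * i.2.1 + p.n * i.2.2 +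
          p.a * (i.1 * i.2.2 - i.2.1 ^ 2)))) := by
  have hqm : q ∈ N.primeFactors := Nat.mem_primeFactors.2 ⟨hq, hqN, hN.ne_zero⟩
  have hq0 : (q : ℝ) ≠ 0 := by exact_mod_cast hq.ne_zero
  have hqc : (q : ℂ) ≠ 0 := by exact_mod_cast hq.ne_zero
  have hpos : 0 < (q : ℝ)⁻¹ := by have := hq.pos; positivity
  funext τ
  rw [heckeT, deltaT_eq]
  have hinv := diagonal_quad_inv hq0 hq0 one_ne_zero one_ne_zero
  rw [inv_one] at hinv
  have hsim : ((deltaT q)⁻¹)ᵀ * Matrix.J (Fin 2) ℝ * (deltaT q)⁻¹ =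
      (q : ℝ)⁻¹ • Matrix.J (Fin 2) ℝ := by
    rw [deltaT, hinv.2, Matrix.diagonal_transpose,
      diagonal_quad_similitude (ν := (q : ℝ)⁻¹) (by simp) (by simp)]
  rw [hecke_eis_eq_sum (δ := deltaT q) hinv.1 hpos hsim
    (fun γ η h => det_blockD_eq_of_diagonal one_ne_zero one_ne_zero h)
    (equivariant_totalWeight hN ht) (repT N) repT_injective (repT_surjective hqN) (fun i => by
      simp only [repT, transl_inv, det_blockD_transl])]
  have hterm : ∀ i : ZMod q × ZMod q × ZMod q,
      slash k (eis k (totalWeight χ t)) ((deltaT q)⁻¹ * toReal (repT N i).1) τ =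
        ((q : ℂ) ^ k)⁻¹ * eis k (fun p => (setT q).indicator
          (fun w => totalWeight χ t (scaleT q w)) (act (transl i.1.val i.2.1.val i.2.2.val) p)) τ := by
    intro i
    simp only [repT]
    rw [slash_eis_transfer hpos hsim (fun p hp => hp.1) (fun w hw => scaleT_mem hq hw)
      (scaleT_injOn hq) (s := 1), deltaT, hinv.2, det_diagonal_quad]
    · simp only [mul_one, Complex.ofReal_one, one_pow, inv_one, one_mul]
      rw [← sq, rpow_div_two]
    · intro p hp h
      apply exists_scaleT hq hp
      by_contra hr
      rw [totalWeight_eq_mul hqm, h0] at h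
      simp [weight, hr] at h
    · intro w hw
      rw [deltaT, hinv.2, diagonal_quad_mul_skew (ν := (q : ℝ)⁻¹) (by simp) (by simp), one_smul]
      congr 1
      ext <;> simp [scaleT] <;> field_simp
  rw [Finset.sum_congr rfl fun i _ => hterm i, eis_sum hk _ _ _ (fun i p =>
    norm_indicator_le (fun _ => norm_totalWeight_le _ _ _) _)]
  have hzp : (q : ℂ) ^ ((k : ℤ) - 3) = (q : ℂ) ^ k * ((q : ℂ) ^ 3)⁻¹ := by
    rw [zpow_sub₀ hqc, zpow_natCast, div_eq_mul_inv]
    rfl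
  rw [mul_eis]
  refine congrFun (eis_congr fun p hp => ?_) τ
  rw [← Finset.mul_sum, hzp, mul_comm ((q : ℂ) ^ k), mul_assoc,
    mul_inv_cancel_left₀ (pow_ne_zero k hqc)]
  congr 1
  rw [Finset.mul_sum]
  refine Finset.sum_congr rfl fun i _ => ?_
  have hV : act (transl i.1.val i.2.1.val i.2.2.val) p ∈ V := act_mem_V _ hp
  have he : (((act (transl i.1.val i.2.1.val i.2.2.val) p).e : ℤ) : ZMod q) =
      p.e + p.m * i.1 - 2 * p.b * i.2.1 + p.n * i.2.2 + p.a * (i.1 * i.2.2 - i.2.1 ^ 2) := by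
    rw [act_transl]
    simp
  have hval : totalWeight χ t (scaleT q (act (transl i.1.val i.2.1.val i.2.2.val) p)) =
      coWeight χ t q p * (starRingEnd ℂ) (part χ q (p.e + p.m * i.1 - 2 * p.b * i.2.1 +
        p.n * i.2.2 + p.a * (i.1 * i.2.2 - i.2.1 ^ 2))) := by
    rw [totalWeight_eq_mul hqm, h0, weight_zero_scaleT, coWeight_scaleT hq ht,
      coWeight_act ht (transl_mem N _ _ _) (det_blockD_transl _ _ _), he, mul_comm]
  by_cases hw : act (transl i.1.val i.2.1.val i.2.2.val) p ∈ setT q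
  · rw [Set.indicator_of_mem hw, hval]
  · rw [Set.indicator_of_notMem hw, ← he]
    have hd : (q : ℤ) ∣ (act (transl i.1.val i.2.1.val i.2.2.val) p).e := by
      by_contra hd
      exact hw ⟨hV, hd⟩
    rw [(ZMod.intCast_zmod_eq_zero_iff_dvd _ _).2 hd, MulChar.map_nonunit]
    · simp
    · have : Fact q.Prime := ⟨hq⟩
      simp

/-! ### Character sums over a finite field -/

section CharacterSums

variable {F : Type*} [Field F]

theorem sum_mulChar [Fintype F] (ψ : MulChar F ℂ) [Decidable (ψ = 1)] :
    ∑ x, ψ x = if ψ = 1 then (Fintype.card F : ℂ) - 1 else 0 := by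
  classical
  split_ifs with h
  · subst h
    rw [MulChar.sum_one_eq_card_units, Fintype.card_units, Nat.cast_sub Fintype.card_pos]
    simp
  · exact MulChar.sum_eq_zero_of_ne_one h

theorem sum_mulChar_affine [Fintype F] (ψ : MulChar F ℂ) (c : F) {d : F} (hd : d ≠ 0) :
    ∑ x, ψ (c + d * x) = ∑ x, ψ x :=
  ((Equiv.mulLeft₀ d hd).trans (Equiv.addLeft c)).sum_comp ψ

theorem mulChar_sq_of_ne_zero {ψ : MulChar F ℂ} (h : ψ ^ 2 = 1) {x : F} (hx : x ≠ 0) :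
    ψ (x ^ 2) = 1 := by
  obtain ⟨u, rfl⟩ := hx.isUnit
  rw [map_pow, ← MulChar.pow_apply_coe, h, MulChar.one_apply_coe]

theorem mulChar_inv_of_sq {ψ : MulChar F ℂ} (h : ψ ^ 2 = 1) (x : F) : ψ x⁻¹ = ψ x := by
  by_cases hx : x = 0
  · simp [hx]
  · have : x⁻¹ = x * (x⁻¹) ^ 2 := by field_simp
    rw [this, map_mul, mulChar_sq_of_ne_zero h (inv_ne_zero hx), mul_one]

theorem sum_mulChar_neg_sq [Fintype F] {ψ : MulChar F ℂ} (h : ψ ^ 2 = 1) :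
    ∑ z, ψ (-z ^ 2) = ψ (-1) * ((Fintype.card F : ℂ) - 1) := by
  classical
  have : ∀ z : F, ψ (-z ^ 2) = ψ (-1) * (1 : MulChar F ℂ) z := by
    intro z
    rw [neg_eq_neg_one_mul, map_mul]
    by_cases hz : z = 0
    · rw [hz, zero_pow two_ne_zero, MulChar.map_zero, MulChar.map_zero]
    · rw [mulChar_sq_of_ne_zero h hz, MulChar.one_apply (Ne.isUnit hz)]
  rw [Finset.sum_congr rfl fun z _ => this z, ← Finset.mul_sum, MulChar.sum_one_eq_card_units,
    Fintype.card_units, Nat.cast_sub Fintype.card_pos]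
  simp

theorem sum_fst {F : Type*} [Fintype F] {f : F × F × F → ℂ} : ∑ i, f i = ∑ z, ∑ y, ∑ x, f (x, y, z) := by
  rw [Fintype.sum_prod_type_right, Fintype.sum_prod_type_right]

variable {ψ : MulChar F ℂ} {a b m n e : F}

/-- With a = 0 the polynomial is affine. As m = n = 0 would force b = 0, it depends on the first or
the third variable and takes all values equally often. -/
theorem sum_quadric_rank_one [Fintype F] (h0 : a = 0) (h : m * n = a * e + b ^ 2)
    (hr : ¬ (b = 0 ∧ m = 0 ∧ n = 0)) :
    ∑ i : F × F × F, ψ (e + m * i.1 - 2 * b * i.2.1 + n * i.2.2 + a * (i.1 * i.2.2 - i.2.1 ^ 2)) =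
      (Fintype.card F : ℂ) ^ 2 * ∑ x, ψ x := by
  subst h0
  by_cases hm : m = 0
  · have hn : n ≠ 0 := by
      rintro rfl
      apply hr
      refine ⟨?_, hm, rfl⟩
      rw [hm] at h
      simpa using h.symm
    simp only [Fintype.sum_prod_type]
    have : ∀ x y : F, ∑ z, ψ (e + m * x - 2 * b * y + n * z + 0 * (x * z - y ^ 2)) = ∑ x, ψ x := by
      intro x y
      rw [← sum_mulChar_affine ψ (e + m * x - 2 * b * y) hn]
      simp
    simp only [this, Finset.sum_const, Finset.card_univ, nsmul_eq_mul]
    ring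
  · rw [sum_fst]
    have : ∀ z y : F, ∑ x, ψ (e + m * x - 2 * b * y + n * z + 0 * (x * z - y ^ 2)) = ∑ x, ψ x := by
      intro z y
      rw [← sum_mulChar_affine ψ (e - 2 * b * y + n * z) hm]
      exact Finset.sum_congr rfl fun x _ => congrArg ψ (by ring)
    simp only [this, Finset.sum_const, Finset.card_univ, nsmul_eq_mul]
    ring

/-- Multiplied by a, the polynomial is (m + az)(n + ax) - (b + ay)², so affine substitutions bring
it to (zx - y²)/a. For z ≠ 0 the sum over x is the full sum of ψ; z = 0 leaves the values ψ(-y²/a),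
which are ψ(-1)ψ(a) for y ≠ 0. -/
theorem sum_quadric_rank_two [Fintype F] (hψ : ψ ^ 2 = 1) (ha : a ≠ 0) (h : m * n = a * e + b ^ 2) :
    ∑ i : F × F × F, ψ (e + m * i.1 - 2 * b * i.2.1 + n * i.2.2 + a * (i.1 * i.2.2 - i.2.1 ^ 2)) =
      (Fintype.card F : ℂ) * ((Fintype.card F : ℂ) - 1) * (∑ x, ψ x + ψ (-1) * ψ a) := by
  classical
  rw [sum_fst]
  have key : ∀ z y x : F, e + m * x - 2 * b * y + n * z + a * (x * z - y ^ 2) =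
      a⁻¹ * ((m + a * z) * (n + a * x) - (b + a * y) ^ 2) := by
    intro z y x
    field_simp
    linear_combination -h
  have e1 : ∀ z y : F, ∑ x, ψ (a⁻¹ * ((m + a * z) * (n + a * x) - (b + a * y) ^ 2)) =
      ∑ x, ψ (a⁻¹ * ((m + a * z) * x - (b + a * y) ^ 2)) := fun z y =>
    ((Equiv.mulLeft₀ a ha).trans (Equiv.addLeft n)).sum_comp
      fun x => ψ (a⁻¹ * ((m + a * z) * x - (b + a * y) ^ 2))
  have e2 : ∀ z : F, ∑ y, ∑ x, ψ (a⁻¹ * ((m + a * z) * x - (b + a * y) ^ 2)) =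
      ∑ y, ∑ x, ψ (a⁻¹ * ((m + a * z) * x - y ^ 2)) := fun z =>
    ((Equiv.mulLeft₀ a ha).trans (Equiv.addLeft b)).sum_comp
      fun y => ∑ x, ψ (a⁻¹ * ((m + a * z) * x - y ^ 2))
  have e3 : ∑ z, ∑ y, ∑ x, ψ (a⁻¹ * ((m + a * z) * x - y ^ 2)) =
      ∑ z, ∑ y, ∑ x, ψ (a⁻¹ * (z * x - y ^ 2)) :=
    ((Equiv.mulLeft₀ a ha).trans (Equiv.addLeft m)).sum_comp
      fun z => ∑ y, ∑ x, ψ (a⁻¹ * (z * x - y ^ 2))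
  simp only [key, e1, e2, e3]
  rw [← Finset.add_sum_erase _ _ (Finset.mem_univ (0 : F))]
  have h1 : ∑ y, ∑ x, ψ (a⁻¹ * (0 * x - y ^ 2)) =
      (Fintype.card F : ℂ) * ((Fintype.card F : ℂ) - 1) * (ψ (-1) * ψ a) := by
    have : ∀ y : F, ∑ x : F, ψ (a⁻¹ * (0 * x - y ^ 2)) =
        (Fintype.card F : ℂ) * ψ a * ψ (-y ^ 2) := by
      intro y
      simp only [zero_mul, zero_sub, map_mul, mulChar_inv_of_sq hψ, Finset.sum_const,
        Finset.card_univ, nsmul_eq_mul]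
      ring
    simp only [this]
    rw [← Finset.mul_sum, sum_mulChar_neg_sq hψ]
    ring
  have h2 : ∀ z ∈ Finset.univ.erase (0 : F), ∑ y, ∑ x, ψ (a⁻¹ * (z * x - y ^ 2)) =
      (Fintype.card F : ℂ) * ∑ x, ψ x := by
    intro z hz
    have : ∀ y : F, ∑ x, ψ (a⁻¹ * (z * x - y ^ 2)) = ∑ x, ψ x := by
      intro y
      rw [← sum_mulChar_affine ψ (-a⁻¹ * y ^ 2)
        (mul_ne_zero (inv_ne_zero ha) (Finset.ne_of_mem_erase hz))]
      exact Finset.sum_congr rfl fun x _ => congrArg ψ (by ring)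
    simp only [this, Finset.sum_const, Finset.card_univ, nsmul_eq_mul]
  rw [h1, Finset.sum_congr rfl h2, Finset.sum_const, Finset.card_erase_of_mem (Finset.mem_univ _),
    nsmul_eq_mul, Finset.card_univ, Nat.cast_sub Fintype.card_pos]
  push_cast
  ring

end CharacterSums

theorem conj_eq_self_of_sq {q : ℕ} {ψ : DirichletCharacter ℂ q} (h : ψ ^ 2 = 1) (x : ZMod q) :
    (starRingEnd ℂ) (ψ x) = ψ x := by
  by_cases hx : IsUnit x
  · have h1 := part_sq_apply h hx
    rw [map_pow, sq_eq_one_iff] at h1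
    rcases h1 with h1 | h1 <;> simp [h1]
  · rw [MulChar.map_nonunit _ hx, map_zero]

theorem cast_isotropic {p : Plucker ℤ} (hp : p ∈ V) (q : ℕ) :
    (p.m : ZMod q) * p.n = p.a * p.e + p.b ^ 2 := by
  have := congrArg (Int.cast : ℤ → ZMod q) hp.1
  simpa using this

theorem weight_of_rankZero {N q : ℕ} (hq : q.Prime) (χ : DirichletCharacter ℂ N) {p : Plucker ℤ}
    (h : RankZero q p) : weight χ q 1 p = 0 ∧ weight χ q 2 p = 0 := by
  have : Fact q.Prime := ⟨hq⟩
  refine ⟨by simp [weight, h], ?_⟩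
  rw [weight, (rankZero_iff.1 h).1]
  exact MulChar.map_zero _

/-- The combination of local factors that `T(q)` produces from the one of type `0`. -/
theorem sum_weight_T {N q : ℕ} [NeZero q] (hq : q.Prime) {χ : DirichletCharacter ℂ N}
    (hχ : part χ q ^ 2 = 1) [Decidable (part χ q = 1)] {p : Plucker ℤ} (hp : p ∈ V) :
    ((q : ℂ) ^ 3)⁻¹ * ∑ i : ZMod q × ZMod q × ZMod q,
        (starRingEnd ℂ) (part χ q (p.e + p.m * i.1 - 2 * p.b * i.2.1 + p.n * i.2.2 +
          p.a * (i.1 * i.2.2 - i.2.1 ^ 2))) =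
      weight χ q 0 p + if part χ q = 1 then (1 - (q : ℂ)⁻¹) * (weight χ q 1 p + weight χ q 2 p)
        else part χ q (-1) * (((q : ℂ) - 1) / (q : ℂ) ^ 2) * weight χ q 2 p := by
  have : Fact q.Prime := ⟨hq⟩
  have hqc : (q : ℂ) ≠ 0 := by exact_mod_cast hq.ne_zero
  simp only [conj_eq_self_of_sq hχ]
  by_cases hr : RankZero q p
  · obtain ⟨h1, h2⟩ := weight_of_rankZero hq χ hr
    obtain ⟨ha, hb, hm, hn⟩ := rankZero_iff.1 hr
    rw [h1, h2]
    simp only [ha, hb, hm, hn, weight, if_pos hr, conj_eq_self_of_sq hχ]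
    simp
    field_simp
  · have hw0 : weight χ q 0 p = 0 := by simp [weight, hr]
    by_cases ha : (p.a : ZMod q) = 0
    · have hw1 : weight χ q 1 p = 1 := by
        rw [weight, if_pos ⟨(ZMod.intCast_zmod_eq_zero_iff_dvd _ _).1 ha, hr⟩]
      have hw2 : weight χ q 2 p = 0 := by
        rw [weight, ha]
        exact MulChar.map_zero _
      rw [sum_quadric_rank_one ha (cast_isotropic hp q)
        (fun h => hr (rankZero_iff.2 ⟨ha, h⟩)), sum_mulChar, hw0, hw1, hw2, ZMod.card]
      split_ifs
      · field_simp
        ring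
      · simp
    · have hw1 : weight χ q 1 p = 0 := by
        rw [weight, if_neg]
        exact fun h => ha ((ZMod.intCast_zmod_eq_zero_iff_dvd _ _).2 h.1)
      rw [sum_quadric_rank_two hχ ha (cast_isotropic hp q), sum_mulChar, hw0, hw1, ZMod.card]
      simp only [weight]
      split_ifs with h
      · rw [h, MulChar.one_apply (Ne.isUnit ha), MulChar.one_apply (by simp)]
        field_simp
        ring
      · field_simp
        ring

open scoped Classical in
theorem heckeT_eis_totalWeight {N k q : ℕ} (hN : Squarefree N) (hk : 4 ≤ k) (hq : q.Prime)
    (hqN : q ∣ N) {χ : DirichletCharacter ℂ N} {t : ℕ → Fin 3} (ht : GoodType χ t) (h0 : t q = 0)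
    (hχ : part χ q ^ 2 = 1) :
    heckeT k χ q (eis k (totalWeight χ t)) = eis k fun p => totalWeight χ t p +
      if part χ q = 1 then (1 - (q : ℂ)⁻¹) * (totalWeight χ (Function.update t q 1) p +
        totalWeight χ (Function.update t q 2) p)
      else part χ q (-1) * (((q : ℂ) - 1) / (q : ℂ) ^ 2) *
        totalWeight χ (Function.update t q 2) p := by
  have : NeZero q := ⟨hq.ne_zero⟩
  have hqm : q ∈ N.primeFactors := Nat.mem_primeFactors.2 ⟨hq, hqN, hN.ne_zero⟩
  rw [heckeT_eis hN hk hq hqN ht h0]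
  refine eis_congr fun p hp => ?_
  rw [mul_left_comm, sum_weight_T hq hχ hp]
  simp only [totalWeight_eq_mul hqm, coWeight_update, Function.update_self, h0]
  split_ifs <;> ring

/-- The character ψ is 1 on nonzero squares and -1 at some nonsquare u. If -1 is a nonsquare, then
-u is a square, whence ψ(-1)ψ(u) = 1. -/
theorem quadratic_apply_neg_one {q : ℕ} (hq : q.Prime) {ψ : DirichletCharacter ℂ q}
    (h : ψ ^ 2 = 1) (h1 : ψ ≠ 1) : ψ (-1) = (jacobiSym (-1) q : ℤ) := by
  have : Fact q.Prime := ⟨hq⟩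
  rw [← jacobiSym.legendreSym.to_jacobiSym]
  obtain ⟨u, hu⟩ := (MulChar.ne_one_iff).1 h1
  have hg : ψ (u : ZMod q) = -1 := by
    have h2 := part_sq_apply h u.isUnit
    rw [map_pow, sq_eq_one_iff] at h2
    exact h2.resolve_left hu
  have hns : quadraticChar (ZMod q) u = -1 := by
    rw [quadraticChar_neg_one_iff_not_isSquare]
    rintro ⟨y, hy⟩
    have hy0 : y ≠ 0 := by
      rintro rfl
      exact u.ne_zero (by rw [hy]; simp)
    rw [hy, ← sq, mulChar_sq_of_ne_zero h hy0] at hg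
    norm_num at hg
  rcases quadraticChar_dichotomy (F := ZMod q) (a := -1) (by simp) with h3 | h3
  · obtain ⟨y, hy⟩ := (quadraticChar_one_iff_isSquare (by simp)).1 h3
    have hy0 : y ≠ 0 := by
      rintro rfl
      simp at hy
    rw [legendreSym, Int.cast_neg, Int.cast_one, h3, hy, ← sq, mulChar_sq_of_ne_zero h hy0]
    simp
  · have h4 : quadraticChar (ZMod q) (-u) = 1 := by
      rw [neg_eq_neg_one_mul, map_mul, h3, hns]
      norm_num
    obtain ⟨y, hy⟩ := (quadraticChar_one_iff_isSquare (by simp)).1 h4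
    have hy0 : y ≠ 0 := by
      rintro rfl
      simp at hy
    have h5 : ψ (-1) * ψ u = 1 := by
      rw [← map_mul, neg_one_mul, hy, ← sq, mulChar_sq_of_ne_zero h hy0]
    rw [hg] at h5
    rw [legendreSym, Int.cast_neg, Int.cast_one, h3]
    push_cast
    linear_combination -h5

/-! ### The operator T₁(q²) -/

/-- The matrix `diag(q, 1, q⁻¹, 1)`. -/
def deltaT1 (q : ℕ) : Mat4R := Matrix.diagonal (quad (q : ℝ) 1 (q : ℝ)⁻¹ 1)

/-- The matrix δ⁻¹γδ also contains B₁₀/q and D₁₀/q. As q ∣ N, the symplectic relations modulo q make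
these integral once the three listed conditions hold. -/
theorem mem_heckeStab_deltaT1_iff {N q : ℕ} (hq : q ≠ 0) (hqN : q ∣ N) {γ : Gamma0 N} :
    γ ∈ heckeStab N (deltaT1 q) ↔ (q : ℤ) ∣ γ.1.1 (.inl 0) (.inl 1) ∧
      (q : ℤ) ^ 2 ∣ γ.1.1 (.inl 0) (.inr 0) ∧ (q : ℤ) ∣ γ.1.1 (.inl 0) (.inr 1) := by
  have hq0 : (q : ℝ) ≠ 0 := by exact_mod_cast hq
  constructor
  · intro h
    obtain ⟨c, hc⟩ := apply_of_mem_heckeStab_diagonal h (.inl 0) (.inl 1)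
    obtain ⟨c', hc'⟩ := apply_of_mem_heckeStab_diagonal h (.inl 0) (.inr 0)
    obtain ⟨c'', hc''⟩ := apply_of_mem_heckeStab_diagonal h (.inl 0) (.inr 1)
    simp only [quad, Sum.elim_inl, Sum.elim_inr, Matrix.cons_val_zero, Matrix.cons_val_one,
      mul_one] at hc hc' hc''
    rw [← div_eq_mul_inv, div_eq_iff hq0] at hc'
    refine ⟨⟨c, by exact_mod_cast hc⟩, ⟨c', ?_⟩, ⟨c'', by exact_mod_cast hc''⟩⟩
    have : (γ.1.1 (.inl 0) (.inr 0) : ℝ) = q ^ 2 * c' := by rw [hc']; ring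
    exact_mod_cast this
  · rintro ⟨⟨a, ha⟩, ⟨b, hb⟩, ⟨c, hc⟩⟩
    obtain ⟨A, B, D, hA, hB, hD, a00, a01, a10, a11, b01⟩ := cast_symplectic (Gamma0_mono hqN γ.2)
    have h1 : A 0 1 = 0 := by rw [← hA, ha]; simp
    have h2 : B 0 0 = 0 := by rw [← hB, hb]; simp
    have h3 : B 0 1 = 0 := by rw [← hB, hc]; simp
    have h4 : D 1 0 = 0 := by
      linear_combination D 0 0 * a01 - D 1 0 * a00 + (D 1 0 * D 0 1 - D 0 0 * D 1 1) * h1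
    have h5 : B 1 0 = 0 := by
      linear_combination A 1 1 * b01 - B 1 0 * a11 + (B 1 0 * A 1 0 + A 1 1 * B 1 1) * h4 -
        A 1 1 * D 0 1 * h2 + A 1 1 * D 0 0 * h3
    obtain ⟨d, hd⟩ : (q : ℤ) ∣ γ.1.1 (.inr 1) (.inr 0) := by
      rw [← ZMod.intCast_zmod_eq_zero_iff_dvd, hD, h4]
    obtain ⟨e, he⟩ : (q : ℤ) ∣ γ.1.1 (.inl 1) (.inr 0) := by
      rw [← ZMod.intCast_zmod_eq_zero_iff_dvd, hB, h5]
    have := mem_heckeStab_diagonal (s := (q : ℝ)⁻¹) (x := (q : ℤ) ^ 2) (y := q) (z := 1) (w := q)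
      (ν := (q : ℤ) ^ 2) (γ := γ)
      (η := fromBlocks !![γ.1.1 (.inl 0) (.inl 0), a; q * γ.1.1 (.inl 1) (.inl 0),
          γ.1.1 (.inl 1) (.inl 1)]
        !![b, c; e, γ.1.1 (.inl 1) (.inr 1)]
        !![q ^ 2 * γ.1.1 (.inr 0) (.inl 0), q * γ.1.1 (.inr 0) (.inl 1);
          q * γ.1.1 (.inr 1) (.inl 0), γ.1.1 (.inr 1) (.inl 1)]
        !![γ.1.1 (.inr 0) (.inr 0), q * γ.1.1 (.inr 0) (.inr 1); d, γ.1.1 (.inr 1) (.inr 1)])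
      (by ring) (by ring) (by positivity) ?_ ?_
    · convert this using 2
      rw [deltaT1]
      congr 2 <;> push_cast <;> field_simp
    · intro i j
      rcases i with i | i <;> rcases j with j | j <;> fin_cases i <;> fin_cases j <;>
        simp [quad, ha, hb, hc, hd, he] <;> ring
    · intro i j
      fin_cases i <;> fin_cases j
      · exact (γ.2 0 0).mul_left _
      · exact (γ.2 0 1).mul_left _
      · exact (γ.2 1 0).mul_left _
      · exact γ.2 1 1

theorem levi_inv (A D : Matrix (Fin 2) (Fin 2) ℤ) (h : A * Dᵀ = 1) :
    (levi A D h)⁻¹ = levi Dᵀ Aᵀ (by rw [Matrix.transpose_transpose]; exact mul_eq_one_comm.1 h) := by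
  apply inv_eq_of_mul_eq_one_right
  apply Subtype.ext
  have h' : D * Aᵀ = 1 := by
    rw [← Matrix.transpose_transpose D, ← Matrix.transpose_mul, h, Matrix.transpose_one]
  rw [Submonoid.coe_mul, levi, levi, fromBlocks_multiply]
  simp [h, h']

/-- Representatives of the lines modulo `q`. -/
def shear {q : ℕ} : Option (ZMod q) → Sp2Z
  | some j => levi !![1, -(j.val : ℤ); 0, 1] !![1, 0; (j.val : ℤ), 1] (by
      ext i j; fin_cases i <;> fin_cases j <;> simp [Matrix.mul_apply])
  | none => levi !![0, -1; 1, 0] !![0, -1; 1, 0] (by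
      ext i j; fin_cases i <;> fin_cases j <;> simp [Matrix.mul_apply])

theorem act_shear_some {q : ℕ} (j : ZMod q) (p : Plucker ℤ) : act (shear (some j)) p =
    ⟨p.a, p.b + j.val * p.m, p.m, p.n + 2 * p.b * j.val + p.m * j.val ^ 2, p.e⟩ := by
  rw [shear, act_levi]
  ext <;> simp [Matrix.det_fin_two] <;> ring

theorem act_shear_none {q : ℕ} (p : Plucker ℤ) :
    act (shear (none : Option (ZMod q))) p = ⟨p.a, -p.b, p.n, p.m, p.e⟩ := by
  rw [shear, act_levi]
  ext <;> simp [Matrix.det_fin_two]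

/-- Index set for the representatives for `T₁(q²)`. -/
abbrev IndexT1 (q : ℕ) : Type := Option (ZMod q) × ZMod q × ZMod q × ZMod q

/-- The inverses of the representatives for `T₁(q²)`. -/
def coRepT1 {q : ℕ} (i : IndexT1 q) : Sp2Z :=
  shear i.1 * transl (i.2.2.1.val + q * i.2.2.2.val) i.2.1.val 0

theorem blockC_coRepT1 {q : ℕ} (i : IndexT1 q) : blockC (coRepT1 i) = 0 := by
  rw [coRepT1, blockC_mul]
  obtain ⟨u | u, -⟩ := i <;> simp [shear, levi, transl, blockC]

theorem det_blockD_coRepT1 {q : ℕ} (i : IndexT1 q) : (blockD (coRepT1 i)).det = 1 := by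
  rw [coRepT1, blockD, Submonoid.coe_mul]
  obtain ⟨u | u, -⟩ := i <;>
    simp [shear, levi, transl, fromBlocks_multiply]

theorem coRepT1_mem (N : ℕ) {q : ℕ} (i : IndexT1 q) : coRepT1 i ∈ Gamma0 N :=
  mem_Gamma0_of_blockC_eq_zero N (blockC_coRepT1 i)

/-- Representatives for `T₁(q²)`. -/
def repT1 (N : ℕ) {q : ℕ} (i : IndexT1 q) : Gamma0 N :=
  ⟨(coRepT1 i)⁻¹, (Gamma0 N).inv_mem (coRepT1_mem N i)⟩

theorem eq_of_dvd_shear_inv_mul {q : ℕ} [NeZero q] {u u' : Option (ZMod q)} (hq : q ≠ 1)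
    (h : (q : ℤ) ∣ ((shear u)⁻¹ * shear u').1 (.inl 0) (.inl 1)) : u = u' := by
  have hq1 : ¬ (q : ℤ) ∣ 1 := fun h => hq (Nat.dvd_one.1 (by exact_mod_cast h))
  rcases u with _ | u <;> rcases u' with _ | u' <;>
    simp only [shear, levi_inv, Submonoid.coe_mul] at h <;>
    simp only [levi, fromBlocks_multiply, fromBlocks_apply₁₁] at h
  · rfl
  · simp [Matrix.mul_apply, hq1] at h
  · simp [Matrix.mul_apply, hq1] at h
  · rw [zmod_eq_of_dvd (x := u) (y := u')]
    simpa [Matrix.mul_apply, -ZMod.natCast_val, sub_eq_neg_add] using h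

theorem blockC_shear {q : ℕ} (u : Option (ZMod q)) : blockC (shear u) = 0 := by
  rcases u with _ | u <;> simp [shear, levi, blockC]

theorem transl_mul_mul_transl_apply {M : Sp2Z} (hM : blockC M = 0) (a b c a' b' c' : ℤ) :
    (transl a b c * M * transl a' b' c').1 (.inl 0) (.inl 1) = M.1 (.inl 0) (.inl 1) := by
  have h : ∀ i j, M.1 (.inr i) (.inl j) = 0 := fun i j => congrFun (congrFun hM i) j
  simp [transl, Matrix.mul_apply, h, Matrix.one_apply]

/-- Translations do not affect the entry (0, 1) of the upper left block, so this entry separates the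
lines modulo q. What remains is a difference of translations, read modulo q² and modulo q. -/
theorem repT1_injective {N q : ℕ} [NeZero q] (hq1 : q ≠ 1) (hqN : q ∣ N) (i j : IndexT1 q)
    (h : repT1 N i * (repT1 N j)⁻¹ ∈ heckeStab N (deltaT1 q)) : i = j := by
  have e : (repT1 N i * (repT1 N j)⁻¹).1 = (coRepT1 i)⁻¹ * coRepT1 j := by simp [repT1]
  rw [mem_heckeStab_deltaT1_iff (NeZero.ne q) hqN, e] at h
  obtain ⟨h1, h2, h3⟩ := h
  obtain ⟨u, s, x, y⟩ := i
  obtain ⟨u', s', x', y'⟩ := j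
  have e2 : (coRepT1 (u, s, x, y))⁻¹ * coRepT1 (u', s', x', y') =
      transl (-(x.val + q * y.val)) (-s.val) (-0) * ((shear u)⁻¹ * shear u') *
        transl (x'.val + q * y'.val) s'.val 0 := by
    simp only [coRepT1, ← transl_inv]
    group
  rw [e2] at h1 h2 h3
  have hu : u = u' := by
    refine eq_of_dvd_shear_inv_mul hq1 ?_
    rwa [transl_mul_mul_transl_apply] at h1
    rw [blockC_mul, blockC_inv, blockC_shear, blockC_shear]
    simp
  subst hu
  rw [inv_mul_cancel, mul_one, transl_mul] at h2 h3
  simp only [transl, fromBlocks_apply₁₂, Matrix.of_apply, Matrix.cons_val', Matrix.cons_val_zero,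
    Matrix.cons_val_one, Matrix.cons_val_fin_one] at h2 h3
  have hs : s' = s := zmod_eq_of_dvd (by rwa [sub_eq_neg_add])
  have hx : x' = x := by
    refine zmod_eq_of_dvd ?_
    obtain ⟨c, hc⟩ := h2
    exact ⟨q * c + y.val - y'.val, by linear_combination hc⟩
  subst hx
  have hy : y' = y := by
    refine zmod_eq_of_dvd ?_
    obtain ⟨c, hc⟩ := h2
    refine ⟨c, mul_left_cancel₀ (a := (q : ℤ)) (by exact_mod_cast NeZero.ne q) ?_⟩
    linear_combination hc
  rw [hs, hy]

theorem exists_val_add_mul_val {q : ℕ} [NeZero q] (t : ℤ) :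
    ∃ x y : ZMod q, (q : ℤ) ^ 2 ∣ (x.val + q * y.val) - t := by
  refine ⟨(t : ZMod q), ((t / q : ℤ) : ZMod q), -(t / q / q), ?_⟩
  rw [ZMod.val_intCast, ZMod.val_intCast]
  have h1 := Int.emod_add_mul_ediv t q
  have h2 := Int.emod_add_mul_ediv (t / q) q
  linear_combination h1 + q * h2

theorem exists_shear_apply {q : ℕ} [Fact q.Prime] (γ : Sp2Z) :
    ∃ u : Option (ZMod q), (((γ * shear u).1 (.inl 0) (.inl 1) : ℤ) : ZMod q) = 0 := by
  by_cases h : ((γ.1 (.inl 0) (.inl 0) : ℤ) : ZMod q) = 0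
  · refine ⟨none, ?_⟩
    simp [shear, levi, Matrix.mul_apply, h]
  · refine ⟨some ((γ.1 (.inl 0) (.inl 1) : ℤ) / (γ.1 (.inl 0) (.inl 0) : ℤ)), ?_⟩
    simp [shear, levi, Matrix.mul_apply]
    field_simp
    ring

/-- A shear makes A₀₁ vanish modulo q. Then A₀₀ is a unit modulo q², and a translation clears B₀₁
modulo q and B₀₀ modulo q². -/
theorem repT1_surjective {N q : ℕ} [Fact q.Prime] (hqN : q ∣ N) (γ : Gamma0 N) :
    ∃ i : IndexT1 q, γ * (repT1 N i)⁻¹ ∈ heckeStab N (deltaT1 q) := by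
  obtain ⟨u, hu⟩ := exists_shear_apply (q := q) γ.1
  have hmem : γ.1 * shear u ∈ Gamma0 N :=
    mul_mem γ.2 (mem_Gamma0_of_blockC_eq_zero N (blockC_shear u))
  set γ' : Sp2Z := γ.1 * shear u with hγ'
  obtain ⟨A, B, D, hA, hB, hD, a00, a01, a10, a11, b01⟩ :=
    cast_symplectic (Gamma0_mono hqN hmem)
  rw [hA] at hu
  rw [hu, zero_mul, add_zero] at a00
  have hcop : IsCoprime ((q : ℤ) ^ 2) (γ'.1 (.inl 0) (.inl 0)) := by
    refine IsCoprime.pow_left ?_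
    rw [Prime.coprime_iff_not_dvd (Nat.prime_iff_prime_int.1 (Fact.out : q.Prime)),
      ← ZMod.intCast_zmod_eq_zero_iff_dvd, hA]
    exact left_ne_zero_of_mul_eq_one a00
  obtain ⟨v, w, hvw⟩ := hcop
  -- D₀₀ inverts A₀₀ modulo q, and the Bézout coefficient w inverts it modulo q²; the first
  -- parameter of the translation is therefore taken ≡ -wc modulo q².
  set s : ZMod q := -(D 0 0 * B 0 1) with hs
  set c : ℤ := γ'.1 (.inl 0) (.inl 1) * s.val + γ'.1 (.inl 0) (.inr 0) with hc
  obtain ⟨x, y, ⟨z, hz⟩⟩ := exists_val_add_mul_val (q := q) (-(w * c))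
  refine ⟨(u, s, x, y), (mem_heckeStab_deltaT1_iff (NeZero.ne q) hqN).2 ?_⟩
  have e : (γ * (repT1 N (u, s, x, y))⁻¹).1 = γ' * transl (x.val + q * y.val) s.val 0 := by
    simp [repT1, coRepT1, hγ', mul_assoc]
  rw [e, Submonoid.coe_mul]
  refine ⟨?_, ⟨c * v + γ'.1 (.inl 0) (.inl 0) * z, ?_⟩, ?_⟩
  · rw [← ZMod.intCast_zmod_eq_zero_iff_dvd]
    simp [transl, Matrix.mul_apply, Matrix.one_apply, hA, hu]
  · have : (γ'.1 * (transl (x.val + q * y.val) s.val 0).1) (.inl 0) (.inr 0) =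
        γ'.1 (.inl 0) (.inl 0) * (x.val + q * y.val) + c := by
      simp [transl, Matrix.mul_apply, Matrix.one_apply, hc]
      ring
    rw [this]
    linear_combination γ'.1 (.inl 0) (.inl 0) * hz - c * hvw
  · rw [← ZMod.intCast_zmod_eq_zero_iff_dvd]
    simp [transl, Matrix.mul_apply, Matrix.one_apply, hA, hB, hs]
    linear_combination (-B 0 1) * a00

/-- The vectors that `scaleA q` maps to primitive vectors of rank `0` modulo `q`. -/
def setA (q : ℕ) : Set (Plucker ℤ) :=
  {p | p ∈ V ∧ (q : ℤ) ∣ p.a ∧ (q : ℤ) ∣ p.b ∧ ¬ (q : ℤ) ∣ p.m ∧ (q : ℤ) ^ 2 ∣ p.n ∧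
    (q : ℤ) ∣ p.e ∧ ¬ (q : ℤ) ^ 2 ∣ p.e}

/-- The scaling by `diag(q, 1, q⁻¹, 1)`. -/
def scaleA (q : ℕ) (p : Plucker ℤ) : Plucker ℤ := ⟨q * p.a, p.b, q * p.m, p.n / q, p.e / q⟩

theorem setA_cases {q : ℕ} (hq : q.Prime) {p : Plucker ℤ} (hp : p ∈ setA q) :
    ∃ n e : ℤ, p.n = q * n ∧ p.e = q * e ∧ scaleA q p = ⟨q * p.a, p.b, q * p.m, n, e⟩ ∧
      (q : ℤ) ∣ n ∧ ¬ (q : ℤ) ∣ e := by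
  have hq0 : (q : ℤ) ≠ 0 := by exact_mod_cast hq.ne_zero
  obtain ⟨-, -, -, -, ⟨n, hn⟩, ⟨e, he⟩, he'⟩ := hp
  refine ⟨q * n, e, by rw [hn]; ring, he, ?_, dvd_mul_right _ _, fun ⟨c, hc⟩ => he' ⟨c, ?_⟩⟩
  · rw [scaleA, hn, he, sq, mul_assoc, Int.mul_ediv_cancel_left _ hq0,
      Int.mul_ediv_cancel_left _ hq0]
  · rw [he, hc]; ring

theorem scaleA_mem {q : ℕ} (hq : q.Prime) {p : Plucker ℤ} (hp : p ∈ setA q) : scaleA q p ∈ V := by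
  obtain ⟨n, e, hn, he, hs, -, h⟩ := setA_cases hq hp
  obtain ⟨⟨h1, h2⟩, -⟩ := hp
  rw [hs]
  refine ⟨?_, isPrimitive_of_dvd h2 hq (.inl h) ⟨q, ?_⟩ ⟨q ^ 2, ?_⟩ ⟨q, ?_⟩ ⟨q ^ 3, ?_⟩ ⟨q ^ 3, ?_⟩⟩
  · have : p.m * p.n = _ := h1
    rw [hn, he] at this
    simp only [Isotropic]
    linear_combination this
  · simp only; ring
  · simp only; ring
  · simp only; ring
  · rw [hn]; ring
  · rw [he]; ring

/-- The matrix δ⁻¹ = diag(q⁻¹, 1, q, 1) sends a rank 0 vector to (a/q, b, m/q, qn, qe). This is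
integral, and all its coordinates except possibly m/q are divisible by q. So it is primitive exactly
if q² ∤ m; otherwise a factor q has to be removed, which is the case of `exists_scaleB`. -/
theorem exists_scaleA {q : ℕ} (hq : q.Prime) {p : Plucker ℤ} (hp : p ∈ V) (h : RankZero q p)
    (h2 : ¬ (q : ℤ) ^ 2 ∣ p.m) : ∃ w ∈ setA q, scaleA q w = p := by
  have he := not_dvd_e_of_rankZero hp hq h
  have hq0 : (q : ℤ) ≠ 0 := by exact_mod_cast hq.ne_zero
  obtain ⟨a, ha⟩ := sq_dvd_a_of_rankZero hp hq h
  obtain ⟨-, hb, ⟨m, hm⟩, hn⟩ := h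
  have hm' : ¬ (q : ℤ) ∣ m := fun ⟨c, hc⟩ => h2 ⟨c, by rw [hm, hc]; ring⟩
  refine ⟨⟨q * a, p.b, m, q * p.n, q * p.e⟩, ⟨⟨?_, ?_⟩, dvd_mul_right _ _, hb, hm', ?_,
    dvd_mul_right _ _, ?_⟩, ?_⟩
  · have := hp.1
    rw [Isotropic, ha, hm] at this
    simp only [Isotropic]
    linear_combination this
  · refine isPrimitive_of_dvd hp.2 hq (.inr hm') ⟨q ^ 3, ?_⟩ ⟨q ^ 2, ?_⟩ ⟨q ^ 3, ?_⟩ ⟨q, ?_⟩ ⟨q, ?_⟩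
    · rw [ha]; simp only; ring
    · simp only; ring
    · rw [hm]; simp only; ring
    · simp only; ring
    · simp only; ring
  · rw [sq]; exact mul_dvd_mul_left _ hn
  · rw [sq]; exact fun h => he ((mul_dvd_mul_iff_left hq0).1 h)
  · rw [scaleA, Int.mul_ediv_cancel_left _ hq0, Int.mul_ediv_cancel_left _ hq0]
    ext
    · rw [ha]; simp only; ring
    · rfl
    · exact hm.symm
    · rfl
    · rfl

theorem scaleA_injOn {q : ℕ} (hq : q.Prime) : Set.InjOn (scaleA q) (setA q) := by
  intro p hp p' hp' h
  have hq0 : (q : ℤ) ≠ 0 := by exact_mod_cast hq.ne_zero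
  obtain ⟨n, e, hn, he, hs, -⟩ := setA_cases hq hp
  obtain ⟨n', e', hn', he', hs', -⟩ := setA_cases hq hp'
  rw [hs, hs'] at h
  simp only [Plucker.mk.injEq] at h
  obtain ⟨h1, h2, h3, h4, h5⟩ := h
  ext
  · exact mul_left_cancel₀ hq0 h1
  · exact h2
  · exact mul_left_cancel₀ hq0 h3
  · rw [hn, hn', h4]
  · rw [he, he', h5]

/-- The vectors that `scaleB q` maps to primitive vectors of rank `0` modulo `q`. -/
def setB (q : ℕ) : Set (Plucker ℤ) := {p | p ∈ V ∧ (q : ℤ) ∣ p.n ∧ ¬ (q : ℤ) ∣ p.e}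

/-- The scaling by `q · diag(q, 1, q⁻¹, 1)`. -/
def scaleB (q : ℕ) (p : Plucker ℤ) : Plucker ℤ := ⟨q ^ 2 * p.a, q * p.b, q ^ 2 * p.m, p.n, p.e⟩

theorem scaleB_mem {q : ℕ} (hq : q.Prime) {p : Plucker ℤ} (hp : p ∈ setB q) : scaleB q p ∈ V := by
  obtain ⟨⟨h1, h2⟩, -, h3⟩ := hp
  refine ⟨?_, isPrimitive_of_dvd h2 hq (.inl h3) dvd_rfl ⟨q, ?_⟩ dvd_rfl ⟨q ^ 2, ?_⟩ ⟨q ^ 2, ?_⟩⟩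
  · have : p.m * p.n = _ := h1
    simp only [Isotropic, scaleB]
    linear_combination q ^ 2 * this
  all_goals simp only [scaleB]; ring

theorem exists_scaleB {q : ℕ} (hq : q.Prime) {p : Plucker ℤ} (hp : p ∈ V) (h : RankZero q p)
    (h2 : (q : ℤ) ^ 2 ∣ p.m) : ∃ w ∈ setB q, scaleB q w = p := by
  have he := not_dvd_e_of_rankZero hp hq h
  have hq0 : (q : ℤ) ≠ 0 := by exact_mod_cast hq.ne_zero
  obtain ⟨a, ha⟩ := sq_dvd_a_of_rankZero hp hq h
  obtain ⟨m, hm⟩ := h2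
  obtain ⟨-, ⟨b, hb⟩, -, hn⟩ := h
  refine ⟨⟨a, b, m, p.n, p.e⟩, ⟨⟨?_, ?_⟩, hn, he⟩, ?_⟩
  · have := hp.1
    rw [Isotropic, ha, hb, hm] at this
    apply mul_left_cancel₀ (pow_ne_zero 2 hq0)
    simp only
    linear_combination this
  · intro d da db dm dn de
    exact hp.2 d (ha ▸ da.mul_left _) (hb ▸ db.mul_left _) (hm ▸ dm.mul_left _) dn de
  · simp only [scaleB]
    rw [← ha, ← hb, ← hm]

theorem scaleB_injOn {q : ℕ} (hq : q.Prime) : Set.InjOn (scaleB q) (setB q) := by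
  intro p _ p' _ h
  have hq0 : (q : ℤ) ≠ 0 := by exact_mod_cast hq.ne_zero
  simp only [scaleB, Plucker.mk.injEq] at h
  obtain ⟨h1, h2, h3, h4, h5⟩ := h
  ext
  · exact mul_left_cancel₀ (pow_ne_zero 2 hq0) h1
  · exact mul_left_cancel₀ hq0 h2
  · exact mul_left_cancel₀ (pow_ne_zero 2 hq0) h3
  · exact h4
  · exact h5

theorem weight_zero_of_part_eq_one {N q : ℕ} (hq : q.Prime) {χ : DirichletCharacter ℂ N}
    (hχ : part χ q = 1) {p : Plucker ℤ} (h : RankZero q p) (he : ¬ (q : ℤ) ∣ p.e) :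
    weight χ q 0 p = 1 := by
  have : Fact q.Prime := ⟨hq⟩
  rw [weight, if_pos h, hχ, MulChar.one_apply, map_one]
  exact Ne.isUnit fun h => he ((ZMod.intCast_zmod_eq_zero_iff_dvd _ _).1 h)

theorem weight_zero_scaleA {N q : ℕ} (hq : q.Prime) {χ : DirichletCharacter ℂ N}
    (hχ : part χ q = 1) {p : Plucker ℤ} (hp : p ∈ setA q) : weight χ q 0 (scaleA q p) = 1 := by
  obtain ⟨n, e, hn, he, hs, h1, h2⟩ := setA_cases hq hp
  rw [hs]
  exact weight_zero_of_part_eq_one hq hχ ⟨dvd_mul_right _ _, hp.2.2.1, dvd_mul_right _ _, h1⟩ h2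

theorem weight_zero_scaleB {N q : ℕ} (hq : q.Prime) {χ : DirichletCharacter ℂ N}
    (hχ : part χ q = 1) {p : Plucker ℤ} (hp : p ∈ setB q) : weight χ q 0 (scaleB q p) = 1 :=
  weight_zero_of_part_eq_one hq hχ ⟨(dvd_pow_self _ two_ne_zero).mul_right _, dvd_mul_right _ _,
    (dvd_pow_self _ two_ne_zero).mul_right _, hp.2.1⟩ hp.2.2

theorem primeFactors_div {N q : ℕ} (hN : Squarefree N) (hq : q.Prime) (hqN : q ∣ N) :
    (N / q).primeFactors = N.primeFactors.erase q := by
  have h := coprime_div hN hqN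
  have hNq : N / q ≠ 0 := (Nat.div_pos (Nat.le_of_dvd (Nat.pos_of_ne_zero hN.ne_zero) hqN)
    hq.pos).ne'
  ext l
  simp only [Nat.mem_primeFactors, Finset.mem_erase]
  constructor
  · rintro ⟨h1, h2, -⟩
    refine ⟨?_, h1, h2.trans (Nat.div_dvd_of_dvd hqN), hN.ne_zero⟩
    rintro rfl
    exact Nat.not_coprime_of_dvd_of_dvd h1.one_lt dvd_rfl h2 h
  · rintro ⟨h1, h2, h3, -⟩
    exact ⟨h2, dvd_div_of_ne h2 hq h3 hqN h1, hNq⟩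

theorem coVal_eq_prod {N q : ℕ} (hN : Squarefree N) (hq : q.Prime) (hqN : q ∣ N)
    (χ : DirichletCharacter ℂ N) :
    coVal χ q = ∏ l ∈ N.primeFactors.erase q, part χ l (q : ZMod l) := by
  rw [coVal, ← primeFactors_div hN hq hqN]
  have := part_eq_prod hN (Nat.div_dvd_of_dvd hqN) χ (q : ℤ)
  simpa using this

theorem norm_coVal {N q : ℕ} (hN : Squarefree N) (hqN : q ∣ N)
    (χ : DirichletCharacter ℂ N) : ‖coVal χ q‖ = 1 := by
  have : IsUnit ((q : ℕ) : ZMod (N / q)) := (ZMod.isUnit_iff_coprime _ _).2 (coprime_div hN hqN)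
  obtain ⟨u, hu⟩ := this
  rw [coVal, ← hu]
  exact DirichletCharacter.unit_norm_eq_one _ u

/-- Away from q, the coordinate a is multiplied and e is divided by q. So types 0 and 2 at l both
give χ_l(q), type 1 gives 1 = χ_l(q), and the product is χ_{N/q}(q). -/
theorem coWeight_scaleA {N q : ℕ} (hN : Squarefree N) (hq : q.Prime) (hqN : q ∣ N)
    {χ : DirichletCharacter ℂ N} {t : ℕ → Fin 3} (ht : GoodType χ t) {p : Plucker ℤ}
    (hp : p ∈ setA q) : coWeight χ t q (scaleA q p) = coVal χ q * coWeight χ t q p := by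
  obtain ⟨n, e, hn, he, hs, -⟩ := setA_cases hq hp
  rw [coVal_eq_prod hN hq hqN, hs]
  refine coWeight_scale χ fun l hl => ?_
  have hu := isUnit_cast_of_mem_erase hq hl
  have hl' := Finset.mem_of_mem_erase hl
  obtain ⟨v, hv⟩ := hu
  have hinv : ((v⁻¹ : (ZMod l)ˣ) : ZMod l) * v = 1 := by simp
  refine weight_scale χ (α := q) (β := 1) (μ := q) (ν := ((v⁻¹ : (ZMod l)ˣ) : ZMod l))
    (ε := ((v⁻¹ : (ZMod l)ˣ) : ZMod l)) ⟨v, hv⟩ isUnit_one ⟨v, hv⟩ (Units.isUnit _) (by simp)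
    (by simp) (by simp) ?_ ?_ ?_ ?_ ?_
  · rw [hn]; push_cast; rw [← hv, ← mul_assoc, hinv, one_mul]
  · rw [he]; push_cast; rw [← hv, ← mul_assoc, hinv, one_mul]
  · intro _
    rw [← hv]
    exact (conj_eq_of_mul_eq_one _ (by simp)).symm
  · intro h
    rw [(ht l hl').1 h, ← hv, MulChar.one_apply_coe]
  · intro _; rfl

/-- Here e is unchanged and a changes by the square q², which the quadratic characters of type 2 do
not see. -/
theorem coWeight_scaleB {N q : ℕ} (hq : q.Prime) {χ : DirichletCharacter ℂ N} {t : ℕ → Fin 3}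
    (ht : GoodType χ t) (p : Plucker ℤ) : coWeight χ t q (scaleB q p) = coWeight χ t q p := by
  rw [coWeight_scale χ (p := p) (c := fun _ => 1)]
  · simp
  · intro l hl
    have hu := isUnit_cast_of_mem_erase hq hl
    have hl' := Finset.mem_of_mem_erase hl
    refine weight_scale χ (α := (q : ZMod l) ^ 2) (β := q) (μ := (q : ZMod l) ^ 2) (ν := 1) (ε := 1)
      (hu.pow 2) hu (hu.pow 2) isUnit_one ?_ ?_ ?_ ?_ ?_ (fun _ => by simp) (fun _ => rfl)
      (fun h => part_sq_apply ((ht l hl').2 h) hu)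
    all_goals simp [scaleB]

theorem slash_add (k : ℕ) (f g : UpperHalf → ℂ) (M : Mat4R) (τ : UpperHalf) :
    slash k (f + g) M τ = slash k f M τ + slash k g M τ := by
  simp only [slash]
  split_ifs
  · exact mul_add _ _ _
  · simp

theorem eis_add {k : ℕ} (hk : 4 ≤ k) {Φ Ψ : Plucker ℤ → ℂ} (hΦ : ∀ p, ‖Φ p‖ ≤ 1)
    (hΨ : ∀ p, ‖Ψ p‖ ≤ 1) : eis k (fun p => Φ p + Ψ p) = eis k Φ + eis k Ψ := by
  funext τ
  simp only [Pi.add_apply, eis, add_mul]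
  rw [(summable_lin τ hk hΦ).tsum_add (summable_lin τ hk hΨ), mul_add]

theorem deltaT1_eq (q : ℕ) : fromBlocks (Matrix.diagonal ![(q : ℝ), 1]) 0 0
    (Matrix.diagonal ![(q : ℝ)⁻¹, 1]) = deltaT1 q := by
  rw [deltaT1, diagonal_quad]

/-- The rank 0 vectors are split according to q² ∣ m. On the `setB` half the transformed vector is q
times a primitive one, which gives q^(-k). After normalisation the other half carries q^k, the
source of the term χ_{N/q}(q) q^k in T₁(q²). -/
theorem slash_deltaT1_eis {N k q : ℕ} (hN : Squarefree N) (hk : 4 ≤ k) (hq : q.Prime)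
    (hqN : q ∣ N) {χ : DirichletCharacter ℂ N} {t : ℕ → Fin 3} (h0 : t q = 0)
    (ρ : Sp2Z) (τ : UpperHalf) :
    slash k (eis k (totalWeight χ t)) ((deltaT1 q)⁻¹ * toReal ρ⁻¹) τ =
      eis k (fun p => (setA q).indicator (fun w => totalWeight χ t (scaleA q w)) (act ρ p)) τ +
      ((q : ℂ) ^ k)⁻¹ *
        eis k (fun p => (setB q).indicator (fun w => totalWeight χ t (scaleB q w)) (act ρ p)) τ := by
  have hqm : q ∈ N.primeFactors := Nat.mem_primeFactors.2 ⟨hq, hqN, hN.ne_zero⟩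
  have hq0 : (q : ℝ) ≠ 0 := by exact_mod_cast hq.ne_zero
  have hinv := diagonal_quad_inv hq0 one_ne_zero (inv_ne_zero hq0) one_ne_zero
  rw [inv_one, inv_inv] at hinv
  have hν : (q : ℝ)⁻¹ * q = 1 := inv_mul_cancel₀ hq0
  have hsim : ((deltaT1 q)⁻¹)ᵀ * Matrix.J (Fin 2) ℝ * (deltaT1 q)⁻¹ =
      (1 : ℝ) • Matrix.J (Fin 2) ℝ := by
    rw [deltaT1, hinv.2, Matrix.diagonal_transpose, diagonal_quad_similitude hν (by simp)]
  have hdet : ((deltaT1 q)⁻¹).det = 1 := by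
    rw [deltaT1, hinv.2, det_diagonal_quad]
    simpa using hν
  have hrank : ∀ p, totalWeight χ t p ≠ 0 → RankZero q p := by
    intro p h
    by_contra hr
    rw [totalWeight_eq_mul hqm, h0] at h
    simp [weight, hr] at h
  set P : Set (Plucker ℤ) := {p | (q : ℤ) ^ 2 ∣ p.m} with hP
  have hsplit : eis k (totalWeight χ t) =
      eis k (Pᶜ.indicator (totalWeight χ t)) + eis k (P.indicator (totalWeight χ t)) := by
    rw [← eis_add hk (norm_indicator_le fun _ => norm_totalWeight_le _ _ _)
      (norm_indicator_le fun _ => norm_totalWeight_le _ _ _)]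
    congr 1
    funext p
    exact (congrFun (Set.indicator_compl_add_self P (totalWeight χ t)) p).symm
  rw [hsplit, slash_add]
  congr 1
  · rw [slash_eis_transfer one_pos hsim (fun p hp => hp.1) (fun w hw => scaleA_mem hq hw)
      (scaleA_injOn hq) (s := 1), hdet]
    · simp only [Real.one_rpow, Complex.ofReal_one, one_pow, inv_one, one_mul]
      congr 1
      funext p
      by_cases hp : act ρ p ∈ setA q
      · rw [Set.indicator_of_mem hp, Set.indicator_of_mem hp, Set.indicator_of_mem]
        intro h
        rw [hP, Set.mem_ofPred_eq, scaleA, sq] at h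
        exact hp.2.2.2.1 ((mul_dvd_mul_iff_left (by exact_mod_cast hq.ne_zero)).1 h)
      · rw [Set.indicator_of_notMem hp, Set.indicator_of_notMem hp]
    · intro p hp h
      have hp' : p ∈ Pᶜ := Set.mem_of_indicator_ne_zero h
      rw [Set.indicator_of_mem hp'] at h
      exact exists_scaleA hq hp (hrank p h) hp'
    · intro w hw
      obtain ⟨n, e, hn, he, hs, -⟩ := setA_cases hq hw
      rw [deltaT1, hinv.2, diagonal_quad_mul_skew hν (by simp), one_smul, hs]
      congr 1
      ext <;> simp [hn, he] <;> field_simp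
  · rw [slash_eis_transfer one_pos hsim (fun p hp => hp.1) (fun w hw => scaleB_mem hq hw)
      (scaleB_injOn hq) (s := q), hdet]
    · simp only [Real.one_rpow, Complex.ofReal_one, one_mul, Complex.ofReal_natCast]
      congr 2
      funext p
      by_cases hp : act ρ p ∈ setB q
      · rw [Set.indicator_of_mem hp, Set.indicator_of_mem hp, Set.indicator_of_mem]
        exact dvd_mul_right _ _
      · rw [Set.indicator_of_notMem hp, Set.indicator_of_notMem hp]
    · intro p hp h
      have hp' : p ∈ P := Set.mem_of_indicator_ne_zero h
      rw [Set.indicator_of_mem hp'] at h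
      exact exists_scaleB hq hp (hrank p h) hp'
    · intro w hw
      rw [deltaT1, hinv.2, diagonal_quad_mul_skew hν (by simp)]
      have : (q : ℝ) • skew w.toR = skew (R := ℝ)
          ⟨q * w.a, q * w.b, q * w.m, q * w.n, q * w.e⟩ := by
        ext i j
        rcases i with i | i <;> rcases j with j | j <;> fin_cases i <;> fin_cases j <;>
          simp [skew]
      rw [this]
      congr 1
      ext <;> simp [scaleB] <;> field_simp

theorem det_blockD_coRepT1_inv {q : ℕ} (i : IndexT1 q) : (blockD (coRepT1 i)⁻¹).det = 1 := by
  rw [blockD_inv, coRepT1, Submonoid.coe_mul]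
  obtain ⟨u | u, -⟩ := i <;>
    simp [shear, levi, transl, fromBlocks_multiply]

/-- As χ_q = 1, the factor at q is an indicator function. It remains to count the representatives
that move p into `setA` and into `setB`. -/
theorem heckeT1_eis {N k q : ℕ} [NeZero q] (hN : Squarefree N) (hk : 4 ≤ k) (hq : q.Prime)
    (hqN : q ∣ N) {χ : DirichletCharacter ℂ N} {t : ℕ → Fin 3} (ht : GoodType χ t) (h0 : t q = 0)
    (hχ : part χ q = 1) :
    heckeT1 k χ q (eis k (totalWeight χ t)) = eis k fun p =>
      coWeight χ t q p * (coVal χ q * (q : ℂ) ^ k * ((q : ℂ) ^ 3)⁻¹ *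
          ∑ i : IndexT1 q, (setA q).indicator (fun _ => (1 : ℂ)) (act (coRepT1 i) p) +
        ((q : ℂ) ^ 3)⁻¹ *
          ∑ i : IndexT1 q, (setB q).indicator (fun _ => (1 : ℂ)) (act (coRepT1 i) p)) := by
  have : Fact q.Prime := ⟨hq⟩
  have hqm : q ∈ N.primeFactors := Nat.mem_primeFactors.2 ⟨hq, hqN, hN.ne_zero⟩
  have hq0 : (q : ℝ) ≠ 0 := by exact_mod_cast hq.ne_zero
  have hqc : (q : ℂ) ≠ 0 := by exact_mod_cast hq.ne_zero
  funext τ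
  rw [heckeT1, deltaT1_eq]
  have hinv := diagonal_quad_inv hq0 one_ne_zero (inv_ne_zero hq0) one_ne_zero
  rw [inv_one, inv_inv] at hinv
  have hν : (q : ℝ)⁻¹ * q = 1 := inv_mul_cancel₀ hq0
  have hsim : ((deltaT1 q)⁻¹)ᵀ * Matrix.J (Fin 2) ℝ * (deltaT1 q)⁻¹ =
      (1 : ℝ) • Matrix.J (Fin 2) ℝ := by
    rw [deltaT1, hinv.2, Matrix.diagonal_transpose, diagonal_quad_similitude hν (by simp)]
  rw [hecke_eis_eq_sum (δ := deltaT1 q) hinv.1 one_pos hsim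
    (fun γ η h => det_blockD_eq_of_diagonal (inv_ne_zero hq0) one_ne_zero h)
    (equivariant_totalWeight hN ht) (repT1 N) (repT1_injective hq.ne_one hqN)
    (repT1_surjective hqN) det_blockD_coRepT1_inv]
  simp only [repT1, slash_deltaT1_eis hN hk hq hqN h0]
  have hzp : (q : ℂ) ^ ((k : ℤ) - 3) = (q : ℂ) ^ k * ((q : ℂ) ^ 3)⁻¹ := by
    rw [zpow_sub₀ hqc, zpow_natCast, div_eq_mul_inv]
    rfl
  have hsum := eis_sum hk Finset.univ
    (Sum.elim (fun _ : IndexT1 q => (1 : ℂ)) (fun _ : IndexT1 q => ((q : ℂ) ^ k)⁻¹))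
    (Sum.elim (fun i p => (setA q).indicator (fun w => totalWeight χ t (scaleA q w))
        (act (coRepT1 i) p))
      (fun i p => (setB q).indicator (fun w => totalWeight χ t (scaleB q w))
        (act (coRepT1 i) p))) (by
      rintro (i | i) p <;> exact norm_indicator_le (fun _ => norm_totalWeight_le _ _ _) _) τ
  simp only [Fintype.sum_sum_type, Sum.elim_inl, Sum.elim_inr, one_mul] at hsum
  rw [Finset.sum_add_distrib, hsum, mul_eis, hzp]
  refine congrFun (eis_congr fun p hp => ?_) τ
  have hA : ∀ i : IndexT1 q, (setA q).indicator (fun w => totalWeight χ t (scaleA q w))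
      (act (coRepT1 i) p) = coVal χ q * coWeight χ t q p *
        (setA q).indicator (fun _ => (1 : ℂ)) (act (coRepT1 i) p) := by
    intro i
    by_cases hi : act (coRepT1 i) p ∈ setA q
    · rw [Set.indicator_of_mem hi, Set.indicator_of_mem hi, totalWeight_eq_mul hqm, h0,
        weight_zero_scaleA hq hχ hi, coWeight_scaleA hN hq hqN ht hi,
        coWeight_act ht (coRepT1_mem N i) (det_blockD_coRepT1 i), one_mul, mul_one]
    · rw [Set.indicator_of_notMem hi, Set.indicator_of_notMem hi, mul_zero]
  have hB : ∀ i : IndexT1 q, (setB q).indicator (fun w => totalWeight χ t (scaleB q w))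
      (act (coRepT1 i) p) = coWeight χ t q p *
        (setB q).indicator (fun _ => (1 : ℂ)) (act (coRepT1 i) p) := by
    intro i
    by_cases hi : act (coRepT1 i) p ∈ setB q
    · rw [Set.indicator_of_mem hi, Set.indicator_of_mem hi, totalWeight_eq_mul hqm, h0,
        weight_zero_scaleB hq hχ hi, coWeight_scaleB hq ht,
        coWeight_act ht (coRepT1_mem N i) (det_blockD_coRepT1 i), one_mul, mul_one]
    · rw [Set.indicator_of_notMem hi, Set.indicator_of_notMem hi, mul_zero]
  simp only [hA, hB, ← Finset.mul_sum]
  field_simp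

/-! ### Local counts for T₁(q²) -/

section

section FieldCounts

variable {F : Type*} [Field F] [Fintype F] [DecidableEq F]

theorem sum_ite_affine_eq {c m : F} (hm : m ≠ 0) (f : F → ℂ) :
    ∑ x, (if c + m * x = 0 then f x else 0) = f (-c / m) := by
  have h : ∀ x, c + m * x = 0 ↔ x = -c / m := by
    intro x
    rw [eq_div_iff hm]
    constructor <;> intro h <;> linear_combination h
  simp [h]

theorem sum_ite_affine_ne {c m : F} (hm : m ≠ 0) :
    ∑ x, (if c + m * x ≠ 0 then (1 : ℂ) else 0) = (Fintype.card F : ℂ) - 1 := by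
  have h : ∀ x, (if c + m * x ≠ 0 then (1 : ℂ) else 0) = 1 - if c + m * x = 0 then 1 else 0 := by
    intro x
    split_ifs with h1 h2 <;> simp_all
  simp only [h, Finset.sum_sub_distrib, sum_ite_affine_eq hm (fun _ => 1)]
  simp

/-- For a ≠ 0 the first condition fixes x = -n/a, where the second expression becomes -(b + as)²/a,
nonzero for all s but one. For a = n = 0 the relation gives b = 0, and e + mx ≠ 0 is all that
remains. -/
theorem sum_ite_quadric {a b m n e : F} (h : m * n = a * e + b ^ 2) (h0 : a = 0 → b = 0 → m = 0 →
    n = 0 → e ≠ 0) :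
    ∑ s, ∑ x, (if n + a * x = 0 ∧ e + m * x - 2 * b * s - a * s ^ 2 ≠ 0 then (1 : ℂ) else 0) =
      if a = 0 then
        if n = 0 then
          if m = 0 then (Fintype.card F : ℂ) ^ 2
          else (Fintype.card F : ℂ) * ((Fintype.card F : ℂ) - 1)
        else 0
      else (Fintype.card F : ℂ) - 1 := by
  split_ifs with ha hn hm
  · subst ha hn hm
    have hb : b = 0 := by simpa using h.symm
    have he := h0 rfl hb rfl rfl
    simp [hb, he]
    ring
  · subst ha hn
    have hb : b = 0 := by simpa using h.symm
    subst hb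
    have : ∀ s : F, ∑ x, (if (0 : F) + 0 * x = 0 ∧ e + m * x - 2 * 0 * s - 0 * s ^ 2 ≠ 0
        then (1 : ℂ) else 0) = (Fintype.card F : ℂ) - 1 := by
      intro s
      rw [← sum_ite_affine_ne (c := e) hm]
      simp
    simp only [this, Finset.sum_const, Finset.card_univ, nsmul_eq_mul]
  · subst ha
    simp [hn]
  · have : ∀ s : F, ∑ x, (if n + a * x = 0 ∧ e + m * x - 2 * b * s - a * s ^ 2 ≠ 0
        then (1 : ℂ) else 0) = if b + a * s ≠ 0 then 1 else 0 := by
      intro s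
      simp only [ite_and]
      rw [sum_ite_affine_eq ha]
      have key : e + m * (-n / a) - 2 * b * s - a * s ^ 2 = -((b + a * s) ^ 2 / a) := by
        field_simp
        linear_combination -h
      rw [key]
      simp [ha]
    simp only [this]
    exact sum_ite_affine_ne ha

end FieldCounts

variable {q : ℕ}

theorem indicator_setB_act_transl [Fact q.Prime] {p : Plucker ℤ} (hp : p ∈ V) (s x y : ZMod q) :
    (setB q).indicator (fun _ => (1 : ℂ)) (act (transl (x.val + q * y.val) s.val 0) p) =
      if (p.n : ZMod q) + p.a * x = 0 ∧ (p.e : ZMod q) + p.m * x - 2 * p.b * s - p.a * s ^ 2 ≠ 0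
        then 1 else 0 := by
  classical
  rw [Set.indicator_apply]
  congr 1
  have hV : act (transl (x.val + q * y.val) s.val 0) p ∈ V := act_mem_V _ hp
  simp only [setB, Set.mem_ofPred_eq, hV, true_and, ← ZMod.intCast_zmod_eq_zero_iff_dvd]
  rw [act_transl]
  simp [sub_eq_add_neg]

/-- The second digit y matters modulo q² only, which `setB` does not see; it contributes a factor q.
-/
theorem sum_indicator_setB [Fact q.Prime] {p : Plucker ℤ} (hp : p ∈ V) :
    ∑ i : ZMod q × ZMod q × ZMod q, (setB q).indicator (fun _ => (1 : ℂ))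
      (act (transl (i.2.1.val + q * i.2.2.val) i.1.val 0) p) =
      if (p.a : ZMod q) = 0 then
        if (p.n : ZMod q) = 0 then
          if (p.m : ZMod q) = 0 then (q : ℂ) ^ 3 else (q : ℂ) ^ 2 * ((q : ℂ) - 1)
        else 0
      else q * ((q : ℂ) - 1) := by
  have h1 : ∀ s x : ZMod q, ∑ y : ZMod q, (setB q).indicator (fun _ => (1 : ℂ))
      (act (transl (x.val + q * y.val) s.val 0) p) = q * if (p.n : ZMod q) + p.a * x = 0 ∧
        (p.e : ZMod q) + p.m * x - 2 * p.b * s - p.a * s ^ 2 ≠ 0 then 1 else 0 := fun s x => by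
    rw [Finset.sum_congr rfl fun y _ => indicator_setB_act_transl hp s x y, Finset.sum_const,
      Finset.card_univ, ZMod.card, nsmul_eq_mul]
  simp only [Fintype.sum_prod_type, h1]
  simp only [← Finset.mul_sum]
  rw [sum_ite_quadric (cast_isotropic hp q), ZMod.card]
  · split_ifs <;> ring
  · intro ha hb hm hn he
    simp only [ZMod.intCast_zmod_eq_zero_iff_dvd] at ha hb hm hn he
    exact not_dvd_e_of_rankZero hp Fact.out ⟨ha, hb, hm, hn⟩ he

/-- Once a vanishes modulo q, the translation changes only e modulo q. The condition that q² divides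
n is automatic: in mn = ae + b² the right side is divisible by q², and m is prime to q. -/
theorem act_transl_mem_setA_iff [Fact q.Prime] {p : Plucker ℤ} (hp : p ∈ V) (s x y : ZMod q) :
    act (transl (x.val + q * y.val) s.val 0) p ∈ setA q ↔
      ((p.a : ZMod q) = 0 ∧ (p.n : ZMod q) = 0 ∧ (p.m : ZMod q) ≠ 0) ∧
      (q : ℤ) ∣ (act (transl (x.val + q * y.val) s.val 0) p).e ∧
      ¬ (q : ℤ) ^ 2 ∣ (act (transl (x.val + q * y.val) s.val 0) p).e := by
  have hV : act (transl (x.val + q * y.val) s.val 0) p ∈ V := act_mem_V _ hp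
  have hiso := cast_isotropic hp q
  have hpr := Nat.prime_iff_prime_int.1 (Fact.out : q.Prime)
  constructor
  · rintro ⟨-, ha, hb, hm, -, he, he'⟩
    rw [act_transl] at ha hb hm
    simp only [mul_zero, add_zero] at hm
    rw [← ZMod.intCast_zmod_eq_zero_iff_dvd] at ha hb hm
    simp only at ha
    simp [ha] at hb
    refine ⟨⟨ha, ?_, hm⟩, he, he'⟩
    rw [ha, hb] at hiso
    simpa [hm] using hiso
  · rintro ⟨⟨ha, hn, hm⟩, he, he'⟩
    have hb : (p.b : ZMod q) = 0 := by simpa [ha, hn] using hiso.symm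
    rw [ZMod.intCast_zmod_eq_zero_iff_dvd] at ha hn hb
    rw [Ne, ZMod.intCast_zmod_eq_zero_iff_dvd] at hm
    have ha' : (q : ℤ) ∣ (act (transl (x.val + q * y.val) s.val 0) p).a := by
      rwa [act_transl]
    have hb' : (q : ℤ) ∣ (act (transl (x.val + q * y.val) s.val 0) p).b := by
      rw [act_transl]
      exact dvd_add hb (ha.mul_right _)
    have hm' : ¬ (q : ℤ) ∣ (act (transl (x.val + q * y.val) s.val 0) p).m := by
      rw [act_transl]
      simpa using hm
    refine ⟨hV, ha', hb', hm', ?_, he, he'⟩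
    have hcop : IsCoprime ((q : ℤ) ^ 2) (act (transl (x.val + q * y.val) s.val 0) p).m :=
      IsCoprime.pow_left ((Prime.coprime_iff_not_dvd hpr).2 hm')
    refine hcop.dvd_of_dvd_mul_left ?_
    rw [hV.1, sq, sq]
    exact dvd_add (mul_dvd_mul ha' he) (mul_dvd_mul hb' hb')

/-- The translated e has the form c(s) + mx + qmy with m prime to q. For each s exactly one x makes
it divisible by q, and then q - 1 values of y keep q² from dividing it. -/
theorem sum_indicator_setA [Fact q.Prime] {p : Plucker ℤ} (hp : p ∈ V) :
    ∑ i : ZMod q × ZMod q × ZMod q, (setA q).indicator (fun _ => (1 : ℂ))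
      (act (transl (i.2.1.val + q * i.2.2.val) i.1.val 0) p) =
      if (p.a : ZMod q) = 0 ∧ (p.n : ZMod q) = 0 ∧ (p.m : ZMod q) ≠ 0 then (q : ℂ) * ((q : ℂ) - 1)
      else 0 := by
  classical
  have hq0 : (q : ℤ) ≠ 0 := by exact_mod_cast NeZero.ne q
  simp only [Set.indicator_apply, act_transl_mem_setA_iff hp, Fintype.sum_prod_type]
  split_ifs with hc
  · have hs : ∀ s : ZMod q, ∑ x : ZMod q, ∑ y : ZMod q,
        (if (q : ℤ) ∣ (act (transl (x.val + q * y.val) s.val 0) p).e ∧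
          ¬ (q : ℤ) ^ 2 ∣ (act (transl (x.val + q * y.val) s.val 0) p).e then (1 : ℂ) else 0) =
        (q : ℂ) - 1 := by
      intro s
      have hE : ∀ x y : ZMod q, (act (transl (x.val + q * y.val) s.val 0) p).e =
          (p.e + p.m * x.val - 2 * p.b * s.val - p.a * s.val ^ 2) + q * (p.m * y.val) := by
        intro x y
        rw [act_transl]
        simp only
        ring
      have hx : ∀ x : ZMod q, ∑ y : ZMod q,
          (if (q : ℤ) ∣ (act (transl (x.val + q * y.val) s.val 0) p).e ∧
            ¬ (q : ℤ) ^ 2 ∣ (act (transl (x.val + q * y.val) s.val 0) p).e then (1 : ℂ) else 0) =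
          if ((p.e : ZMod q) - 2 * p.b * s - p.a * s ^ 2) + p.m * x = 0 then (q : ℂ) - 1 else 0 := by
        intro x
        have hiff : ((p.e : ZMod q) - 2 * p.b * s - p.a * s ^ 2) + p.m * x = 0 ↔
            (q : ℤ) ∣ p.e + p.m * x.val - 2 * p.b * s.val - p.a * s.val ^ 2 := by
          rw [← ZMod.intCast_zmod_eq_zero_iff_dvd]
          push_cast
          simp only [ZMod.natCast_val, ZMod.cast_id', id_eq]
          constructor <;> intro h <;> linear_combination h
        simp only [hiff]
        split_ifs with h
        · obtain ⟨c, hc'⟩ := h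
          have := sum_ite_affine_ne (c := (c : ZMod q)) hc.2.2
          rw [ZMod.card] at this
          rw [← this]
          refine Finset.sum_congr rfl fun y _ => ?_
          refine if_congr ?_ rfl rfl
          rw [hE, hc', ← mul_add, sq, mul_dvd_mul_iff_left hq0,
            ← ZMod.intCast_zmod_eq_zero_iff_dvd (c + p.m * y.val)]
          simp
        · refine Finset.sum_eq_zero fun y _ => if_neg fun h' => h ?_
          rw [hE] at h'
          exact (dvd_add_left (dvd_mul_right _ _)).1 h'.1
      rw [Finset.sum_congr rfl fun x _ => hx x, sum_ite_affine_eq hc.2.2 (fun _ => (q : ℂ) - 1)]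
    simp only [hc, ne_eq, not_false_eq_true, and_self, true_and]
    rw [Finset.sum_congr rfl fun s _ => hs s, Finset.sum_const, Finset.card_univ, ZMod.card,
      nsmul_eq_mul]
  · simp [hc]

theorem shear_a (u : Option (ZMod q)) (p : Plucker ℤ) : (act (shear u) p).a = p.a := by
  rcases u with _ | u
  · rw [act_shear_none]
  · rw [act_shear_some]

theorem rankZero_shear_iff (u : Option (ZMod q)) (p : Plucker ℤ) :
    RankZero q (act (shear u) p) ↔ RankZero q p :=
  rankZero_act_iff (γ := shear u) (fun i j => by rw [blockC_shear u]; exact dvd_zero _) p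

/-- Modulo q, the binary quadratic form with matrix (m b; b n) has rank 1, so it is a nonzero
multiple of the square of a linear form. The sheared n is its value on a line, and exactly one of
the q + 1 lines is a zero. -/
theorem sum_shear [Fact q.Prime] {p : Plucker ℤ} (hp : p ∈ V) (ha : (p.a : ZMod q) = 0)
    (hr : ¬ RankZero q p) (c : ℂ) :
    ∑ u : Option (ZMod q), (if ((act (shear u) p).n : ZMod q) = 0 then c else 0) = c := by
  have hiso := cast_isotropic hp q
  rw [ha, zero_mul, zero_add] at hiso
  rw [Fintype.sum_option]
  simp only [act_shear_none, act_shear_some]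
  by_cases hm : (p.m : ZMod q) = 0
  · have hb : (p.b : ZMod q) = 0 := by simpa [hm] using hiso.symm
    have hn : (p.n : ZMod q) ≠ 0 := fun hn => hr (rankZero_iff.2 ⟨ha, hb, hm, hn⟩)
    simp [hm, hb, hn]
  · rw [if_neg hm, zero_add]
    have : ∀ j : ZMod q, (((p.n + 2 * p.b * j.val + p.m * j.val ^ 2 : ℤ) : ZMod q) = 0 ↔
        (p.b : ZMod q) + p.m * j = 0) := by
      intro j
      push_cast
      simp only [ZMod.natCast_val, ZMod.cast_id', id_eq]
      have h : (p.m : ZMod q) * (p.n + 2 * p.b * j + p.m * j ^ 2) = (p.b + p.m * j) ^ 2 := by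
        linear_combination hiso
      rw [← sq_eq_zero_iff (a := (p.b : ZMod q) + p.m * j), ← h, mul_eq_zero, or_iff_right hm]
    simp only [this]
    exact sum_ite_affine_eq hm fun _ => c

theorem sum_coRepT1 [Fact q.Prime] (f : Plucker ℤ → ℂ) (p : Plucker ℤ) :
    ∑ i : IndexT1 q, f (act (coRepT1 i) p) = ∑ u : Option (ZMod q),
      ∑ i : ZMod q × ZMod q × ZMod q,
        f (act (transl (i.2.1.val + q * i.2.2.val) i.1.val 0) (act (shear u) p)) := by
  rw [Fintype.sum_prod_type]
  simp only [coRepT1, act_mul]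

/-- The combination of local factors that `T₁(q²)` produces from the one of type `0`. -/
theorem sum_weight_T1 {N : ℕ} [Fact q.Prime] {χ : DirichletCharacter ℂ N} (hχ : part χ q = 1)
    {p : Plucker ℤ} (hp : p ∈ V) :
    ∑ i : IndexT1 q, (setA q).indicator (fun _ => (1 : ℂ)) (act (coRepT1 i) p) =
      q * ((q : ℂ) - 1) * weight χ q 1 p ∧
    ∑ i : IndexT1 q, (setB q).indicator (fun _ => (1 : ℂ)) (act (coRepT1 i) p) =
      (q : ℂ) ^ 3 * ((q : ℂ) + 1) * weight χ q 0 p + (q : ℂ) ^ 2 * ((q : ℂ) - 1) * weight χ q 1 p +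
        q * ((q : ℂ) ^ 2 - 1) * weight χ q 2 p := by
  have hq : q.Prime := Fact.out
  rw [sum_coRepT1, sum_coRepT1]
  simp only [sum_indicator_setA (act_mem_V _ hp), sum_indicator_setB (act_mem_V _ hp), shear_a]
  by_cases hr : RankZero q p
  · obtain ⟨h1, h2⟩ := weight_of_rankZero hq χ hr
    rw [h1, h2, weight_zero_of_part_eq_one hq hχ hr (not_dvd_e_of_rankZero hp hq hr)]
    have h3 : ∀ u : Option (ZMod q), _ := fun u => rankZero_iff.1 ((rankZero_shear_iff u p).2 hr)
    have h4 := (rankZero_iff.1 hr).1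
    constructor
    · simp [h4, fun u => (h3 u).2.2.1]
    · simp only [h4, fun u => (h3 u).2.2.1, fun u => (h3 u).2.2.2, if_true, Finset.sum_const,
        Finset.card_univ, Fintype.card_option, ZMod.card, nsmul_eq_mul]
      push_cast
      ring
  · have hw0 : weight χ q 0 p = 0 := by simp [weight, hr]
    by_cases ha : (p.a : ZMod q) = 0
    · have hw1 : weight χ q 1 p = 1 := by
        rw [weight, if_pos ⟨(ZMod.intCast_zmod_eq_zero_iff_dvd _ _).1 ha, hr⟩]
      have hw2 : weight χ q 2 p = 0 := by
        rw [weight, ha]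
        exact MulChar.map_zero _
      have hm : ∀ u : Option (ZMod q), ((act (shear u) p).n : ZMod q) = 0 →
          ((act (shear u) p).m : ZMod q) ≠ 0 := by
        intro u hn hm
        have hiso := cast_isotropic (act_mem_V (shear u) hp) q
        rw [shear_a, ha, hn, hm] at hiso
        refine hr ((rankZero_shear_iff u p).1 (rankZero_iff.2 ⟨by rw [shear_a, ha], ?_, hm, hn⟩))
        simpa using hiso.symm
      rw [hw0, hw1, hw2]
      constructor
      · rw [mul_one]
        refine Eq.trans ?_ (sum_shear hp ha hr ((q : ℂ) * ((q : ℂ) - 1)))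
        refine Finset.sum_congr rfl fun u _ => if_congr ?_ rfl rfl
        exact ⟨fun h => h.2.1, fun h => ⟨ha, h, hm u h⟩⟩
      · rw [mul_one, mul_zero, mul_zero, zero_add, add_zero]
        refine Eq.trans ?_ (sum_shear hp ha hr ((q : ℂ) ^ 2 * ((q : ℂ) - 1)))
        refine Finset.sum_congr rfl fun u _ => ?_
        rw [if_pos ha]
        refine ite_congr rfl (fun h => if_neg (hm u h)) fun _ => rfl
    · have hw1 : weight χ q 1 p = 0 := by
        rw [weight, if_neg]
        exact fun h => ha ((ZMod.intCast_zmod_eq_zero_iff_dvd _ _).2 h.1)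
      have hw2 : weight χ q 2 p = 1 := by
        rw [weight, hχ, MulChar.one_apply (Ne.isUnit ha)]
      rw [hw0, hw1, hw2]
      constructor
      · simp [ha]
      · simp only [ha, if_false, Finset.sum_const, Finset.card_univ, Fintype.card_option, ZMod.card,
          nsmul_eq_mul]
        push_cast
        ring

theorem heckeT1_eis_totalWeight {N k : ℕ} (hN : Squarefree N) (hk : 4 ≤ k) (hq : q.Prime)
    (hqN : q ∣ N) {χ : DirichletCharacter ℂ N} {t : ℕ → Fin 3} (ht : GoodType χ t) (h0 : t q = 0)
    (hχ : part χ q = 1) :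
    heckeT1 k χ q (eis k (totalWeight χ t)) = eis k fun p => ((q : ℂ) + 1) * totalWeight χ t p +
      (((q : ℂ) - 1) * (coVal χ q * (q : ℂ) ^ k + q) / (q : ℂ) ^ 2) *
        totalWeight χ (Function.update t q 1) p +
      (((q : ℂ) ^ 2 - 1) / (q : ℂ) ^ 2) * totalWeight χ (Function.update t q 2) p := by
  have : Fact q.Prime := ⟨hq⟩
  have hqc : (q : ℂ) ≠ 0 := by exact_mod_cast hq.ne_zero
  have hqm : q ∈ N.primeFactors := Nat.mem_primeFactors.2 ⟨hq, hqN, hN.ne_zero⟩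
  rw [heckeT1_eis hN hk hq hqN ht h0 hχ]
  refine eis_congr fun p hp => ?_
  rw [(sum_weight_T1 hχ hp).1, (sum_weight_T1 hχ hp).2]
  simp only [totalWeight_eq_mul hqm, coWeight_update, Function.update_self, h0]
  field_simp
  ring

end

/-! ### Solving for S₁(q) and S₂(q), and their products -/

section

theorem eis_combination {k : ℕ} (hk : 4 ≤ k) {Φ : Fin 3 → Plucker ℤ → ℂ}
    (hΦ : ∀ i p, ‖Φ i p‖ ≤ 1) (c : Fin 3 → ℂ) :
    eis k (fun p => c 0 * Φ 0 p + c 1 * Φ 1 p + c 2 * Φ 2 p) =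
      c 0 • eis k (Φ 0) + c 1 • eis k (Φ 1) + c 2 • eis k (Φ 2) := by
  funext τ
  have := eis_sum hk Finset.univ c Φ hΦ τ
  simp only [Fin.sum_univ_three] at this
  simp [this]

variable {N k q : ℕ} {χ : DirichletCharacter ℂ N} {t : ℕ → Fin 3}

/-- Since N is square-free, q is prime to N/q, so χ_{N/q}(q) has absolute value 1, whereas q^k > 1.
-/
theorem coVal_mul_pow_ne_one (hN : Squarefree N) (hk : k ≠ 0) (hq : q.Prime) (hqN : q ∣ N) :
    coVal χ q * (q : ℂ) ^ k - 1 ≠ 0 := by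
  intro h
  have h1 := congrArg norm (sub_eq_zero.1 h)
  rw [norm_mul, norm_coVal hN hqN, one_mul, norm_pow, norm_one, Complex.norm_natCast] at h1
  have : (1 : ℝ) < (q : ℝ) ^ k := one_lt_pow₀ (by exact_mod_cast hq.one_lt) hk
  linarith

theorem heckeT_eq_combination (hN : Squarefree N) (hk : 4 ≤ k) (hq : q.Prime) (hqN : q ∣ N)
    (ht : GoodType χ t) (h0 : t q = 0) (hχ : part χ q = 1) :
    heckeT k χ q (eis k (totalWeight χ t)) = eis k (totalWeight χ t) +
      (1 - (q : ℂ)⁻¹) • eis k (totalWeight χ (Function.update t q 1)) +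
      (1 - (q : ℂ)⁻¹) • eis k (totalWeight χ (Function.update t q 2)) := by
  have := eis_combination hk (Φ := ![totalWeight χ t, totalWeight χ (Function.update t q 1),
    totalWeight χ (Function.update t q 2)])
    (by intro i; fin_cases i <;> exact norm_totalWeight_le _ _)
    ![1, 1 - (q : ℂ)⁻¹, 1 - (q : ℂ)⁻¹]
  simp only [Matrix.cons_val_zero, Matrix.cons_val_one, Matrix.cons_val, one_smul] at this
  rw [heckeT_eis_totalWeight hN hk hq hqN ht h0 (by rw [hχ, one_pow]), ← this]
  refine eis_congr fun p _ => ?_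
  rw [if_pos hχ]
  ring

theorem heckeT1_eq_combination (hN : Squarefree N) (hk : 4 ≤ k) (hq : q.Prime) (hqN : q ∣ N)
    (ht : GoodType χ t) (h0 : t q = 0) (hχ : part χ q = 1) :
    heckeT1 k χ q (eis k (totalWeight χ t)) = ((q : ℂ) + 1) • eis k (totalWeight χ t) +
      (((q : ℂ) - 1) * (coVal χ q * (q : ℂ) ^ k + q) / (q : ℂ) ^ 2) •
        eis k (totalWeight χ (Function.update t q 1)) +
      (((q : ℂ) ^ 2 - 1) / (q : ℂ) ^ 2) • eis k (totalWeight χ (Function.update t q 2)) := by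
  have := eis_combination hk (Φ := ![totalWeight χ t, totalWeight χ (Function.update t q 1),
    totalWeight χ (Function.update t q 2)])
    (by intro i; fin_cases i <;> exact norm_totalWeight_le _ _)
    ![(q : ℂ) + 1, ((q : ℂ) - 1) * (coVal χ q * (q : ℂ) ^ k + q) / (q : ℂ) ^ 2,
      ((q : ℂ) ^ 2 - 1) / (q : ℂ) ^ 2]
  simp only [Matrix.cons_val_zero, Matrix.cons_val_one, Matrix.cons_val] at this
  rw [heckeT1_eis_totalWeight hN hk hq hqN ht h0 hχ, ← this]

theorem heckeT_eq_combination_of_ne_one (hN : Squarefree N) (hk : 4 ≤ k) (hq : q.Prime)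
    (hqN : q ∣ N) (ht : GoodType χ t) (h0 : t q = 0) (hχ : part χ q ^ 2 = 1)
    (hχ1 : part χ q ≠ 1) :
    heckeT k χ q (eis k (totalWeight χ t)) = eis k (totalWeight χ t) +
      (part χ q (-1) * (((q : ℂ) - 1) / (q : ℂ) ^ 2)) •
        eis k (totalWeight χ (Function.update t q 2)) := by
  have := eis_combination hk (Φ := ![totalWeight χ t, totalWeight χ (Function.update t q 2),
    totalWeight χ (Function.update t q 2)])
    (by intro i; fin_cases i <;> exact norm_totalWeight_le _ _)
    ![1, part χ q (-1) * (((q : ℂ) - 1) / (q : ℂ) ^ 2), 0]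
  simp only [Matrix.cons_val_zero, Matrix.cons_val_one, Matrix.cons_val, one_smul, zero_smul,
    add_zero] at this
  rw [heckeT_eis_totalWeight hN hk hq hqN ht h0 hχ, ← this]
  refine eis_congr fun p _ => ?_
  rw [if_neg hχ1]
  ring

/-- Subtracting (1 + 1/q) T(q) from T₁(q²) cancels the type 2 component, and the multiple (q² - 1)/q
of the identity cancels type 0. Type 1 is left with coefficient (q - 1)(χ_{N/q}(q) q^k - 1)/q² =
1/c(q). -/
theorem S1Prime_eis (hN : Squarefree N) (hk : 4 ≤ k) (hq : q.Prime) (hqN : q ∣ N)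
    (ht : GoodType χ t) (h0 : t q = 0) (hχ : part χ q = 1) :
    S1Prime k χ q (eis k (totalWeight χ t)) = eis k (totalWeight χ (Function.update t q 1)) := by
  have hqc : (q : ℂ) ≠ 0 := by exact_mod_cast hq.ne_zero
  have hq1 : (q : ℂ) - 1 ≠ 0 := sub_ne_zero.2 (by exact_mod_cast hq.ne_one)
  have hX := coVal_mul_pow_ne_one (χ := χ) hN (by omega : k ≠ 0) hq hqN
  rw [S1Prime, heckeT_eq_combination hN hk hq hqN ht h0 hχ,
    heckeT1_eq_combination hN hk hq hqN ht h0 hχ, cConst]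
  funext τ
  simp only [Pi.smul_apply, Pi.sub_apply, Pi.add_apply, smul_eq_mul]
  field_simp
  ring

/-- If χ_q = 1, the multiple of T(q) is chosen to cancel type 1: with X = χ_{N/q}(q) q^k, one has (1
- 1/q)(X/q + 1) = (q - 1)(X + q)/q². If χ_q is nontrivial, type 1 does not occur, and χ_q(-1) is the
Legendre symbol. -/
theorem S2Prime_eis (hN : Squarefree N) (hk : 4 ≤ k) (hq : q.Prime) (hqN : q ∣ N)
    (ht : GoodType χ t) (h0 : t q = 0) (hχ : part χ q ^ 2 = 1) :
    S2Prime k χ q (eis k (totalWeight χ t)) = eis k (totalWeight χ (Function.update t q 2)) := by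
  have hqc : (q : ℂ) ≠ 0 := by exact_mod_cast hq.ne_zero
  have hq1 : (q : ℂ) - 1 ≠ 0 := sub_ne_zero.2 (by exact_mod_cast hq.ne_one)
  have hX := coVal_mul_pow_ne_one (χ := χ) hN (by omega : k ≠ 0) hq hqN
  rw [S2Prime]
  split_ifs with h1
  · have e1 : (q : ℂ) ^ ((k : ℤ) - 1) = (q : ℂ) ^ k / q := by
      rw [zpow_sub₀ hqc, zpow_natCast, zpow_one]
    have e2 : (q : ℂ) ^ ((k : ℤ) - 2) = (q : ℂ) ^ k / (q : ℂ) ^ 2 := by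
      rw [zpow_sub₀ hqc, zpow_natCast]
      rfl
    rw [heckeT_eq_combination hN hk hq hqN ht h0 h1,
      heckeT1_eq_combination hN hk hq hqN ht h0 h1, cConst, e1, e2]
    funext τ
    simp only [Pi.smul_apply, Pi.sub_apply, Pi.add_apply, smul_eq_mul]
    field_simp
    ring
  · have hsq : (((jacobiSym (-1) q : ℤ) : ℂ)) * ((jacobiSym (-1) q : ℤ) : ℂ) = 1 := by
      rw [← quadratic_apply_neg_one hq hχ h1, ← map_mul]
      simp
    rw [heckeT_eq_combination_of_ne_one hN hk hq hqN ht h0 hχ h1,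
      quadratic_apply_neg_one hq hχ h1]
    funext τ
    simp only [Pi.smul_apply, Pi.sub_apply, Pi.add_apply, smul_eq_mul]
    field_simp
    linear_combination ((q : ℂ) - 1) * eis k (totalWeight χ (Function.update t q 2)) τ * hsq

theorem GoodType.update (ht : GoodType χ t) {j : Fin 3} (h1 : j = 1 → part χ q = 1)
    (h2 : j = 2 → part χ q ^ 2 = 1) : GoodType χ (Function.update t q j) := by
  intro l hl
  by_cases h : l = q
  · subst h
    rw [Function.update_self]
    exact ⟨h1, h2⟩
  · rw [Function.update_of_ne h]
    exact ht l hl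

/-- As the primes of the list are distinct, each operator meets type 0 at its own prime, the only
case in which its action is known. -/
theorem applyList_eis {S : ℕ → (UpperHalf → ℂ) → (UpperHalf → ℂ)} {j : Fin 3} {l : List ℕ}
    (hS : ∀ q ∈ l, ∀ t : ℕ → Fin 3, GoodType χ t → t q = 0 → S q (eis k (totalWeight χ t)) =
      eis k (totalWeight χ (Function.update t q j)) ∧ GoodType χ (Function.update t q j))
    (hl : l.Nodup) (ht : GoodType χ t) (h0 : ∀ q ∈ l, t q = 0) :
    applyList S l (eis k (totalWeight χ t)) =
        eis k (totalWeight χ (fun q => if q ∈ l then j else t q)) ∧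
      GoodType χ (fun q => if q ∈ l then j else t q) := by
  induction l generalizing t with
  | nil => simpa [applyList] using ht
  | cons a l ih =>
    obtain ⟨ha, hl'⟩ := List.nodup_cons.1 hl
    obtain ⟨h1, h2⟩ := hS a List.mem_cons_self t ht (h0 a List.mem_cons_self)
    have h3 : ∀ q ∈ l, Function.update t a j q = 0 := by
      intro q hq
      rw [Function.update_of_ne (fun h : q = a => ha (h ▸ hq))]
      exact h0 q (List.mem_cons_of_mem _ hq)
    have h4 := ih (fun q hq => hS q (List.mem_cons_of_mem _ hq)) hl' h2 h3
    have h5 : (fun q => if q ∈ l then j else Function.update t a j q) =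
        fun q => if q ∈ a :: l then j else t q := by
      funext q
      by_cases hq : q = a
      · subst hq
        simp
      · simp [hq]
    rw [h5] at h4
    refine ⟨?_, h4.2⟩
    rw [← h4.1, ← h1]
    rfl

theorem totalWeight_congr {t' : ℕ → Fin 3} (h : ∀ q ∈ N.primeFactors, t q = t' q) :
    totalWeight χ t = totalWeight χ t' := by
  funext p
  exact Finset.prod_congr rfl fun q hq => by rw [h q hq]

end

/-- The series at (N, 1, 1) has type 0 everywhere. The final type function depends only on which
primes occur in the two lists, so their order plays no role. -/
theorem eisRho_eq_applyList {N k : ℕ} (hN : Squarefree N) (hk : 4 ≤ k)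
    {χ : DirichletCharacter ℂ N} (hχ : χ (-1) = (-1) ^ k) {N₀ N₁ N₂ : ℕ} (h : N₀ * N₁ * N₂ = N)
    (h1 : part χ N₁ = 1) (h2 : part χ N₂ ^ 2 = 1) {l₁ l₂ : List ℕ}
    (hl₁ : l₁.Perm N₁.primeFactorsList) (hl₂ : l₂.Perm N₂.primeFactorsList) :
    eisRho k χ N₀ N₁ N₂ =
      applyList (S2Prime k χ) l₂ (applyList (S1Prime k χ) l₁ (eisRho k χ N 1 1)) := by
  have hN1 : N₁ ∣ N := ⟨N₀ * N₂, by rw [← h]; ring⟩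
  have hN2 : N₂ ∣ N := ⟨N₀ * N₁, by rw [← h]; ring⟩
  have hs1 := hN.squarefree_of_dvd hN1
  have hs2 := hN.squarefree_of_dvd hN2
  have hone : part χ 1 = 1 := DirichletCharacter.level_one _
  have mem1 : ∀ q, q ∈ l₁ ↔ q.Prime ∧ q ∣ N₁ := fun q => by
    rw [hl₁.mem_iff, Nat.mem_primeFactorsList hs1.ne_zero]
  have mem2 : ∀ q, q ∈ l₂ ↔ q.Prime ∧ q ∣ N₂ := fun q => by
    rw [hl₂.mem_iff, Nat.mem_primeFactorsList hs2.ne_zero]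
  have nd1 : l₁.Nodup := hl₁.nodup_iff.2 ((Nat.squarefree_iff_nodup_primeFactorsList hs1.ne_zero).1 hs1)
  have nd2 : l₂.Nodup := hl₂.nodup_iff.2 ((Nat.squarefree_iff_nodup_primeFactorsList hs2.ne_zero).1 hs2)
  have base := goodType_cuspType (N₀ := N) (N₁ := 1) (N₂ := 1) (by ring) hN hone
    (by rw [hone, one_pow])
  have hzero : ∀ q, q ∣ N → cuspType N 1 q = 0 := fun q hq => by simp [cuspType, hq]
  obtain ⟨e1, g1⟩ := applyList_eis (k := k) (S := S1Prime k χ) (j := 1) (l := l₁) (fun q hq t ht h0 => by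
    obtain ⟨hq1, hq2⟩ := (mem1 q).1 hq
    have hp := part_prime_eq_one hN hN1 hq1 hq2 h1
    exact ⟨S1Prime_eis hN hk hq1 (hq2.trans hN1) ht h0 hp,
      ht.update (fun _ => hp) (fun h => by simp at h)⟩) nd1 base
    (fun q hq => hzero q (((mem1 q).1 hq).2.trans hN1))
  obtain ⟨e2, -⟩ := applyList_eis (k := k) (S := S2Prime k χ) (j := 2) (l := l₂) (fun q hq t ht h0 => by
    obtain ⟨hq1, hq2⟩ := (mem2 q).1 hq
    have hp := part_prime_sq_eq_one hN hN2 hq1 hq2 h2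
    exact ⟨S2Prime_eis hN hk hq1 (hq2.trans hN2) ht h0 hp,
      ht.update (fun h => by simp at h) (fun _ => hp)⟩) nd2 g1
    (fun q hq => by
      obtain ⟨hq1, hq2⟩ := (mem2 q).1 hq
      have : q ∉ l₁ := fun hq' => by
        have := not_dvd_of_squarefree_mul hq1 (h ▸ hN) hq2
        exact this (((mem1 q).1 hq').2.mul_left _)
      simp only [if_neg this]
      exact hzero q (hq2.trans hN2))
  rw [eisRho_eq_eis (N₀ := N) (N₁ := 1) (N₂ := 1) (by ring) hN hk hχ hone (by rw [hone, one_pow]),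
    e1, e2, eisRho_eq_eis h hN hk hχ h1 h2]
  congr 1
  refine totalWeight_congr fun q hq => ?_
  have hqp := Nat.prime_of_mem_primeFactors hq
  have hd := Nat.dvd_of_mem_primeFactors hq
  simp only [mem1, mem2, hqp, true_and, hzero q hd]
  rw [← h, hqp.dvd_mul, hqp.dvd_mul] at hd
  have ct := cuspType_eq h hN hqp
  by_cases hq2 : q ∣ N₂
  · rw [if_pos hq2, ct.2.2 hq2]
  · by_cases hq1 : q ∣ N₁
    · rw [if_neg hq2, if_pos hq1, ct.2.1 hq1]
    · rw [if_neg hq2, if_neg hq1, ct.1 (by tauto)]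

/-! ### Values at the cusps -/

/-- The point `i y` on the diagonal of the upper half-space. -/
def axisPt (y : ℝ) (hy : 0 < y) : UpperHalf :=
  ⟨Matrix.diagonal fun _ => (y : ℂ) * Complex.I, by
    refine ⟨Matrix.isSymm_diagonal _, ?_⟩
    have : (Matrix.diagonal fun _ : Fin 2 => (y : ℂ) * Complex.I).map Complex.im =
        Matrix.diagonal fun _ => y := by
      rw [Matrix.diagonal_map Complex.zero_im]
      simp
    rw [this]
    exact Matrix.PosDef.diagonal fun _ => hy⟩

theorem lin_axisPt (y : ℝ) (hy : 0 < y) (p : Plucker ℝ) :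
    lin (axisPt y hy) p = ((p.e - p.a * y ^ 2 : ℝ) : ℂ) + ((y * (p.m + p.n) : ℝ) : ℂ) * Complex.I := by
  simp only [lin, axisPt, Matrix.diagonal_apply_eq, ne_eq, zero_ne_one, not_false_eq_true,
    Matrix.diagonal_apply_ne]
  push_cast
  linear_combination p.a * y ^ 2 * Complex.I_sq

/-- The quadratic relation turns the cross terms 2y²(mn - ae) into 2y²b². -/
theorem norm_sq_lin_axisPt (y : ℝ) (hy : 0 < y) {p : Plucker ℤ} (hp : p ∈ V) :
    ‖lin (axisPt y hy) p.toR‖ ^ 2 =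
      p.e ^ 2 + p.a ^ 2 * y ^ 4 + y ^ 2 * (p.m ^ 2 + p.n ^ 2 + 2 * p.b ^ 2) := by
  have h : (p.m : ℝ) * p.n = p.a * p.e + p.b ^ 2 := by exact_mod_cast hp.1
  rw [lin_axisPt, ← Complex.normSq_eq_norm_sq, Complex.normSq_add_mul_I]
  simp only [toR_a, toR_m, toR_n, toR_e]
  linear_combination 2 * y ^ 2 * h

theorem size_le_norm_lin_axisPt {y : ℝ} (hy : 1 ≤ y) {p : Plucker ℤ} (hp : p ∈ V) :
    size p ≤ ‖lin (axisPt y (by linarith)) p.toR‖ := by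
  have h := norm_sq_lin_axisPt y (by linarith) hp
  have h2 : (1 : ℝ) ≤ y ^ 2 := one_le_pow₀ hy
  have h4 : (1 : ℝ) ≤ y ^ 4 := one_le_pow₀ hy
  have ha := mul_le_mul_of_nonneg_left h4 (sq_nonneg (p.a : ℝ))
  have hr := mul_le_mul_of_nonneg_right h2
    (by positivity : (0 : ℝ) ≤ p.m ^ 2 + p.n ^ 2 + 2 * p.b ^ 2)
  simp only [size, max_le_iff]
  have := sq_nonneg (p.a : ℝ)
  have := sq_nonneg (p.b : ℝ)
  have := sq_nonneg (p.m : ℝ)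
  have := sq_nonneg (p.n : ℝ)
  have := sq_nonneg (p.e : ℝ)
  refine ⟨?_, ?_, ?_, ?_, ?_⟩ <;> refine abs_le_of_sq_le_sq ?_ (norm_nonneg _) <;> rw [h] <;> nlinarith

theorem le_norm_lin_axisPt {y : ℝ} (hy : 1 ≤ y) {p : Plucker ℤ} (hp : p ∈ V)
    (h0 : ¬ (p.a = 0 ∧ p.b = 0 ∧ p.m = 0 ∧ p.n = 0)) :
    y ≤ ‖lin (axisPt y (by linarith)) p.toR‖ := by
  have h := norm_sq_lin_axisPt y (by linarith) hp
  have h2 : (1 : ℝ) ≤ y ^ 2 := one_le_pow₀ hy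
  have key : (1 : ℤ) ≤ p.a ^ 2 + (p.m ^ 2 + p.n ^ 2 + 2 * p.b ^ 2) := by
    by_contra hlt
    have e0 : p.a ^ 2 + (p.m ^ 2 + p.n ^ 2 + 2 * p.b ^ 2) ≤ 0 := by omega
    have := sq_nonneg p.a
    have := sq_nonneg p.b
    have := sq_nonneg p.m
    have := sq_nonneg p.n
    exact h0 ⟨pow_eq_zero_iff two_ne_zero |>.1 (by linarith),
      pow_eq_zero_iff two_ne_zero |>.1 (by linarith), pow_eq_zero_iff two_ne_zero |>.1 (by linarith),
      pow_eq_zero_iff two_ne_zero |>.1 (by linarith)⟩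
  have key' : (1 : ℝ) ≤ p.a ^ 2 + (p.m ^ 2 + p.n ^ 2 + 2 * p.b ^ 2) := by exact_mod_cast key
  refine le_of_sq_le_sq ?_ (norm_nonneg _)
  rw [h]
  have ha : (p.a : ℝ) ^ 2 * y ^ 2 ≤ p.a ^ 2 * y ^ 4 := by
    have : y ^ 2 ≤ y ^ 4 := pow_le_pow_right₀ hy (by norm_num)
    exact mul_le_mul_of_nonneg_left this (sq_nonneg _)
  have := mul_le_mul_of_nonneg_left key' (by positivity : (0 : ℝ) ≤ y ^ 2)
  have := sq_nonneg (p.e : ℝ)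
  nlinarith

theorem eq_basePt_or {p : Plucker ℤ} (hp : p ∈ V)
    (h0 : p.a = 0 ∧ p.b = 0 ∧ p.m = 0 ∧ p.n = 0) : p = basePt ∨ p = -basePt := by
  obtain ⟨ha, hb, hm, hn⟩ := h0
  have hu := hp.2 p.e (by simp [ha]) (by simp [hb]) (by simp [hm]) (by simp [hn]) dvd_rfl
  rcases Int.isUnit_iff.1 hu with h | h
  · exact Or.inl (by ext <;> simp [basePt, *])
  · exact Or.inr (by ext <;> simp [basePt, *])

-- As y grows, every term except those at ± `basePt` tends to 0, uniformly dominated by `size`^(-4)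
-- for y ≥ 1; the shift by 1 ensures this range. The two surviving terms agree and cancel the factor
-- 1/2.
open Filter Topology in
theorem tendsto_eis_axisPt {k : ℕ} (hk : 4 ≤ k) {Ψ : Plucker ℤ → ℂ} (hΨ : ∀ p, ‖Ψ p‖ ≤ 1)
    (hneg : Ψ (-basePt) = (-1) ^ k * Ψ basePt) :
    Tendsto (fun n : ℕ => eis k Ψ (axisPt ((n : ℝ) + 1) (by positivity))) atTop
      (𝓝 (Ψ basePt)) := by
  classical
  set g : V → ℂ := fun p => if p.1.a = 0 ∧ p.1.b = 0 ∧ p.1.m = 0 ∧ p.1.n = 0 then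
    Ψ p.1 * (((p.1.e : ℂ)) ^ k)⁻¹ else 0 with hg
  have hlim : ∑' p, g p = 2 * Ψ basePt := by
    have hne : (⟨basePt, basePt_mem⟩ : V) ≠ ⟨-basePt, neg_mem_V basePt_mem⟩ := by
      intro h
      have := congrArg (fun p : V => p.1.e) h
      simp [basePt] at this
    rw [tsum_eq_sum (s := {⟨basePt, basePt_mem⟩, ⟨-basePt, neg_mem_V basePt_mem⟩}),
      Finset.sum_pair hne]
    · have h1 : ((-1 : ℂ) ^ k) * ((-1 : ℂ) ^ k)⁻¹ = 1 := mul_inv_cancel₀ (by simp)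
      simp only [hg, hneg]
      simp only [basePt, neg_a, neg_b, neg_m, neg_n, neg_e, neg_zero, and_self, if_true,
        Int.cast_one, one_pow, inv_one, mul_one, Int.cast_neg]
      linear_combination Ψ ⟨0, 0, 0, 0, 1⟩ * h1
    · intro p hp
      simp only [hg]
      refine if_neg fun h => hp ?_
      rw [Finset.mem_insert, Finset.mem_singleton]
      rcases eq_basePt_or p.2 h with h | h
      · exact Or.inl (Subtype.ext h)
      · exact Or.inr (Subtype.ext h)
  have main : Tendsto (fun n : ℕ => ∑' p : V, Ψ p.1 *
      (lin (axisPt ((n : ℝ) + 1) (by positivity)) p.1.toR ^ k)⁻¹) atTop (𝓝 (∑' p, g p)) := by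
    refine tendsto_tsum_of_dominated_convergence summable_size (fun p => ?_)
      (Eventually.of_forall fun n p => ?_)
    · by_cases h0 : p.1.a = 0 ∧ p.1.b = 0 ∧ p.1.m = 0 ∧ p.1.n = 0
      · have : ∀ n : ℕ, Ψ p.1 * (lin (axisPt ((n : ℝ) + 1) (by positivity)) p.1.toR ^ k)⁻¹ =
            g p := by
          intro n
          rw [lin_axisPt]
          simp [hg, h0]
        simp only [this]
        exact tendsto_const_nhds
      · have : g p = 0 := by
          simp only [hg]
          exact if_neg h0
        rw [this]
        refine squeeze_zero_norm (a := fun n : ℕ => 1 / ((n : ℝ) + 1)) (fun n => ?_)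
          tendsto_one_div_add_atTop_nhds_zero_nat
        have hn : (1 : ℝ) ≤ (n : ℝ) + 1 := by linarith [n.cast_nonneg (α := ℝ)]
        have hle := le_norm_lin_axisPt hn p.2 h0
        rw [norm_mul, norm_inv, norm_pow]
        refine (mul_le_of_le_one_left (by positivity) (hΨ _)).trans ?_
        rw [one_div]
        refine inv_anti₀ (by linarith) (hle.trans (le_self_pow₀ (hn.trans hle) (by omega)))
    · have hn : (1 : ℝ) ≤ (n : ℝ) + 1 := by linarith [n.cast_nonneg (α := ℝ)]
      have hle := size_le_norm_lin_axisPt hn p.2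
      have h1 := one_le_size p.2
      rw [norm_mul, norm_inv, norm_pow]
      refine (mul_le_of_le_one_left (by positivity) (hΨ _)).trans ?_
      exact inv_anti₀ (by positivity) ((pow_le_pow_left₀ (by linarith) hle 4).trans
        (pow_le_pow_right₀ (h1.trans hle) hk))
  have h2 := main.const_mul (2⁻¹ : ℂ)
  rw [hlim, inv_mul_cancel_left₀ two_ne_zero] at h2
  exact h2

/-! ### The basis for the trivial character -/

section

/-- The slash operator at a point, as a linear functional. -/
def slashLin (k : ℕ) (g : Mat4R) (τ : UpperHalf) : (UpperHalf → ℂ) →ₗ[ℂ] ℂ where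
  toFun f := slash k f g τ
  map_add' f f' := slash_add k f f' g τ
  map_smul' c f := by
    simp only [slash]
    split_ifs
    · exact mul_left_comm _ _ _
    · simp

theorem part_one {N : ℕ} (hN : Squarefree N) {d : ℕ} (hd : d ∣ N) :
    part (1 : DirichletCharacter ℂ N) d = 1 := by
  ext u
  have : NeZero d := ⟨ne_zero_of_dvd_ne_zero hN.ne_zero hd⟩
  obtain ⟨y, hy1, hy2⟩ := exists_congr_congr_one (coprime_div hN hd) (((u : ZMod d).val : ℕ) : ℤ)
  have h := part_apply hN hd (1 : DirichletCharacter ℂ N) hy1 hy2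
  have e : (((((u : ZMod d).val : ℕ) : ℤ)) : ZMod d) = u := by simp
  rw [e] at h
  have hne : part (1 : DirichletCharacter ℂ N) d u ≠ 0 := (u.isUnit.map _).ne_zero
  rw [MulChar.one_apply_coe, h, MulChar.one_apply]
  by_contra hu
  rw [h, MulChar.map_nonunit _ hu] at hne
  exact hne rfl

/-- Slashing by γ⁻¹ turns the weight function into p ↦ `totalWeight χ t (act γ p)`, whose value at
`basePt` is the one at the plane of γ. -/
theorem tendsto_slash_eis {N k : ℕ} (hN : Squarefree N) (hk : 4 ≤ k) {χ : DirichletCharacter ℂ N}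
    (hχ : χ (-1) = (-1) ^ k) {t : ℕ → Fin 3} (ht : GoodType χ t) (γ : Sp2Z) :
    Filter.Tendsto (fun n : ℕ => slash k (eis k (totalWeight χ t)) (toReal γ⁻¹)
      (axisPt ((n : ℝ) + 1) (by positivity))) Filter.atTop (nhds (totalWeight χ t (pl γ))) := by
  simp only [slash_eis_toReal, inv_inv]
  refine tendsto_eis_axisPt hk (fun p => norm_totalWeight_le _ _ _) ?_
  rw [act_neg, totalWeight_neg hN ht, hχ]

theorem HasType.dvd_of_prime {N N₀ N₁ N₂ N₀' N₁' N₂' : ℕ} (h : N₀ * N₁ * N₂ = N)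
    (h' : N₀' * N₁' * N₂' = N) {p : Plucker ℤ} (hp : HasType N₀ N₁ N₂ p)
    (hp' : HasType N₀' N₁' N₂' p) {q : ℕ} (hq : q.Prime) :
    (q ∣ N₁ → q ∣ N₁') ∧ (q ∣ N₂ → q ∣ N₂') := by
  obtain ⟨-, b, c⟩ := hp
  obtain ⟨a', b', c'⟩ := hp'
  constructor <;> intro hd
  · have hN : q ∣ N₀' * N₁' * N₂' := h'.trans h.symm ▸ (hd.mul_left _).mul_right _
    rw [hq.dvd_mul, hq.dvd_mul] at hN
    rcases hN with (hN | hN) | hN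
    · exact absurd (a' q hq hN) (b q hq hd).2
    · exact hN
    · exact absurd (b q hq hd).1 (c' q hq hN)
  · have hN : q ∣ N₀' * N₁' * N₂' := h'.trans h.symm ▸ hd.mul_left _
    rw [hq.dvd_mul, hq.dvd_mul] at hN
    rcases hN with (hN | hN) | hN
    · exact absurd (a' q hq hN).1 (c q hq hd)
    · exact absurd (b' q hq hN).1 (c q hq hd)
    · exact hN

theorem HasType.unique {N N₀ N₁ N₂ N₀' N₁' N₂' : ℕ} (hN : Squarefree N) (h : N₀ * N₁ * N₂ = N)
    (h' : N₀' * N₁' * N₂' = N) {p : Plucker ℤ} (hp : HasType N₀ N₁ N₂ p)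
    (hp' : HasType N₀' N₁' N₂' p) : N₁ = N₁' ∧ N₂ = N₂' := by
  have aux : ∀ {n n' : ℕ}, n ∣ N → (∀ q : ℕ, q.Prime → q ∣ n → q ∣ n') → n ∣ n' := by
    intro n n' hn hq
    have := dvd_of_squarefree (hN.squarefree_of_dvd hn) (x := n')
      fun q h1 h2 => by exact_mod_cast hq q h1 h2
    exact_mod_cast this
  have d1 : N₁ ∣ N := ⟨N₀ * N₂, by rw [← h]; ring⟩
  have d2 : N₂ ∣ N := ⟨N₀ * N₁, by rw [← h]; ring⟩
  have d1' : N₁' ∣ N := ⟨N₀' * N₂', by rw [← h']; ring⟩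
  have d2' : N₂' ∣ N := ⟨N₀' * N₁', by rw [← h']; ring⟩
  exact ⟨Nat.dvd_antisymm (aux d1 fun q hq => (hp.dvd_of_prime h h' hp' hq).1)
      (aux d1' fun q hq => (hp'.dvd_of_prime h' h hp hq).1),
    Nat.dvd_antisymm (aux d2 fun q hq => (hp.dvd_of_prime h h' hp' hq).2)
      (aux d2' fun q hq => (hp'.dvd_of_prime h' h hp hq).2)⟩

theorem exists_hasType {N : ℕ} (hN : Squarefree N) (p : Plucker ℤ) :
    ∃ N₀ N₁ N₂ : ℕ, N₀ * N₁ * N₂ = N ∧ HasType N₀ N₁ N₂ p := by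
  classical
  have hdvd : ∀ (P : ℕ → Prop) [DecidablePred P] (q : ℕ), q.Prime → q ∣ ∏ l ∈ N.primeFactors.filter P, l → P q := by
    intro P _ q hq hd
    obtain ⟨l, hl, hql⟩ := (Prime.dvd_finsetProd_iff hq.prime _).1 hd
    obtain ⟨hl1, hl2⟩ := Finset.mem_filter.1 hl
    rwa [(Nat.prime_dvd_prime_iff_eq hq (Nat.prime_of_mem_primeFactors hl1)).1 hql]
  refine ⟨∏ l ∈ N.primeFactors.filter (fun q => RankZero q p), l,
    ∏ l ∈ N.primeFactors.filter (fun q => ¬ RankZero q p ∧ (q : ℤ) ∣ p.a), l,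
    ∏ l ∈ N.primeFactors.filter (fun q => ¬ RankZero q p ∧ ¬ (q : ℤ) ∣ p.a), l, ?_,
    hdvd _, fun q hq hd => And.symm (hdvd (fun q => ¬ RankZero q p ∧ (q : ℤ) ∣ p.a) q hq hd),
    fun q hq hd => And.right (hdvd (fun q => ¬ RankZero q p ∧ ¬ (q : ℤ) ∣ p.a) q hq hd)⟩
  rw [mul_assoc, ← Finset.filter_filter, ← Finset.filter_filter,
    Finset.prod_filter_mul_prod_filter_not, Finset.prod_filter_mul_prod_filter_not,
    Nat.prod_primeFactors_of_squarefree hN]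

/-- For the trivial character all local factors are indicator functions. -/
theorem totalWeight_one_eq_one {N : ℕ} (hN : Squarefree N) {t : ℕ → Fin 3} {p : Plucker ℤ}
    (h : totalWeight (1 : DirichletCharacter ℂ N) t p ≠ 0) :
    totalWeight (1 : DirichletCharacter ℂ N) t p = 1 := by
  classical
  refine Finset.prod_eq_one fun q hq => ?_
  have hw := Finset.prod_ne_zero_iff.1 h q hq
  have hone : ∀ x : ZMod q, (1 : DirichletCharacter ℂ q) x = 0 ∨ (1 : DirichletCharacter ℂ q) x = 1 := by
    intro x
    by_cases hx : IsUnit x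
    · exact Or.inr (MulChar.one_apply hx)
    · exact Or.inl (MulChar.map_nonunit _ hx)
  generalize t q = j at hw ⊢
  fin_cases j <;>
    simp only [weight, part_one hN (Nat.dvd_of_mem_primeFactors hq)] at hw ⊢
  · split_ifs at hw ⊢
    · rcases hone (p.e : ZMod q) with h | h <;> rw [h] at hw ⊢ <;> simp at hw ⊢
    · exact absurd rfl hw
  · split_ifs at hw ⊢
    · rfl
    · exact absurd rfl hw
  · exact (hone _).resolve_left hw

variable {N k : ℕ}

theorem goodType_one (hN : Squarefree N) (t : ℕ → Fin 3) :
    GoodType (1 : DirichletCharacter ℂ N) t := fun q hq => by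
  simp [part_one hN (Nat.dvd_of_mem_primeFactors hq)]

/-- The limits at the standard cusps form an identity matrix: each series has value 1 at its own
cusp and 0 at a cusp of another type. -/
theorem linearIndependent_eisRho (hN : Squarefree N) (hk : 4 ≤ k)
    (hχ : (1 : DirichletCharacter ℂ N) (-1) = (-1) ^ k) :
    LinearIndependent ℂ (fun d : {d : ℕ × ℕ // d.1 * d.2 ∣ N} =>
      eisRho k (1 : DirichletCharacter ℂ N) (N / (d.1.1 * d.1.2)) d.1.1 d.1.2) := by
  have hmul : ∀ d : {d : ℕ × ℕ // d.1 * d.2 ∣ N}, N / (d.1.1 * d.1.2) * d.1.1 * d.1.2 = N :=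
    fun d => by rw [mul_assoc, Nat.div_mul_cancel d.2]
  rw [linearIndependent_iff']
  intro s c hc d₀ hd₀
  set γ := cuspRep (N / (d₀.1.1 * d₀.1.2)) d₀.1.1 d₀.1.2 with hγ
  have hE : ∀ d : {d : ℕ × ℕ // d.1 * d.2 ∣ N},
      eisRho k (1 : DirichletCharacter ℂ N) (N / (d.1.1 * d.1.2)) d.1.1 d.1.2 =
        eis k (totalWeight 1 (cuspType (N / (d.1.1 * d.1.2)) d.1.1)) := fun d =>
    eisRho_eq_eis (hmul d) hN hk hχ (part_one hN ((dvd_mul_right _ _).trans d.2))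
      (by rw [part_one hN ((dvd_mul_left _ _).trans d.2), one_pow])
  have hlim := tendsto_finsetSum s fun d _ => (tendsto_slash_eis hN hk hχ
    (goodType_one hN (cuspType (N / (d.1.1 * d.1.2)) d.1.1)) γ).const_mul (c d)
  have hz : ∀ n : ℕ, ∑ d ∈ s, c d * slash k
      (eis k (totalWeight (1 : DirichletCharacter ℂ N) (cuspType (N / (d.1.1 * d.1.2)) d.1.1)))
        (toReal γ⁻¹) (axisPt ((n : ℝ) + 1) (by positivity)) = 0 := by
    intro n
    have := congrArg (slashLin k (toReal γ⁻¹) (axisPt ((n : ℝ) + 1) (by positivity))) hc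
    simp only [map_sum, map_smul, map_zero, hE, smul_eq_mul] at this
    exact this
  simp only [hz] at hlim
  have h1 := tendsto_nhds_unique hlim tendsto_const_nhds
  rw [Finset.sum_eq_single_of_mem d₀ hd₀, hγ, totalWeight_cuspRep (hmul d₀) hN, mul_one] at h1
  · exact h1
  · intro d _ hne
    by_contra h
    have h2 := (totalWeight_ne_zero_iff (hmul d) hN 1 (pl_mem γ)).1 (right_ne_zero_of_mul h)
    obtain ⟨e1, e2⟩ := h2.unique hN (hmul d) (hmul d₀) (hasType_cuspRep (hmul d₀) hN)
    exact hne (Subtype.ext (Prod.ext e1 e2))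

/-- The plane of any γ₀ has some type, and its weight is 1. So the series of γ₀ is equal, not merely
proportional, to the one at the standard cusp of that type. -/
theorem span_eisRho (hN : Squarefree N) (hk : 4 ≤ k)
    (hχ : (1 : DirichletCharacter ℂ N) (-1) = (-1) ^ k) :
    Submodule.span ℂ (Set.range fun d : {d : ℕ × ℕ // d.1 * d.2 ∣ N} =>
      eisRho k (1 : DirichletCharacter ℂ N) (N / (d.1.1 * d.1.2)) d.1.1 d.1.2) =
      eisSpace k (1 : DirichletCharacter ℂ N) := by
  apply le_antisymm
  · rw [Submodule.span_le]
    rintro _ ⟨d, rfl⟩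
    refine Submodule.subset_span ⟨_, fun q hq hqN _ => ?_, rfl⟩
    rw [part_one hN hqN, one_pow]
  · rw [eisSpace, Submodule.span_le]
    rintro _ ⟨γ₀, -, rfl⟩
    obtain ⟨N₀, N₁, N₂, h, ht⟩ := exists_hasType hN (pl γ₀)
    have hd : N₁ * N₂ ∣ N := ⟨N₀, by rw [← h]; ring⟩
    have hN₀ : N / (N₁ * N₂) = N₀ := by
      have hpos : 0 < N₁ * N₂ := Nat.pos_of_dvd_of_pos hd (Nat.pos_of_ne_zero hN.ne_zero)
      rw [← h, mul_assoc, Nat.mul_div_cancel _ hpos]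
    refine Submodule.subset_span ⟨⟨(N₁, N₂), hd⟩, ?_⟩
    simp only [hN₀]
    rw [eisRho_eq_eis h hN hk hχ (part_one hN ((dvd_mul_right _ _).trans hd))
      (by rw [part_one hN ((dvd_mul_left _ _).trans hd), one_pow]),
      eisenstein_eq_eis_totalWeight h hN hk hχ (goodType_one hN _)
        (totalWeight_one_eq_one hN ((totalWeight_ne_zero_iff h hN 1 (pl_mem γ₀)).2 ht))]

end

end SiegelEisenstein

end

/-! ### The theorem -/

open SiegelEisenstein in
theorem theorem3p12 (N : ℕ) (hN : Squarefree N) (k : ℕ) (hk : 4 ≤ k)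
    (χ : DirichletCharacter ℂ N) (hχ : χ (-1) = (-1) ^ k) :
    (∀ N₀ N₁ N₂ : ℕ, N₀ * N₁ * N₂ = N → part χ N₁ = 1 → part χ N₂ ^ 2 = 1 →
      eisRho k χ N₀ N₁ N₂ = S2 k χ N₂ (S1 k χ N₁ (eisRho k χ N 1 1)) ∧
      -- the order of the prime factors in `S₁(N₁)` and in `S₂(N₂)` does not matter
      ∀ l₁ l₂ : List ℕ, l₁.Perm N₁.primeFactorsList → l₂.Perm N₂.primeFactorsList →
        eisRho k χ N₀ N₁ N₂ =
          applyList (S2Prime k χ) l₂ (applyList (S1Prime k χ) l₁ (eisRho k χ N 1 1))) ∧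
    (χ = 1 →
      LinearIndependent ℂ (fun d : {d : ℕ × ℕ // d.1 * d.2 ∣ N} =>
        S2 k χ d.1.2 (S1 k χ d.1.1 (eisRho k χ N 1 1))) ∧
      Submodule.span ℂ (Set.range (fun d : {d : ℕ × ℕ // d.1 * d.2 ∣ N} =>
        S2 k χ d.1.2 (S1 k χ d.1.1 (eisRho k χ N 1 1)))) = eisSpace k χ) := by
  refine ⟨fun N₀ N₁ N₂ h h1 h2 => ⟨eisRho_eq_applyList hN hk hχ h h1 h2 (.refl _) (.refl _),
    fun l₁ l₂ hl₁ hl₂ => eisRho_eq_applyList hN hk hχ h h1 h2 hl₁ hl₂⟩, ?_⟩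
  intro h1
  have hp : ∀ d, d ∣ N → part χ d = 1 := fun d hd => by rw [h1, part_one hN hd]
  have hfun : (fun d : {d : ℕ × ℕ // d.1 * d.2 ∣ N} =>
      S2 k χ d.1.2 (S1 k χ d.1.1 (eisRho k χ N 1 1))) =
      fun d => eisRho k χ (N / (d.1.1 * d.1.2)) d.1.1 d.1.2 := by
    funext d
    refine (eisRho_eq_applyList hN hk hχ ?_ (hp _ ((dvd_mul_right _ _).trans d.2)) ?_
      (.refl _) (.refl _)).symm
    · rw [mul_assoc, Nat.div_mul_cancel d.2]
    · rw [hp _ ((dvd_mul_left _ _).trans d.2), one_pow]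
  rw [hfun]
  subst h1
  exact ⟨linearIndependent_eisRho hN hk hχ, span_eisRho hN hk hχ⟩
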